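/- Let $\mathbb K$ be a field containing $\mathbb C(r,s)$, with $r,s$ algebraically independent over $\mathbb C$ (for instance an algebraically closed one), and fix $r^{1/2},s^{1/2}\in\mathbb K$; put $(rs)^{1/2}=r^{1/2}s^{1/2}$. Let $n\ge 3$. **The algebra.** Let $\alpha_1,\dots,\alpha_n$ be the simple roots of type $D_n$ ($\alpha_i=\varepsilon_i-\varepsilon_{i+1}$ for $i<n$, $\alpha_n=\varepsilon_{n-1}+\varepsilon_n$), let $\theta=\sum_i\theta_i\alpha_i=\varepsilon_1+\varepsilon_2$ be the highest root, and let $\langle\cdot,\cdot\rangle$ be the bilinear form on the root lattice with $\langle\alpha_i,\alpha_i\rangle=1$, $\langle\alpha_i,\alpha_j\rangle=(\alpha_i,\alpha_j)$ for $i<j$, $\langle\alpha_i,\alpha_j\rangle=0$ for $i>j$, except that $\langle\alpha_{n-1},\alpha_n\rangle=-1$, $\langle\alpha_n,\alpha_{n-1}\rangle=1$. For $0\le i,j\le n$ set $\Omega_{ij}=r^{\langle\alpha_i,\alpha_j\rangle}s^{-\langle\alpha_j,\alpha_i\rangle}$ and $c_{ij}=2(\alpha_i,\alpha_j)/(\alpha_i,\alpha_i)$,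 where $\alpha_0$ is read as $-\theta$. Let $U'=U'_{r,s}(\widehat{\mathfrak{so}}_{2n})$ be the $\mathbb K$-algebra generated by $e_i,f_i,\omega_i^{\pm1},(\omega_i')^{\pm1}$ $(0\le i\le n)$ and $\gamma^{\pm1},(\gamma')^{\pm1}$ with relations: the $\omega_i,\omega'_i$ are invertible and commute with each other; $\gamma=\omega_0\prod_{i=1}^n\omega_i^{\theta_i}$ and $\gamma'=\omega'_0\prod_{i=1}^n(\omega'_i)^{\theta_i}$ are central; $$\omega_ie_j=\Omega_{ji}e_j\omega_i,\quad \omega_if_j=\Omega_{ji}^{-1}f_j\omega_i,\quad \omega'_ie_j=\Omega_{ij}^{-1}e_j\omega'_i,\quad \omega'_if_j=\Omega_{ij}f_j\omega'_i,\quad [e_i,f_j]=\delta_{ij}\frac{\omega_i-\omega'_i}{r-s};$$ and for $i\ne j$, with $m=1-c_{ij}$ and $\lambda_k=(-1)^k\binom{m}{k}_{r,s}(rs)^{k(k-1)/2}\Omega_{ji}^k s^{kc_{ij}}$, $$\sum_{k=0}^m\lambda_k\,e_i^{m-k}e_je_i^k=0,\qquad \sum_{k=0}^m\lambda_k\,f_i^{k}f_jf_i^{m-k}=0.$$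 Here $\binom{m}{k}_{r,s}$ is the Gaussian binomial coefficient built from $[m]_{r,s}=(r^m-s^m)/(r-s)$. Let $U=U_{r,s}(\widehat{\mathfrak{so}}_{2n})$ be the algebra generated by $U'$ and commuting invertible $D,D'$ which commute with all $\omega_i,\omega_i'$ and satisfy $De_iD^{-1}=r^{\delta_{0i}}e_i$, $Df_iD^{-1}=r^{-\delta_{0i}}f_i$, $D'e_i(D')^{-1}=s^{\delta_{0i}}e_i$, $D'f_i(D')^{-1}=s^{-\delta_{0i}}f_i$. Both carry the coproduct $\Delta(e_i)=e_i\otimes1+\omega_i\otimes e_i$, $\Delta(f_i)=1\otimes f_i+f_i\otimes\omega'_i$, for which the other generators are group-like. **The modules.** Let $V=\mathbb K^{2n}$ with matrix units $E_{ij}$, and $i'=2n+1-i$. For $a,b,u\in\mathbb K^\times$ and $c=rs\,ab$, the evaluation module $V(u)=V$ of $U'$ is given by $\gamma,\gamma'\mapsto c$, $$e_0\mapsto au(E_{1'2}-rsE_{2'1}),\quad f_0\mapsto bu^{-1}(E_{21'}-E_{12'}),\quad e_n\mapsto (rs)^{-1}E_{n-1,n'}-E_{n,(n-1)'},\quad f_n\mapsto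 E_{n',n-1}-E_{(n-1)',n},$$ $$e_i\mapsto E_{i,i+1}-E_{(i+1)',i'},\qquad f_i\mapsto E_{i+1,i}-(rs)^{-1}E_{i',(i+1)'}\qquad(1\le i<n),$$ $$\omega_0\mapsto c\Big(sE_{11}+r^{-1}E_{22}+rE_{2'2'}+s^{-1}E_{1'1'}+\sum_{j=3}^n(r^{-1}s^{-1}E_{jj}+rsE_{j'j'})\Big),$$ $$\omega_i\mapsto rE_{ii}+sE_{i+1,i+1}+r^{-1}E_{i'i'}+s^{-1}E_{(i+1)'(i+1)'}+\sum_{1\le j\le n,\ j\ne i,i+1}(E_{jj}+E_{j'j'})\qquad(1\le i<n),$$ $$\omega_n\mapsto s^{-1}E_{n-1,n-1}+rE_{nn}+sE_{(n-1)'(n-1)'}+r^{-1}E_{n'n'}+\sum_{j=1}^{n-2}(r^{-1}s^{-1}E_{jj}+rsE_{j'j'}),$$ and $\omega'_i$ is obtained from the formula for $\omega_i$ by exchanging $r$ and $s$ (with $c$ fixed). For an indeterminate $u$ the same formulas on $V(u)=V\otimes\mathbb K[u,u^{-1}]$, together with $D(vu^k)=r^kvu^k$, $D'(vu^k)=s^kvu^k$,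 define a $U$-module. Denote these representations by $\rho^{a,b}_u$. **The operator.** Let $\xi=r^{-n+1}s^{n-1}$; $\sigma_i=1$, $t_i=s^{i-n}$ for $i\le n$ and $\sigma_i=-1$, $t_i=r^{n+1-i}$ for $i>n$. Put $$\begin{aligned}\hat R(z)={}&(z-r^{-1}s)(z-\xi)\sum_iE_{ii}\otimes E_{ii}+\sum_{j\ne i,i'}a_{ij}(z)E_{ij}\otimes E_{ji}+(1-r^{-1}s)(z-\xi)\sum_{i>j,\ j\ne i'}E_{ii}\otimes E_{jj}\\&+(1-r^{-1}s)z(z-\xi)\sum_{i<j,\ j\ne i'}E_{ii}\otimes E_{jj}+\sum_{i,j}b_{ij}(z)E_{i'j}\otimes E_{ij'},\end{aligned}$$ all indices running over $1,\dots,2n$, where $a_{ij}(z)=r^{-1/2}s^{1/2}(z-1)(z-\xi)(rs)^{\mp\frac12\sigma_i\sigma_j}$ with sign $-$ if $i<j,j'$ or $i>j,j'$ and sign $+$ if $j<i<j'$ or $j'<i<j$, and $$b_{ij}(z)=\begin{cases}(r^{-1}sz-\xi)(z-1)& i=j,\\(r^{-1}s-1)\big(\xi t_it_j^{-1}(z-1)-\delta_{ij'}(z-\xi)\big)&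 i<j,\\(r^{-1}s-1)z\big(t_it_j^{-1}(z-1)-\delta_{ij'}(z-\xi)\big)& i>j.\end{cases}$$ **Theorem.** (a) If $ab=(rs)^{-1}$, then $\hat R(u/v)\circ(\rho^{a,b}_u\otimes\rho^{a,b}_v)(x)=(\rho^{a,b}_v\otimes\rho^{a,b}_u)(x)\circ\hat R(u/v)$ as maps $V(u)\otimes V(v)\to V(v)\otimes V(u)$: for all $x\in U$ when $u,v$ are indeterminates, and for all $x\in U'$ when $u,v\in\mathbb K^\times$. (b) Let $\tau$ be the flip of $V\otimes V$ and $R(z)=\hat R(z)\circ\tau$. For all $u,v,w\in\mathbb K^\times$, $$R_{12}(v/w)R_{13}(u/w)R_{23}(u/v)=R_{23}(u/v)R_{13}(u/w)R_{12}(v/w),$$ $$\hat R_{12}(v/w)\hat R_{23}(u/w)\hat R_{12}(u/v)=\hat R_{23}(u/v)\hat R_{12}(u/w)\hat R_{23}(v/w)$$ on $V\otimes V\otimes V$, where the indices name the tensor factors on which the operator acts and $R_{13}=(\mathrm{Id}\otimes\tau)R_{12}(\mathrm{Id}\otimes\tau)$. -/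

import Mathlib

open scoped TensorProduct LaurentPolynomial Kronecker

noncomputable section

namespace TwoParam

set_option linter.unusedSectionVars false
set_option linter.unusedSimpArgs false

/-- The two indeterminates `r, s` of the ground field: elements of `K` which are algebraically
independent over `ℂ`, so that `ℂ(r,s) ⊆ K`. -/
structure Params (K : Type*) [Field K] [Algebra ℂ K] where
  r : K
  s : K
  indep : AlgebraicIndependent ℂ ![r, s]

/-! ### The root system of type `D_n`

Simple roots are numbered `1, …, n` as in `α_i = ε_i - ε_{i+1}` for `i < n` and
`α_n = ε_{n-1} + ε_n`. All roots have square length `2`. -/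

/-- The Cartan matrix of type `D_n`, that is the Gram matrix `(α_i, α_j)`. -/
def cartanD (n i j : ℕ) : ℤ :=
  if i = j then 2
  else if (i + 1 = j ∧ j < n) ∨ (j + 1 = i ∧ i < n) then -1
  else if (i + 2 = j ∧ j = n) ∨ (j + 2 = i ∧ i = n) then -1
  else 0

/-- The modified Ringel form `⟨α_i, α_j⟩` on the simple roots. -/
def ringel (n i j : ℕ) : ℤ :=
  if i + 1 = n ∧ j = n then -1
  else if i = n ∧ j + 1 = n then 1
  else if i < j then cartanD n i j
  else if i = j then 1
  else 0

/-- The Ringel form on the root lattice; `x` stands for `∑ x_i α_i`. -/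
def ringelForm (n : ℕ) (x y : ℕ → ℤ) : ℤ :=
  ∑ i ∈ Finset.Icc 1 n, ∑ j ∈ Finset.Icc 1 n, x i * y j * ringel n i j

/-- The coefficients of the highest root
`θ = ε_1 + ε_2 = α_1 + 2 α_2 + ⋯ + 2 α_{n-2} + α_{n-1} + α_n`. -/
def highestRoot (n i : ℕ) : ℕ :=
  if i = 1 ∨ i + 1 = n ∨ i = n then 1 else 2

/-- The affine simple roots modulo `δ`: `-θ` for `i = 0`, and `α_i` for `i = 1, …, n`. -/
def affRoot (n i : ℕ) : ℕ → ℤ :=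
  fun k => if i = 0 then -(highestRoot n k : ℤ) else if k = i then 1 else 0

/-- `⟨α_i, α_j⟩` for `0 ≤ i, j ≤ n`, where `α_0` is read as `-θ`. -/
def affRingel (n i j : ℕ) : ℤ := ringelForm n (affRoot n i) (affRoot n j)

/-- The extended Cartan matrix `c_ij = 2 (α_i, α_j) / (α_i, α_i)`, `0 ≤ i, j ≤ n`, through the
symmetrization `(μ, ν) = ⟨μ, ν⟩ + ⟨ν, μ⟩` of the Ringel form. -/
def affCartan (n i j : ℕ) : ℤ :=
  2 * (affRingel n i j + affRingel n j i) / (affRingel n i i + affRingel n i i)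

section RootLemmas

variable {n : ℕ}

theorem ringel_left (hn : 3 ≤ n) {j k : ℕ} (hk : 1 ≤ k) (hjn : j ≤ n) (hkn : k ≤ n) :
    ringel n k j = (if k = j then 1 else 0) - (if k = j - 1 then 1 else 0)
      - (if k = n - 2 then (if j = n then 1 else 0) else 0)
      + (if k = n then (if j + 1 = n then 1 else 0) else 0) := by
  unfold ringel cartanD
  grind (splits := 40)

theorem ringel_right (hn : 3 ≤ n) {j k : ℕ} (hjn : j ≤ n) (hkn : k ≤ n) :
    ringel n j k = (if k = j then 1 else 0) - (if k = j + 1 then 1 else 0)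
      - (if k = n then (if j + 2 = n then 1 else 0) else 0)
      + (if k = n - 1 then (if j = n then 1 else 0) else 0) := by
  unfold ringel cartanD
  grind (splits := 40)

theorem sum_ringel_left (hn : 3 ≤ n) (x : ℕ → ℤ) {j : ℕ} (hj : 1 ≤ j) (hjn : j ≤ n) :
    ∑ k ∈ Finset.Icc 1 n, x k * ringel n k j =
      x j - (if 1 < j then x (j - 1) else 0) - (if j = n then x (n - 2) else 0)
      + (if j + 1 = n then x n else 0) := by
  rw [Finset.sum_congr rfl (fun k hk => by
    rw [ringel_left hn (Finset.mem_Icc.1 hk).1 hjn (Finset.mem_Icc.1 hk).2])]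
  simp only [mul_add, mul_sub, Finset.sum_add_distrib, Finset.sum_sub_distrib, mul_ite, mul_one,
    mul_zero, Finset.sum_ite_eq', Finset.mem_Icc]
  grind (splits := 40)

theorem sum_ringel_right (hn : 3 ≤ n) (x : ℕ → ℤ) {j : ℕ} (hj : 1 ≤ j) (hjn : j ≤ n) :
    ∑ k ∈ Finset.Icc 1 n, x k * ringel n j k =
      x j - (if j < n then x (j + 1) else 0) - (if j + 2 = n then x n else 0)
      + (if j = n then x (n - 1) else 0) := by
  rw [Finset.sum_congr rfl (fun k hk => by
    rw [ringel_right hn hjn (Finset.mem_Icc.1 hk).2])]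
  simp only [mul_add, mul_sub, Finset.sum_add_distrib, Finset.sum_sub_distrib, mul_ite, mul_one,
    mul_zero, Finset.sum_ite_eq', Finset.mem_Icc]
  grind (splits := 40)

theorem ringelForm_right (x : ℕ → ℤ) {j : ℕ} (hj : 1 ≤ j) (hjn : j ≤ n) :
    ringelForm n x (affRoot n j) = ∑ k ∈ Finset.Icc 1 n, x k * ringel n k j := by
  unfold ringelForm affRoot
  refine Finset.sum_congr rfl fun k _ => ?_
  have h0 : j ≠ 0 := by omega
  simp [h0, hj, hjn]

theorem ringelForm_left (x : ℕ → ℤ) {j : ℕ} (hj : 1 ≤ j) (hjn : j ≤ n) :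
    ringelForm n (affRoot n j) x = ∑ k ∈ Finset.Icc 1 n, x k * ringel n j k := by
  unfold ringelForm affRoot
  rw [Finset.sum_comm]
  refine Finset.sum_congr rfl fun k _ => ?_
  have h0 : j ≠ 0 := by omega
  simp [h0, hj, hjn]

theorem affRingel_pos {i j : ℕ} (hi : 1 ≤ i) (hin : i ≤ n) (hj : 1 ≤ j) (hjn : j ≤ n) :
    affRingel n i j = ringel n i j := by
  unfold affRingel
  rw [ringelForm_right _ hj hjn]
  have h0 : i ≠ 0 := by omega
  simp [affRoot, h0, hi, hin]

theorem affRingel_zero_left (hn : 3 ≤ n) {j : ℕ} (hj : 1 ≤ j) (hjn : j ≤ n) :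
    affRingel n 0 j = (if j = n then (if n = 3 then 1 else 2) else if j = 1 ∨ j = 2 then -1
      else 0) := by
  unfold affRingel
  rw [ringelForm_right _ hj hjn, sum_ringel_left hn _ hj hjn]
  simp only [affRoot, highestRoot, if_true, Nat.cast_ite, Nat.cast_one,
    Nat.cast_ofNat, or_true]
  grind (splits := 40)

theorem affRingel_zero_right (hn : 3 ≤ n) {j : ℕ} (hj : 1 ≤ j) (hjn : j ≤ n) :
    affRingel n j 0 = (if j = n then -2 else if j = 1 then 1 else 0) := by
  unfold affRingel
  rw [ringelForm_left _ hj hjn, sum_ringel_right hn _ hj hjn]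
  simp only [affRoot, highestRoot, if_true, Nat.cast_ite, Nat.cast_one,
    Nat.cast_ofNat, or_true]
  grind (splits := 40)

theorem affRingel_zero_zero (hn : 3 ≤ n) : affRingel n 0 0 = 1 := by
  have h : affRingel n 0 0 = ∑ i ∈ Finset.Icc 1 n, affRoot n 0 i * affRingel n i 0 := by
    unfold affRingel
    conv_lhs => unfold ringelForm
    refine Finset.sum_congr rfl fun i hi => ?_
    rw [ringelForm_left _ (Finset.mem_Icc.1 hi).1 (Finset.mem_Icc.1 hi).2, Finset.mul_sum]
    exact Finset.sum_congr rfl fun j _ => by ring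
  have h2 : ∀ i ∈ Finset.Icc 1 n, affRoot n 0 i * affRingel n i 0 =
      (if i = n then 2 else 0) - (if i = 1 then 1 else 0) := by
    intro i hi
    rw [Finset.mem_Icc] at hi
    rw [affRingel_zero_right hn hi.1 hi.2]
    simp only [affRoot, highestRoot, if_true, Nat.cast_ite, Nat.cast_one,
    Nat.cast_ofNat, or_true]
    grind (splits := 40)
  rw [h, Finset.sum_congr rfl h2, Finset.sum_sub_distrib, Finset.sum_ite_eq', Finset.sum_ite_eq']
  simp only [Finset.mem_Icc]
  grind (splits := 40)

/-- `⟨α_i, α_j⟩` in closed form. -/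
theorem affRingel_eq (hn : 3 ≤ n) {i j : ℕ} (hi : i ≤ n) (hj : j ≤ n) :
    affRingel n i j =
      if i = 0 then
        if j = 0 then 1
        else if j = n then (if n = 3 then 1 else 2) else if j = 1 ∨ j = 2 then -1 else 0
      else if j = 0 then (if i = n then -2 else if i = 1 then 1 else 0)
      else ringel n i j := by
  by_cases h0 : i = 0 <;> by_cases h1 : j = 0
  · subst h0 h1; simp [affRingel_zero_zero hn]
  · subst h0; rw [affRingel_zero_left hn (by omega) hj]; simp [h1]
  · subst h1; rw [affRingel_zero_right hn (by omega) hi]; simp [h0]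
  · rw [affRingel_pos (by omega) hi (by omega) hj]; simp [h0, h1]

theorem affRingel_self (hn : 3 ≤ n) {i : ℕ} (hi : i ≤ n) : affRingel n i i = 1 := by
  rw [affRingel_eq hn hi hi]
  unfold ringel
  grind (splits := 40)

theorem affCartan_eq (hn : 3 ≤ n) {i : ℕ} (hi : i ≤ n) (j : ℕ) :
    affCartan n i j = affRingel n i j + affRingel n j i := by
  unfold affCartan
  rw [affRingel_self hn hi]
  omega

theorem affCartan_cases (hn : 3 ≤ n) {i j : ℕ} (hi : i ≤ n) (hj : j ≤ n) (hij : i ≠ j) :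
    affCartan n i j = 0 ∨ affCartan n i j = -1 := by
  rw [affCartan_eq hn hi, affRingel_eq hn hi hj, affRingel_eq hn hj hi]
  unfold ringel cartanD
  grind (splits := 40)

end RootLemmas

/-! ### The two-parameter quantum affine algebra of type `D_n` -/

section Algebra

variable {K : Type*} [Field K] [Algebra ℂ K] (P : Params K)

theorem Params.r_ne_zero : P.r ≠ 0 := by
  have := P.indep.ne_zero 0
  simpa using this

theorem Params.s_ne_zero : P.s ≠ 0 := by
  have := P.indep.ne_zero 1
  simpa using this

theorem Params.sq_ne_sq : P.r ^ 2 ≠ P.s ^ 2 := by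
  intro h
  have h2 : (MvPolynomial.X 0 ^ 2 - MvPolynomial.X 1 ^ 2 : MvPolynomial (Fin 2) ℂ) = 0 := by
    apply P.indep.eq_zero_of_aeval_eq_zero
    simp [h]
  have h3 := congrArg (MvPolynomial.eval ![1, 0]) h2
  simp at h3

theorem Params.r_ne_s : P.r ≠ P.s := fun h => P.sq_ne_sq (by rw [h])

theorem Params.r_add_s : P.r + P.s ≠ 0 := fun h =>
  P.sq_ne_sq (by linear_combination (P.r - P.s) * h)

/-- The structure constants `Ω_ij = (ω'_i, ω_j) = r^{⟨α_i, α_j⟩} s^{-⟨α_j, α_i⟩}`, where the index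
`0` stands for `-θ`. -/
def Om (n i j : ℕ) : K := P.r ^ affRingel n i j * P.s ^ (-affRingel n j i)

/-- `[m]_{r,s}`. -/
def qInt (m : ℕ) : K := (P.r ^ m - P.s ^ m) / (P.r - P.s)

/-- `[m]_{r,s}!`. -/
def qFact (m : ℕ) : K := ∏ k ∈ Finset.range m, qInt P (k + 1)

/-- The two-parameter Gaussian binomial coefficient. -/
def qBinom (m k : ℕ) : K := qFact P m / (qFact P (m - k) * qFact P k)

/-- The exponent `1 - c_ij` of the Serre relations. -/
def serreExp (n i j : ℕ) : ℕ := (1 - affCartan n i j).toNat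

/-- The coefficients of the Serre relations; `r_i = r` and `s_i = s` in type `D`. -/
def serreCoeff (n i j k : ℕ) : K :=
  (-1) ^ k * qBinom P (serreExp n i j) k * (P.r * P.s) ^ (k * (k - 1) / 2) *
    Om P n j i ^ k * P.s ^ ((k : ℤ) * affCartan n i j)

/-- The generators of the algebra without degree operators; the suffix `i` marks the inverses. -/
inductive Gen (n : ℕ)
  | e (i : Fin (n + 1))
  | f (i : Fin (n + 1))
  | w (i : Fin (n + 1))
  | wi (i : Fin (n + 1))
  | w' (i : Fin (n + 1))
  | w'i (i : Fin (n + 1))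
  | g
  | gi
  | g'
  | g'i

/-- The additional degree generators `D^{±1}`, `D'^{±1}`. -/
inductive DegGen
  | d
  | di
  | d'
  | d'i

/-- `∏ y_i^{θ_i}` over `i = 1, …, n` (for instance `ω_θ` when `y = ω`). -/
def thetaProd {B : Type*} [Monoid B] (n : ℕ) (y : Fin (n + 1) → B) : B :=
  (List.ofFn fun i : Fin n => y i.succ ^ highestRoot n (i + 1)).prod

/-- The defining relations of `U'_{r,s}`, for a family `x` of elements of a `K`-algebra indexed by
the generators: `AffRel P n x a b` says that `a = b` is one of the relations. -/
inductive AffRel (n : ℕ) {B : Type*} [Ring B] [Algebra K B] (x : Gen n → B) : B → B → Prop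
  | g_def : AffRel n x (x .g) (x (.w 0) * thetaProd n fun i => x (.w i))
  | g'_def : AffRel n x (x .g') (x (.w' 0) * thetaProd n fun i => x (.w' i))
  | g_gi : AffRel n x (x .g * x .gi) 1
  | gi_g : AffRel n x (x .gi * x .g) 1
  | g'_g'i : AffRel n x (x .g' * x .g'i) 1
  | g'i_g' : AffRel n x (x .g'i * x .g') 1
  | g_central (y : Gen n) : AffRel n x (x .g * x y) (x y * x .g)
  | g'_central (y : Gen n) : AffRel n x (x .g' * x y) (x y * x .g')
  | w_w (i j) : AffRel n x (x (.w i) * x (.w j)) (x (.w j) * x (.w i))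
  | w_w' (i j) : AffRel n x (x (.w i) * x (.w' j)) (x (.w' j) * x (.w i))
  | w'_w' (i j) : AffRel n x (x (.w' i) * x (.w' j)) (x (.w' j) * x (.w' i))
  | w_wi (i) : AffRel n x (x (.w i) * x (.wi i)) 1
  | wi_w (i) : AffRel n x (x (.wi i) * x (.w i)) 1
  | w'_w'i (i) : AffRel n x (x (.w' i) * x (.w'i i)) 1
  | w'i_w' (i) : AffRel n x (x (.w'i i) * x (.w' i)) 1
  | w_e (i j) : AffRel n x (x (.w i) * x (.e j)) (Om P n j i • (x (.e j) * x (.w i)))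
  | w_f (i j) : AffRel n x (x (.w i) * x (.f j)) ((Om P n j i)⁻¹ • (x (.f j) * x (.w i)))
  | w'_e (i j) : AffRel n x (x (.w' i) * x (.e j)) ((Om P n i j)⁻¹ • (x (.e j) * x (.w' i)))
  | w'_f (i j) : AffRel n x (x (.w' i) * x (.f j)) (Om P n i j • (x (.f j) * x (.w' i)))
  | e_f (i j) : AffRel n x (x (.e i) * x (.f j) - x (.f j) * x (.e i))
      (if i = j then (P.r - P.s)⁻¹ • (x (.w i) - x (.w' i)) else 0)
  | serre_e (i j : Fin (n + 1)) (hij : i ≠ j) : AffRel n x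
      (∑ k ∈ Finset.range (serreExp n i j + 1), serreCoeff P n i j k •
        (x (.e i) ^ (serreExp n i j - k) * x (.e j) * x (.e i) ^ k)) 0
  | serre_f (i j : Fin (n + 1)) (hij : i ≠ j) : AffRel n x
      (∑ k ∈ Finset.range (serreExp n i j + 1), serreCoeff P n i j k •
        (x (.f i) ^ k * x (.f j) * x (.f i) ^ (serreExp n i j - k))) 0

/-- The defining relations of `U_{r,s}`: those of `U'_{r,s}` and those of the degree generators.
(That `γ, γ'` commute with `D, D'` follows, as `γ` and `γ'` are products of `ω_i` and `ω'_i`.) -/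
inductive FullRel (n : ℕ) {B : Type*} [Ring B] [Algebra K B] (x : Gen n ⊕ DegGen → B) :
    B → B → Prop
  | aff {a b : B} : AffRel P n (fun y => x (.inl y)) a b → FullRel n x a b
  | d_di : FullRel n x (x (.inr .d) * x (.inr .di)) 1
  | di_d : FullRel n x (x (.inr .di) * x (.inr .d)) 1
  | d'_d'i : FullRel n x (x (.inr .d') * x (.inr .d'i)) 1
  | d'i_d' : FullRel n x (x (.inr .d'i) * x (.inr .d')) 1
  | d_d' : FullRel n x (x (.inr .d) * x (.inr .d')) (x (.inr .d') * x (.inr .d))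
  | d_w (i) : FullRel n x (x (.inr .d) * x (.inl (.w i))) (x (.inl (.w i)) * x (.inr .d))
  | d_w' (i) : FullRel n x (x (.inr .d) * x (.inl (.w' i))) (x (.inl (.w' i)) * x (.inr .d))
  | d'_w (i) : FullRel n x (x (.inr .d') * x (.inl (.w i))) (x (.inl (.w i)) * x (.inr .d'))
  | d'_w' (i) : FullRel n x (x (.inr .d') * x (.inl (.w' i))) (x (.inl (.w' i)) * x (.inr .d'))
  | d_e (i) : FullRel n x (x (.inr .d) * x (.inl (.e i)) * x (.inr .di))
      ((if i = 0 then P.r else 1) • x (.inl (.e i)))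
  | d_f (i) : FullRel n x (x (.inr .d) * x (.inl (.f i)) * x (.inr .di))
      ((if i = 0 then P.r⁻¹ else 1) • x (.inl (.f i)))
  | d'_e (i) : FullRel n x (x (.inr .d') * x (.inl (.e i)) * x (.inr .d'i))
      ((if i = 0 then P.s else 1) • x (.inl (.e i)))
  | d'_f (i) : FullRel n x (x (.inr .d') * x (.inl (.f i)) * x (.inr .d'i))
      ((if i = 0 then P.s⁻¹ else 1) • x (.inl (.f i)))

/-- `U'_{r,s}` of affine type `D_n^{(1)}`: the algebra without degree generators. -/
abbrev UAff' (n : ℕ) : Type _ :=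
  RingQuot (AffRel P n (FreeAlgebra.ι K : Gen n → FreeAlgebra K (Gen n)))

/-- The two-parameter quantum affine algebra `U_{r,s}` of affine type `D_n^{(1)}`. -/
abbrev UAff (n : ℕ) : Type _ :=
  RingQuot (FullRel P n (FreeAlgebra.ι K : Gen n ⊕ DegGen → FreeAlgebra K (Gen n ⊕ DegGen)))

/-- The generators of `U'_{r,s}`. -/
def gen' {n : ℕ} (y : Gen n) : UAff' P n := RingQuot.mkAlgHom K _ (FreeAlgebra.ι K y)

/-- The generators of `U_{r,s}`. -/
def gen {n : ℕ} (y : Gen n ⊕ DegGen) : UAff P n := RingQuot.mkAlgHom K _ (FreeAlgebra.ι K y)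

section Lift

variable {n : ℕ} {B C : Type*} [Ring B] [Algebra K B] [Ring C] [Algebra K C]

theorem map_thetaProd (F : B →ₐ[K] C) (y : Fin (n + 1) → B) :
    F (thetaProd n y) = thetaProd n fun i => F (y i) := by
  unfold thetaProd
  rw [map_list_prod, List.map_ofFn]
  congr 2
  funext i
  simp

theorem AffRel.map (F : B →ₐ[K] C) {x : Gen n → B} {a b : B} (h : AffRel P n x a b) :
    AffRel P n (fun y => F (x y)) (F a) (F b) := by
  cases h with
  | g_def => simpa only [map_mul, map_thetaProd] using AffRel.g_def (P := P) (x := fun y => F (x y))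
  | g'_def =>
    simpa only [map_mul, map_thetaProd] using AffRel.g'_def (P := P) (x := fun y => F (x y))
  | g_gi => simpa only [map_mul, map_one] using AffRel.g_gi (P := P) (x := fun y => F (x y))
  | gi_g => simpa only [map_mul, map_one] using AffRel.gi_g (P := P) (x := fun y => F (x y))
  | g'_g'i => simpa only [map_mul, map_one] using AffRel.g'_g'i (P := P) (x := fun y => F (x y))
  | g'i_g' => simpa only [map_mul, map_one] using AffRel.g'i_g' (P := P) (x := fun y => F (x y))
  | g_central y => simpa only [map_mul] using AffRel.g_central (P := P) (x := fun y => F (x y)) y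
  | g'_central y => simpa only [map_mul] using AffRel.g'_central (P := P) (x := fun y => F (x y)) y
  | w_w i j => simpa only [map_mul] using AffRel.w_w (P := P) (x := fun y => F (x y)) i j
  | w_w' i j => simpa only [map_mul] using AffRel.w_w' (P := P) (x := fun y => F (x y)) i j
  | w'_w' i j => simpa only [map_mul] using AffRel.w'_w' (P := P) (x := fun y => F (x y)) i j
  | w_wi i => simpa only [map_mul, map_one] using AffRel.w_wi (P := P) (x := fun y => F (x y)) i
  | wi_w i => simpa only [map_mul, map_one] using AffRel.wi_w (P := P) (x := fun y => F (x y)) i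
  | w'_w'i i => simpa only [map_mul, map_one] using AffRel.w'_w'i (P := P) (x := fun y => F (x y)) i
  | w'i_w' i => simpa only [map_mul, map_one] using AffRel.w'i_w' (P := P) (x := fun y => F (x y)) i
  | w_e i j => simpa only [map_mul, map_smul] using AffRel.w_e (P := P) (x := fun y => F (x y)) i j
  | w_f i j => simpa only [map_mul, map_smul] using AffRel.w_f (P := P) (x := fun y => F (x y)) i j
  | w'_e i j =>
    simpa only [map_mul, map_smul] using AffRel.w'_e (P := P) (x := fun y => F (x y)) i j
  | w'_f i j =>
    simpa only [map_mul, map_smul] using AffRel.w'_f (P := P) (x := fun y => F (x y)) i j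
  | e_f i j =>
    simpa only [map_mul, map_sub, apply_ite F, map_smul, map_zero] using
      AffRel.e_f (P := P) (x := fun y => F (x y)) i j
  | serre_e i j hij =>
    simpa only [map_mul, map_sum, map_pow, map_smul, map_zero] using
      AffRel.serre_e (P := P) (x := fun y => F (x y)) i j hij
  | serre_f i j hij =>
    simpa only [map_mul, map_sum, map_pow, map_smul, map_zero] using
      AffRel.serre_f (P := P) (x := fun y => F (x y)) i j hij

theorem FullRel.map (F : B →ₐ[K] C) {x : Gen n ⊕ DegGen → B} {a b : B} (h : FullRel P n x a b) :
    FullRel P n (fun y => F (x y)) (F a) (F b) := by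
  cases h with
  | aff h => exact .aff (h.map P F)
  | d_di => simpa only [map_mul, map_one] using FullRel.d_di (P := P) (x := fun y => F (x y))
  | di_d => simpa only [map_mul, map_one] using FullRel.di_d (P := P) (x := fun y => F (x y))
  | d'_d'i => simpa only [map_mul, map_one] using FullRel.d'_d'i (P := P) (x := fun y => F (x y))
  | d'i_d' => simpa only [map_mul, map_one] using FullRel.d'i_d' (P := P) (x := fun y => F (x y))
  | d_d' => simpa only [map_mul] using FullRel.d_d' (P := P) (x := fun y => F (x y))
  | d_w i => simpa only [map_mul] using FullRel.d_w (P := P) (x := fun y => F (x y)) i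
  | d_w' i => simpa only [map_mul] using FullRel.d_w' (P := P) (x := fun y => F (x y)) i
  | d'_w i => simpa only [map_mul] using FullRel.d'_w (P := P) (x := fun y => F (x y)) i
  | d'_w' i => simpa only [map_mul] using FullRel.d'_w' (P := P) (x := fun y => F (x y)) i
  | d_e i => simpa only [map_mul, map_smul] using FullRel.d_e (P := P) (x := fun y => F (x y)) i
  | d_f i => simpa only [map_mul, map_smul] using FullRel.d_f (P := P) (x := fun y => F (x y)) i
  | d'_e i => simpa only [map_mul, map_smul] using FullRel.d'_e (P := P) (x := fun y => F (x y)) i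
  | d'_f i => simpa only [map_mul, map_smul] using FullRel.d'_f (P := P) (x := fun y => F (x y)) i

theorem AffRel.exists_lift (F : B →ₐ[K] C) {x : Gen n → B} {a b : C}
    (h : AffRel P n (fun y => F (x y)) a b) :
    ∃ a' b', AffRel P n x a' b' ∧ F a' = a ∧ F b' = b := by
  cases h with
  | g_def => exact ⟨_, _, .g_def, rfl, by rw [map_mul, map_thetaProd]⟩
  | g'_def => exact ⟨_, _, .g'_def, rfl, by rw [map_mul, map_thetaProd]⟩
  | g_gi => exact ⟨_, _, .g_gi, map_mul F _ _, map_one F⟩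
  | gi_g => exact ⟨_, _, .gi_g, map_mul F _ _, map_one F⟩
  | g'_g'i => exact ⟨_, _, .g'_g'i, map_mul F _ _, map_one F⟩
  | g'i_g' => exact ⟨_, _, .g'i_g', map_mul F _ _, map_one F⟩
  | g_central y => exact ⟨_, _, .g_central y, map_mul F _ _, map_mul F _ _⟩
  | g'_central y => exact ⟨_, _, .g'_central y, map_mul F _ _, map_mul F _ _⟩
  | w_wi y => exact ⟨_, _, .w_wi y, map_mul F _ _, map_one F⟩
  | wi_w y => exact ⟨_, _, .wi_w y, map_mul F _ _, map_one F⟩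
  | w'_w'i y => exact ⟨_, _, .w'_w'i y, map_mul F _ _, map_one F⟩
  | w'i_w' y => exact ⟨_, _, .w'i_w' y, map_mul F _ _, map_one F⟩
  | w_w i j => exact ⟨_, _, .w_w i j, map_mul F _ _, map_mul F _ _⟩
  | w_w' i j => exact ⟨_, _, .w_w' i j, map_mul F _ _, map_mul F _ _⟩
  | w'_w' i j => exact ⟨_, _, .w'_w' i j, map_mul F _ _, map_mul F _ _⟩
  | w_e i j => exact ⟨_, _, .w_e i j, map_mul F _ _, by rw [map_smul, map_mul]⟩
  | w_f i j => exact ⟨_, _, .w_f i j, map_mul F _ _, by rw [map_smul, map_mul]⟩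
  | w'_e i j => exact ⟨_, _, .w'_e i j, map_mul F _ _, by rw [map_smul, map_mul]⟩
  | w'_f i j => exact ⟨_, _, .w'_f i j, map_mul F _ _, by rw [map_smul, map_mul]⟩
  | e_f i j =>
    exact ⟨_, _, .e_f i j, by simp only [map_mul, map_sub], by
      simp only [map_sub, apply_ite F, map_smul, map_zero]⟩
  | serre_e i j hij =>
    exact ⟨_, _, .serre_e i j hij, by simp only [map_mul, map_sum, map_pow, map_smul], map_zero F⟩
  | serre_f i j hij =>
    exact ⟨_, _, .serre_f i j hij, by simp only [map_mul, map_sum, map_pow, map_smul], map_zero F⟩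

theorem FullRel.exists_lift (F : B →ₐ[K] C) {x : Gen n ⊕ DegGen → B} {a b : C}
    (h : FullRel P n (fun y => F (x y)) a b) :
    ∃ a' b', FullRel P n x a' b' ∧ F a' = a ∧ F b' = b := by
  cases h with
  | aff h =>
    obtain ⟨a', b', h', ha, hb⟩ := h.exists_lift P F
    exact ⟨a', b', .aff h', ha, hb⟩
  | d_di => exact ⟨_, _, .d_di, map_mul F _ _, map_one F⟩
  | di_d => exact ⟨_, _, .di_d, map_mul F _ _, map_one F⟩
  | d'_d'i => exact ⟨_, _, .d'_d'i, map_mul F _ _, map_one F⟩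
  | d'i_d' => exact ⟨_, _, .d'i_d', map_mul F _ _, map_one F⟩
  | d_d' => exact ⟨_, _, .d_d', map_mul F _ _, map_mul F _ _⟩
  | d_w i => exact ⟨_, _, .d_w i, map_mul F _ _, map_mul F _ _⟩
  | d_w' i => exact ⟨_, _, .d_w' i, map_mul F _ _, map_mul F _ _⟩
  | d'_w i => exact ⟨_, _, .d'_w i, map_mul F _ _, map_mul F _ _⟩
  | d'_w' i => exact ⟨_, _, .d'_w' i, map_mul F _ _, map_mul F _ _⟩
  | d_e i => exact ⟨_, _, .d_e i, by rw [map_mul, map_mul], map_smul F _ _⟩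
  | d_f i => exact ⟨_, _, .d_f i, by rw [map_mul, map_mul], map_smul F _ _⟩
  | d'_e i => exact ⟨_, _, .d'_e i, by rw [map_mul, map_mul], map_smul F _ _⟩
  | d'_f i => exact ⟨_, _, .d'_f i, by rw [map_mul, map_mul], map_smul F _ _⟩

variable {P}

/-- The universal property of `U'_{r,s}`: a family of elements that satisfies the relations
defines a homomorphism. -/
def lift' (x : Gen n → B) (h : ∀ a b, AffRel P n x a b → a = b) : UAff' P n →ₐ[K] B :=
  RingQuot.liftAlgHom K ⟨FreeAlgebra.lift K x, fun a b hab =>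
    h _ _ (by simpa using hab.map P (FreeAlgebra.lift K x))⟩

/-- The universal property of `U_{r,s}`. -/
def lift (x : Gen n ⊕ DegGen → B) (h : ∀ a b, FullRel P n x a b → a = b) : UAff P n →ₐ[K] B :=
  RingQuot.liftAlgHom K ⟨FreeAlgebra.lift K x, fun a b hab =>
    h _ _ (by simpa using hab.map P (FreeAlgebra.lift K x))⟩

@[simp] theorem lift'_gen' (x : Gen n → B) (h : ∀ a b, AffRel P n x a b → a = b) (y : Gen n) :
    lift' x h (gen' P y) = x y := by
  simp [lift', gen']

@[simp] theorem lift_gen (x : Gen n ⊕ DegGen → B) (h : ∀ a b, FullRel P n x a b → a = b)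
    (y : Gen n ⊕ DegGen) : lift x h (gen P y) = x y := by
  simp [lift, gen]

theorem gen'_rel (a b : UAff' P n) (h : AffRel P n (gen' P) a b) : a = b := by
  obtain ⟨a', b', h', rfl, rfl⟩ := AffRel.exists_lift P (x := FreeAlgebra.ι K)
    (RingQuot.mkAlgHom K (AffRel P n (FreeAlgebra.ι K : Gen n → FreeAlgebra K (Gen n)))) h
  exact RingQuot.mkAlgHom_rel K h'

theorem gen_rel (a b : UAff P n) (h : FullRel P n (gen P) a b) : a = b := by
  obtain ⟨a', b', h', rfl, rfl⟩ := FullRel.exists_lift P (x := FreeAlgebra.ι K)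
    (RingQuot.mkAlgHom K
      (FullRel P n (FreeAlgebra.ι K : Gen n ⊕ DegGen → FreeAlgebra K (Gen n ⊕ DegGen)))) h
  exact RingQuot.mkAlgHom_rel K h'

end Lift

end Algebra

section Coproduct

variable {K : Type*} [Field K] [Algebra ℂ K] (P : Params K) {n : ℕ}

theorem Om_ne_zero (i j : ℕ) : Om P n i j ≠ 0 :=
  mul_ne_zero (zpow_ne_zero _ P.r_ne_zero) (zpow_ne_zero _ P.s_ne_zero)

theorem Om_self (hn : 3 ≤ n) {i : ℕ} (hi : i ≤ n) : Om P n i i = P.r * P.s⁻¹ := by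
  simp [Om, affRingel_self hn hi]

theorem Om_mul_Om (hn : 3 ≤ n) {i : ℕ} (hi : i ≤ n) (j : ℕ) :
    Om P n i j * Om P n j i = (P.r * P.s⁻¹) ^ affCartan n i j := by
  rw [affCartan_eq hn hi, mul_zpow, zpow_add₀ P.r_ne_zero, inv_zpow, ← zpow_neg, neg_add,
    zpow_add₀ P.s_ne_zero]
  unfold Om
  ring

theorem qInt_one : qInt P 1 = 1 := by
  have := sub_ne_zero.2 P.r_ne_s
  simp [qInt, this]

theorem qInt_two : qInt P 2 = P.r + P.s := by
  have := sub_ne_zero.2 P.r_ne_s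
  unfold qInt
  field_simp
  ring

theorem serre_zero {i j : ℕ} (hc : affCartan n i j = 0) :
    serreExp n i j = 1 ∧ serreCoeff P n i j 0 = 1 ∧ serreCoeff P n i j 1 = -Om P n j i := by
  have h : serreExp n i j = 1 := by simp [serreExp, hc]
  refine ⟨h, ?_, ?_⟩ <;> simp [serreCoeff, h, hc, qBinom, qFact, qInt_one]

theorem serre_one {i j : ℕ} (hc : affCartan n i j = -1) :
    serreExp n i j = 2 ∧ serreCoeff P n i j 0 = 1 ∧
      serreCoeff P n i j 1 = -((P.r + P.s) * Om P n j i * P.s⁻¹) ∧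
      serreCoeff P n i j 2 = P.r * Om P n j i ^ 2 * P.s⁻¹ := by
  have h : serreExp n i j = 2 := by simp [serreExp, hc]
  have h2 := P.r_add_s
  have h3 := P.s_ne_zero
  refine ⟨h, ?_, ?_, ?_⟩ <;>
    simp [serreCoeff, h, hc, qBinom, qFact, qInt_one, qInt_two, Finset.prod_range_succ, h2]
  · ring
  · field_simp

variable {B : Type*} [Ring B] [Algebra K B]

/-- The cubic Serre relation is additive on suitably `q`-commuting elements. -/
theorem cubic_add {X Y X' Y' : B} {α β q o o' : K}
    (hYX : Y * X = q • (X * Y)) (hYX' : Y * X' = o • (X' * Y)) (hY'X : Y' * X = o' • (X * Y'))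
    (h1 : X ^ 2 * X' + α • (X * X' * X) + β • (X' * X ^ 2) = 0)
    (h2 : Y ^ 2 * Y' + α • (Y * Y' * Y) + β • (Y' * Y ^ 2) = 0)
    (e1 : o * (1 + q) + α = 0) (e2 : α * o * q + β * (1 + q) = 0) (e3 : o ^ 2 + α * o + β = 0)
    (e4 : 1 + α * o' + β * o' ^ 2 = 0) (e5 : 1 + q + α * o' * q = 0)
    (e6 : α + β * o' * (1 + q) = 0) :
    (X + Y) ^ 2 * (X' + Y') + α • ((X + Y) * (X' + Y') * (X + Y))
      + β • ((X' + Y') * (X + Y) ^ 2) = 0 := by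
  have kYX : ∀ z, Y * (X * z) = q • (X * (Y * z)) := fun z => by
    rw [← mul_assoc, hYX, smul_mul_assoc, mul_assoc]
  have kYX' : ∀ z, Y * (X' * z) = o • (X' * (Y * z)) := fun z => by
    rw [← mul_assoc, hYX', smul_mul_assoc, mul_assoc]
  have kY'X : ∀ z, Y' * (X * z) = o' • (X * (Y' * z)) := fun z => by
    rw [← mul_assoc, hY'X, smul_mul_assoc, mul_assoc]
  have key : (X + Y) ^ 2 * (X' + Y') + α • ((X + Y) * (X' + Y') * (X + Y))
      + β • ((X' + Y') * (X + Y) ^ 2) =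
      (X ^ 2 * X' + α • (X * X' * X) + β • (X' * X ^ 2))
      + (Y ^ 2 * Y' + α • (Y * Y' * Y) + β • (Y' * Y ^ 2))
      + (o * (1 + q) + α) • (X * (X' * Y)) * 1
      + (α * o * q + β * (1 + q)) • (X' * (X * Y))
      + (o ^ 2 + α * o + β) • (X' * (Y * Y))
      + (1 + α * o' + β * o' ^ 2) • (X * (X * Y'))
      + (1 + q + α * o' * q) • (X * (Y * Y'))
      + (α + β * o' * (1 + q)) • (X * (Y' * Y)) := by
    simp only [pow_two, mul_add, add_mul, mul_assoc, smul_add, kYX, kYX', kY'X, hYX, hYX', hY'X,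
      mul_smul_comm, smul_mul_assoc, smul_smul, mul_one]
    match_scalars <;> ring
  rw [key, h1, h2, e1, e2, e3, e4, e5, e6]
  simp

theorem cubic_add_op {X Y X' Y' : B} {α β q o o' : K}
    (hYX : X * Y = q • (Y * X)) (hYX' : X' * Y = o • (Y * X')) (hY'X : X * Y' = o' • (Y' * X))
    (h1 : X' * X ^ 2 + α • (X * X' * X) + β • (X ^ 2 * X') = 0)
    (h2 : Y' * Y ^ 2 + α • (Y * Y' * Y) + β • (Y ^ 2 * Y') = 0)
    (e1 : o * (1 + q) + α = 0) (e2 : α * o * q + β * (1 + q) = 0) (e3 : o ^ 2 + α * o + β = 0)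
    (e4 : 1 + α * o' + β * o' ^ 2 = 0) (e5 : 1 + q + α * o' * q = 0)
    (e6 : α + β * o' * (1 + q) = 0) :
    (X' + Y') * (X + Y) ^ 2 + α • ((X + Y) * (X' + Y') * (X + Y))
      + β • ((X + Y) ^ 2 * (X' + Y')) = 0 := by
  have := cubic_add (B := Bᵐᵒᵖ) (X := .op X) (Y := .op Y) (X' := .op X') (Y' := .op Y')
    (by simpa using congrArg MulOpposite.op hYX) (by simpa using congrArg MulOpposite.op hYX')
    (by simpa using congrArg MulOpposite.op hY'X)
    (by simpa [mul_assoc] using congrArg MulOpposite.op h1)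
    (by simpa [mul_assoc] using congrArg MulOpposite.op h2) e1 e2 e3 e4 e5 e6
  simpa [mul_assoc] using congrArg MulOpposite.unop this

theorem cubic_scalars {o o' : K} (h : o' * o = (P.r * P.s⁻¹)⁻¹) :
    let q := P.r * P.s⁻¹
    let α := -((P.r + P.s) * o * P.s⁻¹)
    let β := P.r * o ^ 2 * P.s⁻¹
    o * (1 + q) + α = 0 ∧ α * o * q + β * (1 + q) = 0 ∧ o ^ 2 + α * o + β = 0 ∧
      1 + α * o' + β * o' ^ 2 = 0 ∧ 1 + q + α * o' * q = 0 ∧ α + β * o' * (1 + q) = 0 := by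
  have hr := P.r_ne_zero
  have hs := P.s_ne_zero
  have ho : o ≠ 0 := by
    rintro rfl
    rw [mul_zero] at h
    exact inv_ne_zero (mul_ne_zero hr (inv_ne_zero hs)) h.symm
  have h' : o' = P.s * P.r⁻¹ * o⁻¹ := by
    rw [eq_mul_inv_iff_mul_eq₀ ho, h, mul_inv, inv_inv, mul_comm]
  subst h'
  refine ⟨?_, ?_, ?_, ?_, ?_, ?_⟩ <;> field_simp <;> ring

variable (K) in
/-- The values of the coproduct on the generators. -/
def comulGen (x : Gen n → B) : Gen n → B ⊗[K] B
  | .e i => x (.e i) ⊗ₜ 1 + x (.w i) ⊗ₜ x (.e i)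
  | .f i => 1 ⊗ₜ x (.f i) + x (.f i) ⊗ₜ x (.w' i)
  | y => x y ⊗ₜ x y

theorem thetaProd_tmul (y : Fin (n + 1) → B) :
    thetaProd n (fun i => y i ⊗ₜ[K] y i) = thetaProd n y ⊗ₜ[K] thetaProd n y := by
  unfold thetaProd
  have key : ∀ (m : ℕ) (a : Fin m → ℕ) (z : Fin m → B),
      (List.ofFn fun i => (z i ⊗ₜ[K] z i) ^ a i).prod =
        (List.ofFn fun i => z i ^ a i).prod ⊗ₜ[K] (List.ofFn fun i => z i ^ a i).prod := by
    intro m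
    induction m with
    | zero => intro a z; simp [Algebra.TensorProduct.one_def]
    | succ m ih =>
      intro a z
      simp only [List.ofFn_succ, List.prod_cons]
      rw [ih (fun i => a i.succ) (fun i => z i.succ), Algebra.TensorProduct.tmul_pow,
        Algebra.TensorProduct.tmul_mul_tmul]
  exact key n _ _

theorem comul_rel (hn : 3 ≤ n) {x : Gen n → B} (h : ∀ a b, AffRel P n x a b → a = b) :
    ∀ a b, AffRel P n (comulGen K x) a b → a = b := by
  have hle : ∀ i : Fin (n + 1), (i : ℕ) ≤ n := fun i => Nat.lt_succ_iff.1 i.2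
  have ww : ∀ i j, x (.w i) * x (.w j) = x (.w j) * x (.w i) := fun i j => h _ _ (.w_w i j)
  have ww' : ∀ i j, x (.w i) * x (.w' j) = x (.w' j) * x (.w i) := fun i j => h _ _ (.w_w' i j)
  have w'w' : ∀ i j, x (.w' i) * x (.w' j) = x (.w' j) * x (.w' i) := fun i j => h _ _ (.w'_w' i j)
  have we : ∀ i j, x (.w i) * x (.e j) = Om P n j i • (x (.e j) * x (.w i)) :=
    fun i j => h _ _ (.w_e i j)
  have wf : ∀ i j, x (.w i) * x (.f j) = (Om P n j i)⁻¹ • (x (.f j) * x (.w i)) :=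
    fun i j => h _ _ (.w_f i j)
  have w'e : ∀ i j, x (.w' i) * x (.e j) = (Om P n i j)⁻¹ • (x (.e j) * x (.w' i)) :=
    fun i j => h _ _ (.w'_e i j)
  have w'f : ∀ i j, x (.w' i) * x (.f j) = Om P n i j • (x (.f j) * x (.w' i)) :=
    fun i j => h _ _ (.w'_f i j)
  have hr := P.r_ne_zero
  have hs := P.s_ne_zero
  intro a b hab
  cases hab with
  | g_def =>
    simp only [comulGen, thetaProd_tmul, Algebra.TensorProduct.tmul_mul_tmul]
    rw [← h _ _ .g_def]
  | g'_def =>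
    simp only [comulGen, thetaProd_tmul, Algebra.TensorProduct.tmul_mul_tmul]
    rw [← h _ _ .g'_def]
  | g_gi => simp [comulGen, h _ _ .g_gi, Algebra.TensorProduct.one_def]
  | gi_g => simp [comulGen, h _ _ .gi_g, Algebra.TensorProduct.one_def]
  | g'_g'i => simp [comulGen, h _ _ .g'_g'i, Algebra.TensorProduct.one_def]
  | g'i_g' => simp [comulGen, h _ _ .g'i_g', Algebra.TensorProduct.one_def]
  | g_central y =>
    cases y <;> simp [comulGen, mul_add, add_mul, h _ _ (.g_central _)]
  | g'_central y =>
    cases y <;> simp [comulGen, mul_add, add_mul, h _ _ (.g'_central _)]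
  | w_w i j => simp [comulGen, ww i j]
  | w_w' i j => simp [comulGen, ww' i j]
  | w'_w' i j => simp [comulGen, w'w' i j]
  | w_wi i => simp [comulGen, h _ _ (.w_wi i), Algebra.TensorProduct.one_def]
  | wi_w i => simp [comulGen, h _ _ (.wi_w i), Algebra.TensorProduct.one_def]
  | w'_w'i i => simp [comulGen, h _ _ (.w'_w'i i), Algebra.TensorProduct.one_def]
  | w'i_w' i => simp [comulGen, h _ _ (.w'i_w' i), Algebra.TensorProduct.one_def]
  | w_e i j =>
    simp [comulGen, mul_add, add_mul, we i j, ww i j, TensorProduct.smul_tmul']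
  | w_f i j =>
    simp [comulGen, mul_add, add_mul, wf i j, ww' i j, TensorProduct.smul_tmul']
  | w'_e i j =>
    simp [comulGen, mul_add, add_mul, w'e i j, ww' j i, TensorProduct.smul_tmul']
  | w'_f i j =>
    simp [comulGen, mul_add, add_mul, w'f i j, w'w' i j, TensorProduct.smul_tmul']
  | e_f i j =>
    have ef : x (.e i) * x (.f j) = x (.f j) * x (.e i) +
        (if i = j then (P.r - P.s)⁻¹ • (x (.w i) - x (.w' i)) else 0) :=
      eq_add_of_sub_eq' (h _ _ (.e_f i j))
    have h1 : comulGen K x (.e i) * comulGen K x (.f j)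
        - comulGen K x (.f j) * comulGen K x (.e i) =
        (if i = j then (P.r - P.s)⁻¹ • (x (.w i) - x (.w' i)) else 0) ⊗ₜ x (.w' j) +
        x (.w i) ⊗ₜ (if i = j then (P.r - P.s)⁻¹ • (x (.w i) - x (.w' i)) else 0) := by
      simp only [comulGen, mul_add, add_mul, Algebra.TensorProduct.tmul_mul_tmul, one_mul, mul_one,
        ef, wf i j, w'e j i, TensorProduct.tmul_add, TensorProduct.add_tmul,
        TensorProduct.tmul_smul, ← TensorProduct.smul_tmul']
      abel
    rw [h1]
    by_cases hij : i = j
    · subst hij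
      simp only [if_true, comulGen, TensorProduct.tmul_smul, ← TensorProduct.smul_tmul',
        TensorProduct.sub_tmul, TensorProduct.tmul_sub]
      rw [← smul_add]
      congr 1
      abel
    · simp [hij]
  | serre_e i j hij =>
    have hij' : (i : ℕ) ≠ j := fun hh => hij (Fin.ext hh)
    have hse := h _ _ (.serre_e i j hij)
    have hOO := Om_mul_Om P hn (hle i) j
    have hO := Om_ne_zero P (n := n) i j
    have hO' := Om_ne_zero P (n := n) j i
    rcases affCartan_cases hn (hle i) (hle j) hij' with hc | hc
    · obtain ⟨k1, k2, k3⟩ := serre_zero P hc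
      rw [hc, zpow_zero] at hOO
      have hs0 : x (.e i) * x (.e j) = Om P n j i • (x (.e j) * x (.e i)) := by
        simp [k1, Finset.sum_range_succ, k2, k3] at hse
        exact add_neg_eq_zero.1 hse
      simp only [k1, Finset.sum_range_succ, k2, k3, Finset.sum_range_zero, comulGen]
      simp [mul_add, add_mul, hs0, we, ww i j, ← TensorProduct.smul_tmul', smul_smul,
        TensorProduct.tmul_smul]
      rw [mul_comm (Om P n j i), hOO, one_smul]
      abel
    · obtain ⟨k1, k2, k3, k4⟩ := serre_one P hc
      rw [hc, zpow_neg_one] at hOO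
      obtain ⟨e1, e2, e3, e4, e5, e6⟩ := cubic_scalars P hOO
      have hs2 := hse
      simp only [k1, Finset.sum_range_succ, k2, k3, k4, Finset.sum_range_zero, zero_add, one_smul,
        Nat.sub_zero, pow_zero, mul_one, Nat.add_one_sub_one, pow_one, Nat.sub_self, one_mul]
        at hs2 ⊢
      refine cubic_add (q := P.r * P.s⁻¹) (o := Om P n j i) (o' := Om P n i j)
        ?_ ?_ ?_ ?_ ?_ e1 e2 e3 e4 e5 e6
      · simp [we, Om_self P hn (hle i), ← TensorProduct.smul_tmul']
      · simp [we, ← TensorProduct.smul_tmul']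
      · simp [we, ← TensorProduct.smul_tmul']
      · have hz := congrArg ((TensorProduct.mk K B B).flip 1) hs2
        simp only [map_add, map_smul, map_zero, LinearMap.flip_apply, TensorProduct.mk_apply] at hz
        simpa only [Algebra.TensorProduct.tmul_mul_tmul, Algebra.TensorProduct.tmul_pow, one_pow, mul_one, one_mul] using hz
      · have h1 : x (.w i) * x (.w j) * x (.w i) = x (.w i) ^ 2 * x (.w j) := by
          rw [mul_assoc, ww j i, pow_two, mul_assoc]
        have h2 : x (.w j) * x (.w i) ^ 2 = x (.w i) ^ 2 * x (.w j) := by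
          rw [pow_two, ← mul_assoc, ww j i, mul_assoc, ww j i, ← mul_assoc]
        have hz := congrArg (TensorProduct.mk K B B (x (.w i) ^ 2 * x (.w j))) hs2
        simp only [map_add, map_smul, map_zero, LinearMap.flip_apply, TensorProduct.mk_apply] at hz
        simpa only [Algebra.TensorProduct.tmul_mul_tmul, Algebra.TensorProduct.tmul_pow, one_pow, mul_one, one_mul, h1, h2] using hz
  | serre_f i j hij =>
    have hij' : (i : ℕ) ≠ j := fun hh => hij (Fin.ext hh)
    have hse := h _ _ (.serre_f i j hij)
    have hOO := Om_mul_Om P hn (hle i) j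
    rcases affCartan_cases hn (hle i) (hle j) hij' with hc | hc
    · obtain ⟨k1, k2, k3⟩ := serre_zero P hc
      rw [hc, zpow_zero] at hOO
      have hs0 : x (.f j) * x (.f i) = Om P n j i • (x (.f i) * x (.f j)) := by
        simp [k1, Finset.sum_range_succ, k2, k3] at hse
        exact add_neg_eq_zero.1 hse
      simp only [k1, Finset.sum_range_succ, k2, k3, Finset.sum_range_zero, comulGen]
      simp [mul_add, add_mul, hs0, w'f, w'w' j i, ← TensorProduct.smul_tmul', smul_smul,
        TensorProduct.tmul_smul]
      rw [mul_comm (Om P n j i), hOO, one_smul]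
      abel
    · obtain ⟨k1, k2, k3, k4⟩ := serre_one P hc
      rw [hc, zpow_neg_one] at hOO
      obtain ⟨e1, e2, e3, e4, e5, e6⟩ := cubic_scalars P hOO
      have hs2 := hse
      simp only [k1, Finset.sum_range_succ, k2, k3, k4, Finset.sum_range_zero, zero_add, one_smul,
        Nat.sub_zero, pow_zero, mul_one, Nat.add_one_sub_one, pow_one, Nat.sub_self, one_mul]
        at hs2 ⊢
      simp only [comulGen, add_comm ((1 : B) ⊗ₜ[K] _)]
      refine cubic_add_op (q := P.r * P.s⁻¹) (o := Om P n j i) (o' := Om P n i j)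
        ?_ ?_ ?_ ?_ ?_ e1 e2 e3 e4 e5 e6
      · simp [w'f, Om_self P hn (hle i)]
      · simp [w'f]
      · simp [w'f]
      · have h1 : x (.w' i) * x (.w' j) * x (.w' i) = x (.w' i) ^ 2 * x (.w' j) := by
          rw [mul_assoc, w'w' j i, pow_two, mul_assoc]
        have h2 : x (.w' j) * x (.w' i) ^ 2 = x (.w' i) ^ 2 * x (.w' j) := by
          rw [pow_two, ← mul_assoc, w'w' j i, mul_assoc, w'w' j i, ← mul_assoc]
        have hz := congrArg ((TensorProduct.mk K B B).flip (x (.w' i) ^ 2 * x (.w' j))) hs2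
        simp only [map_add, map_smul, map_zero, LinearMap.flip_apply, TensorProduct.mk_apply] at hz
        simpa only [Algebra.TensorProduct.tmul_mul_tmul, Algebra.TensorProduct.tmul_pow, one_pow, mul_one, one_mul, h1, h2] using hz
      · have hz := congrArg (TensorProduct.mk K B B 1) hs2
        simp only [map_add, map_smul, map_zero, LinearMap.flip_apply, TensorProduct.mk_apply] at hz
        simpa only [Algebra.TensorProduct.tmul_mul_tmul, Algebra.TensorProduct.tmul_pow, one_pow, mul_one, one_mul] using hz

variable (n)

/-- The coproduct of `U'_{r,s}`. -/
def comul' (hn : 3 ≤ n) : UAff' P n →ₐ[K] UAff' P n ⊗[K] UAff' P n :=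
  lift' (comulGen K (gen' P)) (comul_rel P hn gen'_rel)

/-- The values of the coproduct of `U_{r,s}` on the generators; `D` and `D'` are group-like. -/
def comulGenFull : Gen n ⊕ DegGen → UAff P n ⊗[K] UAff P n
  | .inl y => comulGen K (fun y => gen P (.inl y)) y
  | .inr y => gen P (.inr y) ⊗ₜ gen P (.inr y)

theorem comulFull_rel (hn : 3 ≤ n) :
    ∀ a b, FullRel P n (comulGenFull P n) a b → a = b := by
  intro a b hab
  cases hab with
  | aff hab =>
    exact comul_rel P hn (x := fun y => gen P (.inl y)) (fun a b h => gen_rel a b (.aff h)) a b hab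
  | d_di => simp [comulGenFull, gen_rel _ _ .d_di, Algebra.TensorProduct.one_def]
  | di_d => simp [comulGenFull, gen_rel _ _ .di_d, Algebra.TensorProduct.one_def]
  | d'_d'i => simp [comulGenFull, gen_rel _ _ .d'_d'i, Algebra.TensorProduct.one_def]
  | d'i_d' => simp [comulGenFull, gen_rel _ _ .d'i_d', Algebra.TensorProduct.one_def]
  | d_d' => simp [comulGenFull, gen_rel _ _ .d_d']
  | d_w i => simp [comulGenFull, comulGen, gen_rel _ _ (.d_w i)]
  | d_w' i => simp [comulGenFull, comulGen, gen_rel _ _ (.d_w' i)]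
  | d'_w i => simp [comulGenFull, comulGen, gen_rel _ _ (.d'_w i)]
  | d'_w' i => simp [comulGenFull, comulGen, gen_rel _ _ (.d'_w' i)]
  | d_e i =>
    have hw : gen P (.inr .d) * gen P (.inl (.w i)) * gen P (.inr .di) = gen P (.inl (.w i)) := by
      rw [gen_rel _ _ (.d_w i), mul_assoc, gen_rel _ _ .d_di, mul_one]
    have hd := gen_rel _ _ (FullRel.d_e (P := P) (x := gen P) i)
    generalize (if i = 0 then P.r else 1) = c at hd ⊢
    simp [comulGenFull, comulGen, mul_add, add_mul, hd, hw, gen_rel _ _ .d_di,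
      ← TensorProduct.smul_tmul']
  | d_f i =>
    have hw : gen P (.inr .d) * gen P (.inl (.w' i)) * gen P (.inr .di) =
        gen P (.inl (.w' i)) := by
      rw [gen_rel _ _ (.d_w' i), mul_assoc, gen_rel _ _ .d_di, mul_one]
    have hd := gen_rel _ _ (FullRel.d_f (P := P) (x := gen P) i)
    generalize (if i = 0 then P.r⁻¹ else 1) = c at hd ⊢
    simp [comulGenFull, comulGen, mul_add, add_mul, hd, hw, gen_rel _ _ .d_di,
      ← TensorProduct.smul_tmul']
  | d'_e i =>
    have hw : gen P (.inr .d') * gen P (.inl (.w i)) * gen P (.inr .d'i) =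
        gen P (.inl (.w i)) := by
      rw [gen_rel _ _ (.d'_w i), mul_assoc, gen_rel _ _ .d'_d'i, mul_one]
    have hd := gen_rel _ _ (FullRel.d'_e (P := P) (x := gen P) i)
    generalize (if i = 0 then P.s else 1) = c at hd ⊢
    simp [comulGenFull, comulGen, mul_add, add_mul, hd, hw, gen_rel _ _ .d'_d'i,
      ← TensorProduct.smul_tmul']
  | d'_f i =>
    have hw : gen P (.inr .d') * gen P (.inl (.w' i)) * gen P (.inr .d'i) =
        gen P (.inl (.w' i)) := by
      rw [gen_rel _ _ (.d'_w' i), mul_assoc, gen_rel _ _ .d'_d'i, mul_one]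
    have hd := gen_rel _ _ (FullRel.d'_f (P := P) (x := gen P) i)
    generalize (if i = 0 then P.s⁻¹ else 1) = c at hd ⊢
    simp [comulGenFull, comulGen, mul_add, add_mul, hd, hw, gen_rel _ _ .d'_d'i,
      ← TensorProduct.smul_tmul']

/-- The coproduct of `U_{r,s}`. -/
def comul (hn : 3 ≤ n) : UAff P n →ₐ[K] UAff P n ⊗[K] UAff P n :=
  lift (comulGenFull P n) (comulFull_rel P n hn)

end Coproduct

/-! ### The vector representation and the evaluation modules -/

section Rep

variable {K : Type*} [Field K] [Algebra ℂ K] (P : Params K)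

/-- The involution `i' = 2n + 1 - i` of `{1, …, 2n}`. -/
def bar (n i : ℕ) : ℕ := 2 * n + 1 - i

/-- The matrix unit `E_{ij}` of size `2n`, where `1 ≤ i, j ≤ 2n`. -/
def E (A : Type*) [CommRing A] (n i j : ℕ) : Matrix (Fin (2 * n)) (Fin (2 * n)) A :=
  Matrix.of fun k l => if (k : ℕ) + 1 = i ∧ (l : ℕ) + 1 = j then 1 else 0

/-- The diagonal matrix `∑_j d_j E_{jj}`, `1 ≤ j ≤ 2n`. -/
def dg (A : Type*) [CommRing A] [Algebra K A] (n : ℕ) (d : ℕ → K) :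
    Matrix (Fin (2 * n)) (Fin (2 * n)) A :=
  Matrix.diagonal fun k => algebraMap K A (d ((k : ℕ) + 1))

/-- The eigenvalue of `ω_i` on the basis vector `v_j`, for `0 ≤ i ≤ n`; `c` is the value of
`γ`. -/
def wVal (n : ℕ) (c : K) (i j : ℕ) : K :=
  if i = 0 then
    c * (if j = 1 then P.s else if j = 2 then P.r⁻¹ else if j = bar n 2 then P.r
      else if j = bar n 1 then P.s⁻¹ else if j ≤ n then P.r⁻¹ * P.s⁻¹ else P.r * P.s)
  else if i < n then
    if j = i then P.r else if j = i + 1 then P.s else if j = bar n i then P.r⁻¹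
      else if j = bar n (i + 1) then P.s⁻¹ else 1
  else
    if j = n - 1 then P.s⁻¹ else if j = n then P.r else if j = bar n (n - 1) then P.s
      else if j = bar n n then P.r⁻¹ else if j ≤ n then P.r⁻¹ * P.s⁻¹ else P.r * P.s

/-- The eigenvalue of `ω'_i` on the basis vector `v_j`, for `0 ≤ i ≤ n`; `c` is the value of
`γ'`. -/
def wVal' (n : ℕ) (c : K) (i j : ℕ) : K :=
  if i = 0 then
    c * (if j = 1 then P.r else if j = 2 then P.s⁻¹ else if j = bar n 2 then P.s
      else if j = bar n 1 then P.r⁻¹ else if j ≤ n then P.r⁻¹ * P.s⁻¹ else P.r * P.s)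
  else if i < n then
    if j = i then P.s else if j = i + 1 then P.r else if j = bar n i then P.s⁻¹
      else if j = bar n (i + 1) then P.r⁻¹ else 1
  else
    if j = n - 1 then P.r⁻¹ else if j = n then P.s else if j = bar n (n - 1) then P.r
      else if j = bar n n then P.s⁻¹ else if j ≤ n then P.r⁻¹ * P.s⁻¹ else P.r * P.s

variable {A : Type*} [CommRing A] [Algebra K A]

/-- The matrix of `e_i`, `0 ≤ i ≤ n`, where `α` stands for `a u`. -/
def matE (n : ℕ) (α : A) (i : ℕ) : Matrix (Fin (2 * n)) (Fin (2 * n)) A :=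
  if i = 0 then α • (E A n (bar n 1) 2 - (P.r * P.s) • E A n (bar n 2) 1)
  else if i < n then E A n i (i + 1) - E A n (bar n (i + 1)) (bar n i)
  else (P.r * P.s)⁻¹ • E A n (n - 1) (bar n n) - E A n n (bar n (n - 1))

/-- The matrix of `f_i`, `0 ≤ i ≤ n`, where `β` stands for `b u⁻¹`. -/
def matF (n : ℕ) (β : A) (i : ℕ) : Matrix (Fin (2 * n)) (Fin (2 * n)) A :=
  if i = 0 then β • (E A n 2 (bar n 1) - E A n 1 (bar n 2))
  else if i < n then E A n (i + 1) i - (P.r * P.s)⁻¹ • E A n (bar n i) (bar n (i + 1))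
  else E A n (bar n n) (n - 1) - E A n (bar n (n - 1)) n

/-- The images of the generators under the evaluation representation, as matrices over a
commutative `K`-algebra `A` containing the spectral parameter `u`, with `α = a u`, `β = b u⁻¹`
and `c = r s a b`. -/
def evalGen (n : ℕ) (c : K) (α β : A) : Gen n → Matrix (Fin (2 * n)) (Fin (2 * n)) A
  | .e i => matE P n α i
  | .f i => matF P n β i
  | .w i => dg A n (wVal P n c i)
  | .wi i => dg A n fun j => (wVal P n c i j)⁻¹
  | .w' i => dg A n (wVal' P n c i)
  | .w'i i => dg A n fun j => (wVal' P n c i j)⁻¹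
  | .g => c • 1
  | .gi => c⁻¹ • 1
  | .g' => c • 1
  | .g'i => c⁻¹ • 1

section Lemmas

variable {n : ℕ}

theorem E_mul_eq {i j k l : ℕ} (h : j = k) (h1 : 1 ≤ j) (h2 : j ≤ 2 * n) :
    E A n i j * E A n k l = E A n i l := by
  subst h
  ext x y
  simp only [E, Matrix.mul_apply, Matrix.of_apply]
  rw [Finset.sum_eq_single (⟨j - 1, by omega⟩ : Fin (2 * n))]
  · have : j - 1 + 1 = j := by omega
    by_cases hx : (x : ℕ) + 1 = i <;> by_cases hy : (y : ℕ) + 1 = l <;> simp [this, hx, hy]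
  · intro b _ hb
    have : (b : ℕ) + 1 ≠ j := fun hh => hb (Fin.ext (by simp; omega))
    simp [this]
  · simp

theorem E_mul_ne {i j k l : ℕ} (h : j ≠ k) : E A n i j * E A n k l = 0 := by
  ext x y
  simp only [E, Matrix.mul_apply, Matrix.of_apply, Matrix.zero_apply]
  refine Finset.sum_eq_zero fun b _ => ?_
  by_cases hb : (b : ℕ) + 1 = j
  · have : (b : ℕ) + 1 ≠ k := by omega
    simp [this]
  · simp [hb]

theorem dg_mul_E (d : ℕ → K) (i j : ℕ) : dg A n d * E A n i j = d i • E A n i j := by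
  ext x y
  simp only [dg, E, Matrix.diagonal_mul, Matrix.of_apply, Matrix.smul_apply, Algebra.smul_def]
  split_ifs with h
  · rw [h.1]
  · simp

theorem E_mul_dg (d : ℕ → K) (i j : ℕ) : E A n i j * dg A n d = d j • E A n i j := by
  ext x y
  simp only [dg, E, Matrix.mul_diagonal, Matrix.of_apply, Matrix.smul_apply, Algebra.smul_def]
  split_ifs with h
  · rw [h.2, mul_comm]
  · simp

theorem dg_mul_dg (d d' : ℕ → K) : dg A n d * dg A n d' = dg A n fun j => d j * d' j := by
  simp [dg]

theorem dg_congr {d d' : ℕ → K} (h : ∀ j, 1 ≤ j → j ≤ 2 * n → d j = d' j) :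
    dg A n d = dg A n d' := by
  unfold dg
  congr 1
  funext k
  rw [h _ (by omega) (by omega)]

theorem dg_const (c : K) : dg A n (fun _ => c) = c • 1 := by
  ext x y
  by_cases h : x = y
  · subst h; simp [dg, Algebra.smul_def]
  · simp [dg, h]

/-- The row index of the first matrix unit in `e_i`. -/
def pI (n i : ℕ) : ℕ := if i = 0 then 2 * n else if i < n then i else n - 1

/-- The column index of the first matrix unit in `e_i`. -/
def qI (n i : ℕ) : ℕ := if i = 0 then 2 else if i < n then i + 1 else n + 1

variable (A) in
/-- A linear combination of the two matrix units of `e_i`. -/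
def eForm (n i : ℕ) (x y : A) : Matrix (Fin (2 * n)) (Fin (2 * n)) A :=
  x • E A n (pI n i) (qI n i) + y • E A n (bar n (qI n i)) (bar n (pI n i))

variable (A) in
/-- A linear combination of the two matrix units of `f_i`. -/
def fForm (n i : ℕ) (x y : A) : Matrix (Fin (2 * n)) (Fin (2 * n)) A :=
  x • E A n (qI n i) (pI n i) + y • E A n (bar n (pI n i)) (bar n (qI n i))

theorem E_transpose (i j : ℕ) : (E A n i j).transpose = E A n j i := by
  ext x y
  simp [E, and_comm]

theorem eForm_transpose (i : ℕ) (x y : A) : (eForm A n i x y).transpose = fForm A n i x y := by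
  simp [eForm, fForm, E_transpose]

/-- The first coefficient of `e_i`. -/
def eX (n : ℕ) (α : A) (i : ℕ) : A :=
  if i = 0 then α else if i < n then 1 else algebraMap K A (P.r * P.s)⁻¹

/-- The second coefficient of `e_i`. -/
def eY (α : A) (i : ℕ) : A := if i = 0 then -((P.r * P.s) • α) else -1

/-- The first coefficient of `f_i`. -/
def fX (β : A) (i : ℕ) : A := if i = 0 then β else 1

/-- The second coefficient of `f_i`. -/
def fY (n : ℕ) (β : A) (i : ℕ) : A :=
  if i = 0 then -β else if i < n then -algebraMap K A (P.r * P.s)⁻¹ else -1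

theorem matE_eq (hn : 3 ≤ n) (α : A) (i : ℕ) :
    matE P n α i = eForm A n i (eX P n α i) (eY P α i) := by
  have h1 : bar n 1 = 2 * n := by unfold bar; omega
  have h2 : bar n (2 * n) = 1 := by unfold bar; omega
  have h3 : bar n n = n + 1 := by unfold bar; omega
  have h4 : bar n (n + 1) = n := by unfold bar; omega
  unfold matE eForm pI qI eX eY
  split_ifs with h0 h5
  · rw [h1, h2, neg_smul, smul_assoc, smul_comm (P.r * P.s), smul_sub, sub_eq_add_neg]
  · module
  · rw [h3, h4, algebraMap_smul]
    module

theorem matF_eq (hn : 3 ≤ n) (β : A) (i : ℕ) :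
    matF P n β i = fForm A n i (fX β i) (fY P n β i) := by
  have h1 : bar n 1 = 2 * n := by unfold bar; omega
  have h2 : bar n (2 * n) = 1 := by unfold bar; omega
  have h3 : bar n n = n + 1 := by unfold bar; omega
  have h4 : bar n (n + 1) = n := by unfold bar; omega
  unfold matF fForm pI qI fX fY
  split_ifs with h0 h5
  · rw [h1, h2]
    module
  · rw [neg_smul, algebraMap_smul]
    module
  · rw [h3, h4]
    module

/-- The exponent of `r` in the eigenvalue of `ω_i` on `v_j`. -/
def wX (n i j : ℕ) : ℤ :=
  if i = 0 then
    if j = 1 then 0 else if j = 2 then -1 else if j = bar n 2 then 1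
      else if j = bar n 1 then 0 else if j ≤ n then -1 else 1
  else if i < n then
    if j = i then 1 else if j = i + 1 then 0 else if j = bar n i then -1 else 0
  else
    if j = n - 1 then 0 else if j = n then 1 else if j = bar n (n - 1) then 0
      else if j = bar n n then -1 else if j ≤ n then -1 else 1

/-- The exponent of `s` in the eigenvalue of `ω_i` on `v_j`. -/
def wY (n i j : ℕ) : ℤ :=
  if i = 0 then
    if j = 1 then 1 else if j = 2 then 0 else if j = bar n 2 then 0
      else if j = bar n 1 then -1 else if j ≤ n then -1 else 1
  else if i < n then
    if j = i then 0 else if j = i + 1 then 1 else if j = bar n i then 0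
      else if j = bar n (i + 1) then -1 else 0
  else
    if j = n - 1 then -1 else if j = n then 0 else if j = bar n (n - 1) then 1
      else if j = bar n n then 0 else if j ≤ n then -1 else 1

theorem wVal_eq (c : K) (i j : ℕ) :
    wVal P n c i j = (if i = 0 then c else 1) * (P.r ^ wX n i j * P.s ^ wY n i j) := by
  unfold wVal wX wY
  grind (splits := 40) [zpow_zero, zpow_one, zpow_neg_one]

theorem wVal'_eq (c : K) (i j : ℕ) :
    wVal' P n c i j = (if i = 0 then c else 1) * (P.r ^ wY n i j * P.s ^ wX n i j) := by
  unfold wVal' wX wY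
  grind (splits := 40) [zpow_zero, zpow_one, zpow_neg_one]

theorem wX_bar (hn : 3 ≤ n) {i k : ℕ} (hi : i ≤ n) (hk : 1 ≤ k) (hk2 : k ≤ 2 * n) :
    wX n i (bar n k) = -wX n i k := by
  unfold wX bar
  grind (splits := 40)

theorem wY_bar (hn : 3 ≤ n) {i k : ℕ} (hi : i ≤ n) (hk : 1 ≤ k) (hk2 : k ≤ 2 * n) :
    wY n i (bar n k) = -wY n i k := by
  unfold wY bar
  grind (splits := 40)

theorem wX_e (hn : 3 ≤ n) {i j : ℕ} (hi : i ≤ n) (hj : j ≤ n) :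
    wX n i (pI n j) = affRingel n j i + wX n i (qI n j) := by
  rw [affRingel_eq hn hj hi]
  unfold wX pI qI ringel cartanD bar
  grind (splits := 40)

theorem wY_e (hn : 3 ≤ n) {i j : ℕ} (hi : i ≤ n) (hj : j ≤ n) :
    wY n i (pI n j) = -affRingel n i j + wY n i (qI n j) := by
  rw [affRingel_eq hn hi hj]
  unfold wY pI qI ringel cartanD bar
  grind (splits := 40)

theorem pI_range (hn : 3 ≤ n) (i : ℕ) : 1 ≤ pI n i ∧ pI n i ≤ 2 * n := by
  unfold pI; grind

theorem qI_range (hn : 3 ≤ n) (i : ℕ) : 1 ≤ qI n i ∧ qI n i ≤ 2 * n := by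
  unfold qI; grind

theorem wVal_e (hn : 3 ≤ n) (c : K) {i j : ℕ} (hi : i ≤ n) (hj : j ≤ n) :
    wVal P n c i (pI n j) = Om P n j i * wVal P n c i (qI n j) ∧
    wVal P n c i (bar n (qI n j)) = Om P n j i * wVal P n c i (bar n (pI n j)) := by
  have hr := P.r_ne_zero
  have hs := P.s_ne_zero
  obtain ⟨p1, p2⟩ := pI_range hn j
  obtain ⟨q1, q2⟩ := qI_range hn j
  simp only [wVal_eq, wX_bar hn hi p1 p2, wX_bar hn hi q1 q2, wY_bar hn hi p1 p2,
    wY_bar hn hi q1 q2, wX_e hn hi hj, wY_e hn hi hj, Om, neg_add, zpow_add₀ hr, zpow_add₀ hs,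
    neg_neg]
  constructor
  · ring
  · have h1 : P.r ^ affRingel n j i ≠ 0 := zpow_ne_zero _ hr
    have h2 : P.s ^ affRingel n i j ≠ 0 := zpow_ne_zero _ hs
    simp only [zpow_neg]
    field_simp

theorem wVal'_e (hn : 3 ≤ n) (c : K) {i j : ℕ} (hi : i ≤ n) (hj : j ≤ n) :
    Om P n i j * wVal' P n c i (pI n j) = wVal' P n c i (qI n j) ∧
    Om P n i j * wVal' P n c i (bar n (qI n j)) = wVal' P n c i (bar n (pI n j)) := by
  have hr := P.r_ne_zero
  have hs := P.s_ne_zero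
  obtain ⟨p1, p2⟩ := pI_range hn j
  obtain ⟨q1, q2⟩ := qI_range hn j
  have h1 : P.r ^ affRingel n i j ≠ 0 := zpow_ne_zero _ hr
  have h2 : P.s ^ affRingel n j i ≠ 0 := zpow_ne_zero _ hs
  simp only [wVal'_eq, wX_bar hn hi p1 p2, wX_bar hn hi q1 q2, wY_bar hn hi p1 p2,
    wY_bar hn hi q1 q2, wX_e hn hi hj, wY_e hn hi hj, Om, neg_add, zpow_add₀ hr, zpow_add₀ hs,
    neg_neg, zpow_neg]
  constructor <;> field_simp

theorem wVal_ne_zero {c : K} (hc : c ≠ 0) (i j : ℕ) : wVal P n c i j ≠ 0 := by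
  rw [wVal_eq]
  refine mul_ne_zero ?_ (mul_ne_zero (zpow_ne_zero _ P.r_ne_zero) (zpow_ne_zero _ P.s_ne_zero))
  split_ifs <;> simp [hc]

theorem wVal'_ne_zero {c : K} (hc : c ≠ 0) (i j : ℕ) : wVal' P n c i j ≠ 0 := by
  rw [wVal'_eq]
  refine mul_ne_zero ?_ (mul_ne_zero (zpow_ne_zero _ P.r_ne_zero) (zpow_ne_zero _ P.s_ne_zero))
  split_ifs <;> simp [hc]

theorem eForm_mul_self (hn : 3 ≤ n) {i : ℕ} (hi : i ≤ n) (x y x' y' : A) :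
    eForm A n i x y * eForm A n i x' y' = 0 := by
  simp only [eForm, mul_add, add_mul, smul_mul_assoc, mul_smul_comm]
  rw [E_mul_ne, E_mul_ne, E_mul_ne, E_mul_ne]
  · simp
  all_goals (simp only [pI, qI, bar]; grind)

theorem E_triple {a b c d a' b' : ℕ} (h : b ≠ c ∨ d ≠ a') :
    E A n a b * E A n c d * E A n a' b' = 0 := by
  rcases h with h | h
  · rw [E_mul_ne h, zero_mul]
  · rw [mul_assoc, E_mul_ne h, mul_zero]

theorem eForm_triple (hn : 3 ≤ n) {i j : ℕ} (hi : i ≤ n) (hj : j ≤ n)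
    (x y x' y' x'' y'' : A) :
    eForm A n i x y * eForm A n j x' y' * eForm A n i x'' y'' = 0 := by
  simp only [eForm, mul_add, add_mul, smul_mul_assoc, mul_smul_comm]
  rw [E_triple, E_triple, E_triple, E_triple, E_triple, E_triple, E_triple, E_triple]
  · simp
  all_goals (simp only [pI, qI, bar]; grind (splits := 40))

theorem eForm_mul_zero (hn : 3 ≤ n) {i j : ℕ} (hi : i ≤ n) (hj : j ≤ n) (hij : i ≠ j)
    (hc : affCartan n i j = 0) (h01 : ¬(i = 0 ∧ j = 1)) (h10 : ¬(i = 1 ∧ j = 0))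
    (h1 : ¬(i + 1 = n ∧ j = n)) (h2 : ¬(i = n ∧ j + 1 = n)) (x y x' y' : A) :
    eForm A n i x y * eForm A n j x' y' = 0 := by
  rw [affCartan_eq hn hi, affRingel_eq hn hi hj, affRingel_eq hn hj hi] at hc
  unfold ringel cartanD at hc
  simp only [eForm, mul_add, add_mul, smul_mul_assoc, mul_smul_comm]
  rw [E_mul_ne, E_mul_ne, E_mul_ne, E_mul_ne]
  · simp
  all_goals (simp only [pI, qI, bar]; grind (splits := 40))

end Lemmas
end Rep

section Rep2
variable {K : Type*} [Field K] [Algebra ℂ K] (P : Params K) {A : Type*} [CommRing A] [Algebra K A]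
variable {n : ℕ}

theorem theta_wX (hn : 3 ≤ n) {j : ℕ} (hj : 1 ≤ j) (hj2 : j ≤ n) :
    wX n 0 j + ∑ i ∈ Finset.Icc 1 n, (highestRoot n i : ℤ) * wX n i j = 0 := by
  have h : ∀ i ∈ Finset.Icc 1 n, (highestRoot n i : ℤ) * wX n i j =
      (if i = j then (if j < n then (highestRoot n j : ℤ) else 0) else 0)
        + (if i = n then wX n n j else 0) := by
    intro i hi
    rw [Finset.mem_Icc] at hi
    unfold highestRoot wX bar
    grind (splits := 40)
  rw [Finset.sum_congr rfl h, Finset.sum_add_distrib, Finset.sum_ite_eq', Finset.sum_ite_eq']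
  simp only [Finset.mem_Icc]
  unfold highestRoot wX bar
  grind (splits := 40)

theorem theta_wY (hn : 3 ≤ n) {j : ℕ} (hj : 1 ≤ j) (hj2 : j ≤ n) :
    wY n 0 j + ∑ i ∈ Finset.Icc 1 n, (highestRoot n i : ℤ) * wY n i j = 0 := by
  have h : ∀ i ∈ Finset.Icc 1 n, (highestRoot n i : ℤ) * wY n i j =
      (if i = j - 1 then (highestRoot n (j - 1) : ℤ) else 0)
        + (if i = n then wY n n j else 0) := by
    intro i hi
    rw [Finset.mem_Icc] at hi
    unfold highestRoot wY bar
    grind (splits := 40)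
  rw [Finset.sum_congr rfl h, Finset.sum_add_distrib, Finset.sum_ite_eq', Finset.sum_ite_eq']
  simp only [Finset.mem_Icc]
  unfold highestRoot wY bar
  grind (splits := 40)

theorem theta_wX' (hn : 3 ≤ n) {j : ℕ} (hj : 1 ≤ j) (hj2 : j ≤ 2 * n) :
    wX n 0 j + ∑ i ∈ Finset.Icc 1 n, (highestRoot n i : ℤ) * wX n i j = 0 := by
  by_cases h : j ≤ n
  · exact theta_wX hn hj h
  · have hb : 1 ≤ bar n j ∧ bar n j ≤ n := by unfold bar; omega
    have h1 := theta_wX hn hb.1 hb.2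
    rw [wX_bar hn (by omega) hj hj2, Finset.sum_congr rfl fun i hi => by
      rw [wX_bar hn (Finset.mem_Icc.1 hi).2 hj hj2, mul_neg], Finset.sum_neg_distrib] at h1
    linarith

theorem theta_wY' (hn : 3 ≤ n) {j : ℕ} (hj : 1 ≤ j) (hj2 : j ≤ 2 * n) :
    wY n 0 j + ∑ i ∈ Finset.Icc 1 n, (highestRoot n i : ℤ) * wY n i j = 0 := by
  by_cases h : j ≤ n
  · exact theta_wY hn hj h
  · have hb : 1 ≤ bar n j ∧ bar n j ≤ n := by unfold bar; omega
    have h1 := theta_wY hn hb.1 hb.2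
    rw [wY_bar hn (by omega) hj hj2, Finset.sum_congr rfl fun i hi => by
      rw [wY_bar hn (Finset.mem_Icc.1 hi).2 hj hj2, mul_neg], Finset.sum_neg_distrib] at h1
    linarith

theorem thetaProd_zpow {r s : K} (hr : r ≠ 0) (hs : s ≠ 0) (x y : ℕ → ℤ) :
    thetaProd n (fun i => r ^ x i * s ^ y i) =
      r ^ (∑ i ∈ Finset.Icc 1 n, (highestRoot n i : ℤ) * x i) *
      s ^ (∑ i ∈ Finset.Icc 1 n, (highestRoot n i : ℤ) * y i) := by
  have key : ∀ (t : K), t ≠ 0 → ∀ (S : Finset ℕ) (f : ℕ → ℤ),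
      ∏ i ∈ S, t ^ f i = t ^ ∑ i ∈ S, f i := by
    intro t ht S f
    induction S using Finset.induction_on with
    | empty => simp
    | insert a S ha ih => rw [Finset.prod_insert ha, Finset.sum_insert ha, ih, zpow_add₀ ht]
  unfold thetaProd
  rw [List.prod_ofFn, ← key r hr, ← key s hs, ← Finset.prod_mul_distrib]
  simp only [Fin.val_succ]
  rw [Fin.prod_univ_eq_prod_range
    (fun i => (r ^ x (i + 1) * s ^ y (i + 1)) ^ highestRoot n (i + 1)) n, Finset.range_eq_Ico]
  rw [Finset.prod_Ico_add' (fun i => (r ^ x i * s ^ y i) ^ highestRoot n i) 0 n 1]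
  refine Finset.prod_congr (by ext; simp) fun i _ => ?_
  rw [mul_pow, mul_comm (highestRoot n i : ℤ), mul_comm (highestRoot n i : ℤ), zpow_mul, zpow_mul,
    zpow_natCast, zpow_natCast]

theorem thetaProd_dg (d : Fin (n + 1) → ℕ → K) :
    thetaProd n (fun i => dg A n (d i)) = dg A n fun j => thetaProd n fun i => d i j := by
  have key : ∀ (m : ℕ) (a : Fin m → ℕ) (z : Fin m → ℕ → K),
      (List.ofFn fun i => dg A n (z i) ^ a i).prod =
        dg A n fun j => (List.ofFn fun i => z i j ^ a i).prod := by
    intro m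
    induction m with
    | zero => intro a z; simp [dg_const]
    | succ m ih =>
      intro a z
      simp only [List.ofFn_succ, List.prod_cons]
      rw [ih (fun i => a i.succ) (fun i => z i.succ), ← dg_mul_dg]
      congr 1
      simp only [dg, Matrix.diagonal_pow]
      congr 1
      funext k
      simp
  exact key n _ _

theorem thetaProd_congr {B : Type*} [Monoid B] {y y' : Fin (n + 1) → B}
    (h : ∀ i : Fin n, y i.succ = y' i.succ) : thetaProd n y = thetaProd n y' := by
  unfold thetaProd
  simp only [h]

theorem theta_wVal (hn : 3 ≤ n) (c : K) {j : ℕ} (hj : 1 ≤ j) (hj2 : j ≤ 2 * n) :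
    wVal P n c 0 j * thetaProd n (fun i => wVal P n c i j) = c := by
  have h : thetaProd n (fun i => wVal P n c i j) =
      thetaProd n (fun i => P.r ^ wX n i j * P.s ^ wY n i j) :=
    thetaProd_congr fun i => by rw [wVal_eq]; simp
  rw [h, thetaProd_zpow P.r_ne_zero P.s_ne_zero (fun i => wX n i j) (fun i => wY n i j), wVal_eq]
  have h1 := theta_wX' hn hj hj2
  have h2 := theta_wY' hn hj hj2
  rw [eq_neg_of_add_eq_zero_left h1, eq_neg_of_add_eq_zero_left h2, zpow_neg, zpow_neg]
  have h3 := fun k : ℤ => zpow_ne_zero k P.r_ne_zero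
  have h4 := fun k : ℤ => zpow_ne_zero k P.s_ne_zero
  simp only [if_true]
  field_simp [h3, h4]

theorem theta_wVal' (hn : 3 ≤ n) (c : K) {j : ℕ} (hj : 1 ≤ j) (hj2 : j ≤ 2 * n) :
    wVal' P n c 0 j * thetaProd n (fun i => wVal' P n c i j) = c := by
  have h : thetaProd n (fun i => wVal' P n c i j) =
      thetaProd n (fun i => P.r ^ wY n i j * P.s ^ wX n i j) :=
    thetaProd_congr fun i => by rw [wVal'_eq]; simp
  rw [h, thetaProd_zpow P.r_ne_zero P.s_ne_zero (fun i => wY n i j) (fun i => wX n i j), wVal'_eq]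
  have h1 := theta_wX' hn hj hj2
  have h2 := theta_wY' hn hj hj2
  rw [eq_neg_of_add_eq_zero_left h1, eq_neg_of_add_eq_zero_left h2, zpow_neg, zpow_neg]
  have h3 := fun k : ℤ => zpow_ne_zero k P.r_ne_zero
  have h4 := fun k : ℤ => zpow_ne_zero k P.s_ne_zero
  simp only [if_true]
  field_simp [h3, h4]

/-- A diagonal matrix supported on the four indices `p, q, q', p'`. -/
theorem dg_four (hn : 3 ≤ n) {i : ℕ} (hi : i ≤ n) (d : ℕ → K)
    (h : ∀ j, 1 ≤ j → j ≤ 2 * n → j ≠ pI n i → j ≠ qI n i → j ≠ bar n (pI n i) →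
      j ≠ bar n (qI n i) → d j = 0) :
    dg A n d = d (pI n i) • E A n (pI n i) (pI n i) + d (qI n i) • E A n (qI n i) (qI n i)
      + d (bar n (qI n i)) • E A n (bar n (qI n i)) (bar n (qI n i))
      + d (bar n (pI n i)) • E A n (bar n (pI n i)) (bar n (pI n i)) := by
  have h1 : pI n i ≠ qI n i := by unfold pI qI; grind
  have h2 : pI n i ≠ bar n (qI n i) := by unfold pI qI bar; grind
  have h3 : pI n i ≠ bar n (pI n i) := by unfold pI bar; grind
  have h4 : qI n i ≠ bar n (qI n i) := by unfold qI bar; grind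
  have h5 : qI n i ≠ bar n (pI n i) := by unfold pI qI bar; grind
  have h6 : bar n (qI n i) ≠ bar n (pI n i) := by unfold pI qI bar; grind
  generalize bar n (pI n i) = p' at *
  generalize bar n (qI n i) = q' at *
  generalize pI n i = p at *
  generalize qI n i = q at *
  ext x y
  by_cases hxy : x = y
  · subst hxy
    have hx := h (x + 1) (by omega) (by omega)
    simp only [dg, E, Matrix.diagonal_apply_eq, Matrix.add_apply, Matrix.smul_apply,
      Matrix.of_apply, and_self, Algebra.algebraMap_eq_smul_one]
    by_cases a1 : (x : ℕ) + 1 = p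
    · simp [a1, h1, h2, h3]
    · by_cases a2 : (x : ℕ) + 1 = q
      · simp [a2, h1.symm, h4, h5]
      · by_cases a3 : (x : ℕ) + 1 = q'
        · simp [a3, h2.symm, h4.symm, h6]
        · by_cases a4 : (x : ℕ) + 1 = p'
          · simp [a4, h3.symm, h5.symm, h6.symm]
          · simp [a1, a2, a3, a4, hx a1 a2 a4 a3]
  · have hv : ∀ t, ¬((x : ℕ) + 1 = t ∧ (y : ℕ) + 1 = t) := by
      rintro t ⟨t1, t2⟩
      exact hxy (Fin.ext (by omega))
    simp [dg, E, hxy, hv]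

theorem e_comm_f_aux {i j : ℕ} (h1 : qI n i ≠ qI n j) (h2 : qI n i ≠ bar n (pI n j))
    (h3 : bar n (pI n i) ≠ qI n j) (h4 : bar n (pI n i) ≠ bar n (pI n j))
    (h5 : pI n j ≠ pI n i) (h6 : pI n j ≠ bar n (qI n i)) (h7 : bar n (qI n j) ≠ pI n i)
    (h8 : bar n (qI n j) ≠ bar n (qI n i)) (x y z w : A) :
    eForm A n i x y * fForm A n j z w - fForm A n j z w * eForm A n i x y = 0 := by
  simp only [eForm, fForm, mul_add, add_mul, smul_mul_assoc, mul_smul_comm]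
  rw [E_mul_ne h1, E_mul_ne h2, E_mul_ne h3, E_mul_ne h4, E_mul_ne h5, E_mul_ne h6, E_mul_ne h7,
    E_mul_ne h8]
  simp

theorem e_comm_f_zero (hn : 3 ≤ n) {i j : ℕ} (hi : i ≤ n) (hj : j ≤ n) (hij : i ≠ j)
    (h01 : ¬(i = 0 ∧ j = 1)) (h10 : ¬(i = 1 ∧ j = 0))
    (h1 : ¬(i + 1 = n ∧ j = n)) (h2 : ¬(i = n ∧ j + 1 = n)) (x y z w : A) :
    eForm A n i x y * fForm A n j z w - fForm A n j z w * eForm A n i x y = 0 := by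
  apply e_comm_f_aux <;> simp only [pI, qI, bar] <;> grind (splits := 40)

end Rep2

section Rep3
variable {K : Type*} [Field K] [Algebra ℂ K] (P : Params K) {A : Type*} [CommRing A] [Algebra K A]
variable {n : ℕ}

theorem wXY_p (hn : 3 ≤ n) {i : ℕ} :
    wX n i (pI n i) = (if 0 < i ∧ i < n then 1 else 0) ∧
    wY n i (pI n i) = (if 0 < i ∧ i < n then 0 else -1) := by
  unfold wX wY pI bar
  grind (splits := 40)

theorem wXY_q (hn : 3 ≤ n) {i : ℕ} :
    wX n i (qI n i) = (if 0 < i ∧ i < n then 0 else -1) ∧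
    wY n i (qI n i) = (if 0 < i ∧ i < n then 1 else 0) := by
  unfold wX wY qI bar
  grind (splits := 40)

theorem wX_eq_wY (hn : 3 ≤ n) {i : ℕ} (hi : i ≤ n) {j : ℕ} (hj : 1 ≤ j) (hj2 : j ≤ 2 * n)
    (hp : j ≠ pI n i) (hq : j ≠ qI n i) (hp' : j ≠ bar n (pI n i)) (hq' : j ≠ bar n (qI n i)) :
    wX n i j = wY n i j := by
  unfold pI bar at *
  unfold qI at *
  unfold wX wY bar
  grind (splits := 40)

/-- The coefficients of `[e_i, f_i]` in matrix units. -/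
theorem wVal_sub (hn : 3 ≤ n) {i : ℕ} (hi : i ≤ n) (c : K) {α β : A}
    (hαβ : α * β = algebraMap K A (c * (P.r * P.s)⁻¹)) (d : ℕ → K)
    (hd : d = fun j => (P.r - P.s)⁻¹ * (wVal P n c i j - wVal' P n c i j)) :
    (∀ j, 1 ≤ j → j ≤ 2 * n → j ≠ pI n i → j ≠ qI n i → j ≠ bar n (pI n i) →
      j ≠ bar n (qI n i) → d j = 0) ∧
    eX P n α i * fX β i = algebraMap K A (d (pI n i)) ∧
    d (qI n i) = -d (pI n i) ∧
    eY P α i * fY P n β i = algebraMap K A (d (bar n (qI n i))) ∧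
    d (bar n (pI n i)) = -d (bar n (qI n i)) := by
  have hr := P.r_ne_zero
  have hs := P.s_ne_zero
  have hrs := sub_ne_zero.2 P.r_ne_s
  obtain ⟨p1, p2⟩ := pI_range hn i
  obtain ⟨q1, q2⟩ := qI_range hn i
  refine ⟨fun j hj1 hj2 hp hq hp' hq' => ?_, ?_⟩
  · rw [hd]
    simp [wVal_eq, wVal'_eq, wX_eq_wY hn hi hj1 hj2 hp hq hp' hq']
  · have dp : d (pI n i) = if i = 0 then c * (P.r * P.s)⁻¹ else if i < n then 1
        else (P.r * P.s)⁻¹ := by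
      rw [hd]
      simp only [wVal_eq, wVal'_eq, (wXY_p hn).1, (wXY_p hn).2]
      split_ifs <;> first | omega | (simp; try field_simp; try ring)
    have dq' : d (bar n (qI n i)) = if i = 0 then c else if i < n then (P.r * P.s)⁻¹
        else 1 := by
      rw [hd]
      simp only [wVal_eq, wVal'_eq, wX_bar hn hi q1 q2, wY_bar hn hi q1 q2, (wXY_q hn).1,
        (wXY_q hn).2]
      split_ifs <;> first | omega | (simp; try field_simp; try ring)
    refine ⟨?_, ?_, ?_, ?_⟩
    · rw [dp]
      unfold eX fX
      split_ifs <;> simp_all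
    · rw [hd]
      simp only [wVal_eq, wVal'_eq, (wXY_p hn).1, (wXY_p hn).2, (wXY_q hn).1,
        (wXY_q hn).2]
      split_ifs <;> ring
    · rw [dq']
      unfold eY fY
      split_ifs
      · rw [neg_mul_neg, smul_mul_assoc, hαβ, Algebra.smul_def, ← map_mul]
        congr 1
        field_simp
      · simp
      · simp
    · rw [hd]
      simp only [wVal_eq, wVal'_eq, wX_bar hn hi p1 p2, wY_bar hn hi p1 p2, wX_bar hn hi q1 q2,
        wY_bar hn hi q1 q2, (wXY_p hn).1, (wXY_p hn).2, (wXY_q hn).1,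
        (wXY_q hn).2]
      split_ifs <;> ring

theorem e_comm_f_self (hn : 3 ≤ n) {i : ℕ} (hi : i ≤ n) {c : K} {α β : A}
    (hαβ : α * β = algebraMap K A (c * (P.r * P.s)⁻¹)) :
    matE P n α i * matF P n β i - matF P n β i * matE P n α i =
      (P.r - P.s)⁻¹ • (dg A n (wVal P n c i) - dg A n (wVal' P n c i)) := by
  have hd : (P.r - P.s)⁻¹ • (dg A n (wVal P n c i) - dg A n (wVal' P n c i)) =
      dg A n (fun j => (P.r - P.s)⁻¹ * (wVal P n c i j - wVal' P n c i j)) := by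
    ext x y
    by_cases h : x = y
    · subst h; simp [dg, Algebra.smul_def]
    · simp [dg, h]
  rw [hd]
  generalize hd' : (fun j => (P.r - P.s)⁻¹ * (wVal P n c i j - wVal' P n c i j)) = d
  obtain ⟨h0, h1, h2, h3, h4⟩ := wVal_sub P hn hi c hαβ d hd'.symm
  obtain ⟨p1, p2⟩ := pI_range hn i
  obtain ⟨q1, q2⟩ := qI_range hn i
  have k1 : qI n i ≠ bar n (pI n i) := by unfold pI qI bar; grind
  have k2 : bar n (qI n i) ≠ pI n i := by unfold pI qI bar; grind
  have k3 : pI n i ≠ bar n (qI n i) := k2.symm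
  rw [dg_four hn hi d h0, matE_eq P hn, matF_eq P hn, h2, h4]
  simp only [eForm, fForm, mul_add, add_mul, smul_mul_assoc, mul_smul_comm]
  rw [E_mul_eq rfl q1 q2, E_mul_eq rfl p1 p2, E_mul_ne k1, E_mul_ne k1.symm, E_mul_ne k3,
    E_mul_ne k2, E_mul_eq rfl (by unfold bar; omega) (by unfold bar; omega),
    E_mul_eq rfl (by unfold bar; omega) (by unfold bar; omega)]
  have key : ∀ (k : K) (M : Matrix (Fin (2 * n)) (Fin (2 * n)) A),
      k • M = algebraMap K A k • M := fun k M => (algebraMap_smul A k M).symm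
  simp only [neg_smul, key (d _), ← h1, ← h3, smul_zero]
  module

/-- The pairs of generators with `c_ij = 0` whose matrices have a non-zero product. -/
def specA (i j : ℕ) : Prop := (i = 0 ∧ j = 1) ∨ (i = 1 ∧ j = 0)

/-- The pairs of generators with `c_ij = 0` whose matrices have a non-zero product. -/
def specB (n i j : ℕ) : Prop := (i + 1 = n ∧ j = n) ∨ (i = n ∧ j + 1 = n)

theorem specA_idx (hn : 3 ≤ n) {i j : ℕ} (h : specA i j) :
    pI n j = bar n (pI n i) ∧ bar n (pI n j) = pI n i ∧ qI n j = qI n i ∧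
    pI n i ≠ qI n i ∧ pI n i ≠ bar n (qI n i) ∧ pI n i ≠ bar n (pI n i) ∧
      qI n i ≠ bar n (qI n i) ∧ qI n i ≠ bar n (pI n i) ∧ bar n (qI n i) ≠ bar n (pI n i) := by
  unfold specA at h
  unfold pI bar qI
  grind (splits := 40)

theorem specB_idx (hn : 3 ≤ n) {i j : ℕ} (h : specB n i j) :
    qI n j = bar n (qI n i) ∧ bar n (qI n j) = qI n i ∧ pI n j = pI n i ∧
    pI n i ≠ qI n i ∧ pI n i ≠ bar n (qI n i) ∧ pI n i ≠ bar n (pI n i) ∧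
      qI n i ≠ bar n (qI n i) ∧ qI n i ≠ bar n (pI n i) ∧ bar n (qI n i) ≠ bar n (pI n i) := by
  unfold specB at h
  unfold pI bar qI
  grind (splits := 40)

theorem e_comm_f_specA (hn : 3 ≤ n) {i j : ℕ} (h : specA i j) {x y z w : A} (hxy : x * z = y * w) :
    eForm A n i x y * fForm A n j z w - fForm A n j z w * eForm A n i x y = 0 := by
  obtain ⟨p1, p2⟩ := pI_range hn i
  obtain ⟨q1, q2⟩ := qI_range hn i
  have b1 : 1 ≤ bar n (pI n i) ∧ bar n (pI n i) ≤ 2 * n := by unfold bar; omega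
  have b2 : 1 ≤ bar n (qI n i) ∧ bar n (qI n i) ≤ 2 * n := by unfold bar; omega
  obtain ⟨h1, h2, h3, k1, k2, k3, k4, k5, k6⟩ := specA_idx hn h
  simp only [eForm, fForm, h1, h2, h3, mul_add, add_mul, smul_mul_assoc, mul_smul_comm]
  have h4 : bar n (bar n (pI n i)) = pI n i := by unfold bar; omega
  rw [h4, E_mul_eq rfl q1 q2, E_mul_ne k1.symm, E_mul_ne k5.symm, E_mul_ne k3.symm,
    E_mul_ne k3.symm, E_mul_ne k2.symm, E_mul_ne k6.symm, E_mul_eq rfl b2.1 b2.2]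
  match_scalars
  linear_combination hxy

theorem e_comm_f_specB (hn : 3 ≤ n) {i j : ℕ} (h : specB n i j) {x y z w : A}
    (hxy : x * z = y * w) :
    eForm A n i x y * fForm A n j z w - fForm A n j z w * eForm A n i x y = 0 := by
  obtain ⟨p1, p2⟩ := pI_range hn i
  obtain ⟨q1, q2⟩ := qI_range hn i
  have b1 : 1 ≤ bar n (pI n i) ∧ bar n (pI n i) ≤ 2 * n := by unfold bar; omega
  have b2 : 1 ≤ bar n (qI n i) ∧ bar n (qI n i) ≤ 2 * n := by unfold bar; omega
  obtain ⟨h1, h2, h3, k1, k2, k3, k4, k5, k6⟩ := specB_idx hn h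
  simp only [eForm, fForm, h1, h2, h3, mul_add, add_mul, smul_mul_assoc, mul_smul_comm]
  have h4 : bar n (bar n (qI n i)) = qI n i := by unfold bar; omega
  rw [h4]
  simp only [E_mul_eq (rfl : pI n i = _) p1 p2, E_mul_eq rfl b1.1 b1.2, E_mul_ne k1, E_mul_ne k2,
    E_mul_ne k3, E_mul_ne k4, E_mul_ne k5, E_mul_ne k6, E_mul_ne k1.symm, E_mul_ne k2.symm,
    E_mul_ne k3.symm, E_mul_ne k4.symm, E_mul_ne k5.symm, E_mul_ne k6.symm]
  match_scalars
  linear_combination -hxy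

theorem e_mul_e_specA (hn : 3 ≤ n) {i j : ℕ} (h : specA i j) (x y z w : A) :
    eForm A n i x y * eForm A n j z w = (y * z) • E A n (bar n (qI n i)) (qI n i) ∧
    eForm A n j z w * eForm A n i x y = (w * x) • E A n (bar n (qI n i)) (qI n i) := by
  obtain ⟨p1, p2⟩ := pI_range hn i
  have b1 : 1 ≤ bar n (pI n i) ∧ bar n (pI n i) ≤ 2 * n := by unfold bar; omega
  obtain ⟨h1, h2, h3, k1, k2, k3, k4, k5, k6⟩ := specA_idx hn h
  simp only [eForm, h1, h2, h3, mul_add, add_mul, smul_mul_assoc, mul_smul_comm]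
  have h4 : bar n (bar n (pI n i)) = pI n i := by unfold bar; omega
  rw [h4]
  simp only [E_mul_eq (rfl : pI n i = _) p1 p2, E_mul_eq rfl b1.1 b1.2, E_mul_ne k1, E_mul_ne k2,
    E_mul_ne k3, E_mul_ne k4, E_mul_ne k5, E_mul_ne k6, E_mul_ne k1.symm, E_mul_ne k2.symm,
    E_mul_ne k3.symm, E_mul_ne k4.symm, E_mul_ne k5.symm, E_mul_ne k6.symm]
  constructor <;> module

theorem e_mul_e_specB (hn : 3 ≤ n) {i j : ℕ} (h : specB n i j) (x y z w : A) :
    eForm A n i x y * eForm A n j z w = (x * w) • E A n (pI n i) (bar n (pI n i)) ∧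
    eForm A n j z w * eForm A n i x y = (z * y) • E A n (pI n i) (bar n (pI n i)) := by
  obtain ⟨q1, q2⟩ := qI_range hn i
  have b1 : 1 ≤ bar n (qI n i) ∧ bar n (qI n i) ≤ 2 * n := by unfold bar; omega
  obtain ⟨h1, h2, h3, k1, k2, k3, k4, k5, k6⟩ := specB_idx hn h
  simp only [eForm, h1, h2, h3, mul_add, add_mul, smul_mul_assoc, mul_smul_comm]
  have h4 : bar n (bar n (qI n i)) = qI n i := by unfold bar; omega
  rw [h4]
  simp only [E_mul_eq (rfl : qI n i = _) q1 q2, E_mul_eq rfl b1.1 b1.2, E_mul_ne k1, E_mul_ne k2,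
    E_mul_ne k3, E_mul_ne k4, E_mul_ne k5, E_mul_ne k6, E_mul_ne k1.symm, E_mul_ne k2.symm,
    E_mul_ne k3.symm, E_mul_ne k4.symm, E_mul_ne k5.symm, E_mul_ne k6.symm]
  constructor <;> module

theorem e_comm_f_ne (hn : 3 ≤ n) {i j : ℕ} (hi : i ≤ n) (hj : j ≤ n) (hij : i ≠ j) (α β : A) :
    matE P n α i * matF P n β j - matF P n β j * matE P n α i = 0 := by
  have hr := P.r_ne_zero
  have hs := P.s_ne_zero
  have hrs := mul_ne_zero hr hs
  rw [matE_eq P hn, matF_eq P hn]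
  by_cases hA : specA i j
  · refine e_comm_f_specA hn hA ?_
    have h1 : ¬ n = 0 := by omega
    have h2 : 1 < n := by omega
    rcases hA with ⟨rfl, rfl⟩ | ⟨rfl, rfl⟩ <;>
      simp [eX, eY, fX, fY, h2, Algebra.smul_def]
    rw [mul_right_comm, ← map_mul, ← map_mul, ← map_mul,
      show P.r * P.s * (P.s⁻¹ * P.r⁻¹) = 1 by field_simp, map_one, one_mul]
  by_cases hB : specB n i j
  · refine e_comm_f_specB hn hB ?_
    rcases hB with ⟨h, rfl⟩ | ⟨rfl, h⟩
    · have h1 : i ≠ 0 := by omega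
      have h2 : i < j := by omega
      have h3 : j ≠ 0 := by omega
      simp [eX, eY, fX, fY, h1, h2, h3]
    · have h1 : i ≠ 0 := by omega
      have h2 : j < i := by omega
      have h3 : j ≠ 0 := by omega
      simp [eX, eY, fX, fY, h1, h2, h3]
  exact e_comm_f_zero hn hi hj hij (fun h => hA (Or.inl h)) (fun h => hA (Or.inr h))
    (fun h => hB (Or.inl h)) (fun h => hB (Or.inr h)) _ _ _ _

end Rep3

section Rep4
variable {K : Type*} [Field K] [Algebra ℂ K] (P : Params K) {A : Type*} [CommRing A] [Algebra K A]
variable {n : ℕ}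

/-- The Serre relations for linear combinations of matrix units. -/
theorem serre_form (hn : 3 ≤ n) {i j : ℕ} (hi : i ≤ n) (hj : j ≤ n) (hij : i ≠ j) {x y z w : A}
    (hA : specA i j → y * z = Om P n j i • (w * x))
    (hB : specB n i j → x * w = Om P n j i • (z * y)) :
    ∑ k ∈ Finset.range (serreExp n i j + 1), serreCoeff P n i j k •
      (eForm A n i x y ^ (serreExp n i j - k) * eForm A n j z w * eForm A n i x y ^ k) = 0 := by
  rcases affCartan_cases hn hi hj hij with hc | hc
  · obtain ⟨k1, k2, k3⟩ := serre_zero P hc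
    simp only [k1, Finset.sum_range_succ, k2, k3, Finset.sum_range_zero, zero_add, one_smul,
      Nat.sub_zero, pow_zero, mul_one, pow_one, Nat.sub_self, one_mul, neg_smul]
    rw [← sub_eq_add_neg, sub_eq_zero]
    by_cases h1 : specA i j
    · obtain ⟨g1, g2⟩ := e_mul_e_specA hn h1 x y z w
      rw [g1, g2, hA h1, smul_assoc]
    by_cases h2 : specB n i j
    · obtain ⟨g1, g2⟩ := e_mul_e_specB hn h2 x y z w
      rw [g1, g2, hB h2, smul_assoc]
    have hc' : affCartan n j i = 0 := by
      rw [affCartan_eq hn hj]; rw [affCartan_eq hn hi] at hc; omega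
    rw [eForm_mul_zero hn hi hj hij hc (fun h => h1 (Or.inl h)) (fun h => h1 (Or.inr h))
        (fun h => h2 (Or.inl h)) (fun h => h2 (Or.inr h)),
      eForm_mul_zero hn hj hi hij.symm hc' (fun h => h1 (Or.inr h.symm))
        (fun h => h1 (Or.inl h.symm)) (fun h => h2 (Or.inr h.symm))
        (fun h => h2 (Or.inl h.symm)), smul_zero]
  · obtain ⟨k1, k2, k3, k4⟩ := serre_one P hc
    simp only [k1, Finset.sum_range_succ, Finset.sum_range_zero, zero_add,
      Nat.sub_zero, pow_zero, mul_one, pow_one, Nat.sub_self, one_mul, pow_two,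
      Nat.add_one_sub_one]
    rw [eForm_triple hn hi hj, mul_assoc, ← mul_assoc (eForm A n i x y) (eForm A n i x y),
      eForm_mul_self hn hi]
    simp

theorem serre_form' (hn : 3 ≤ n) {i j : ℕ} (hi : i ≤ n) (hj : j ≤ n) (hij : i ≠ j) {x y z w : A}
    (hA : specA i j → y * z = Om P n j i • (w * x))
    (hB : specB n i j → x * w = Om P n j i • (z * y)) :
    ∑ k ∈ Finset.range (serreExp n i j + 1), serreCoeff P n i j k •
      (fForm A n i x y ^ k * fForm A n j z w * fForm A n i x y ^ (serreExp n i j - k)) = 0 := by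
  have h := congrArg Matrix.transpose (serre_form P hn hi hj hij hA hB)
  simpa only [Matrix.transpose_sum, Matrix.transpose_smul, Matrix.transpose_mul,
    Matrix.transpose_pow, eForm_transpose, Matrix.transpose_zero, mul_assoc] using h

theorem dg_mul_eForm {d : ℕ → K} {o : K} {i : ℕ} (h1 : d (pI n i) = o * d (qI n i))
    (h2 : d (bar n (qI n i)) = o * d (bar n (pI n i))) (x y : A) :
    dg A n d * eForm A n i x y = o • (eForm A n i x y * dg A n d) := by
  simp only [eForm, mul_add, add_mul, mul_smul_comm, smul_mul_assoc, dg_mul_E, E_mul_dg, h1, h2,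
    smul_add, mul_smul, smul_comm o]

theorem dg_mul_fForm {d : ℕ → K} {o : K} {i : ℕ} (h1 : d (qI n i) = o * d (pI n i))
    (h2 : d (bar n (pI n i)) = o * d (bar n (qI n i))) (x y : A) :
    dg A n d * fForm A n i x y = o • (fForm A n i x y * dg A n d) := by
  simp only [fForm, mul_add, add_mul, mul_smul_comm, smul_mul_assoc, dg_mul_E, E_mul_dg, h1, h2,
    smul_add, mul_smul, smul_comm o]

theorem Om_specA (hn : 3 ≤ n) : Om P n 1 0 = P.r * P.s ∧ Om P n 0 1 = (P.r * P.s)⁻¹ := by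
  have h1 : affRingel n 1 0 = 1 := by
    rw [affRingel_eq hn (by omega) (by omega)]; simp; omega
  have h2 : affRingel n 0 1 = -1 := by
    rw [affRingel_eq hn (by omega) (by omega)]; simp; omega
  simp [Om, h1, h2, mul_comm]

theorem Om_specB {m : ℕ} (hn : 3 ≤ m + 1) : Om P (m + 1) (m + 1) m = P.r * P.s ∧
    Om P (m + 1) m (m + 1) = (P.r * P.s)⁻¹ := by
  have h1 : affRingel (m + 1) (m + 1) m = 1 := by
    rw [affRingel_pos (by omega) (by omega) (by omega) (by omega)]; simp [ringel]
  have h2 : affRingel (m + 1) m (m + 1) = -1 := by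
    rw [affRingel_pos (by omega) (by omega) (by omega) (by omega)]; simp [ringel]
  simp [Om, h1, h2, mul_comm]

/-- The matrices of the evaluation representation satisfy the relations. -/
theorem eval_rel (hn : 3 ≤ n) {c : K} (hc : c ≠ 0) {α β : A}
    (hαβ : α * β = algebraMap K A (c * (P.r * P.s)⁻¹)) :
    ∀ a b, AffRel P n (evalGen P n c α β) a b → a = b := by
  have hr := P.r_ne_zero
  have hs := P.s_ne_zero
  have hrs := mul_ne_zero hr hs
  have hle : ∀ i : Fin (n + 1), (i : ℕ) ≤ n := fun i => Nat.lt_succ_iff.1 i.2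
  have hone : algebraMap K A P.r * algebraMap K A P.s *
      (algebraMap K A P.s⁻¹ * algebraMap K A P.r⁻¹) = 1 := by
    rw [← map_mul, ← map_mul, ← map_mul, show P.r * P.s * (P.s⁻¹ * P.r⁻¹) = 1 by field_simp,
      map_one]
  intro a b hab
  cases hab with
  | g_def =>
    simp only [evalGen]
    rw [thetaProd_dg (A := A) (fun i : Fin (n + 1) => wVal P n c i), dg_mul_dg, ← dg_const]
    exact dg_congr fun j h1 h2 => (theta_wVal P hn c h1 h2).symm
  | g'_def =>
    simp only [evalGen]
    rw [thetaProd_dg (A := A) (fun i : Fin (n + 1) => wVal' P n c i), dg_mul_dg, ← dg_const]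
    exact dg_congr fun j h1 h2 => (theta_wVal' P hn c h1 h2).symm
  | g_gi => simp [evalGen, smul_smul, hc]
  | gi_g => simp [evalGen, smul_smul, hc]
  | g'_g'i => simp [evalGen, smul_smul, hc]
  | g'i_g' => simp [evalGen, smul_smul, hc]
  | g_central y => simp [evalGen]
  | g'_central y => simp [evalGen]
  | w_w i j => simp only [evalGen, dg_mul_dg, mul_comm]
  | w_w' i j => simp only [evalGen, dg_mul_dg, mul_comm]
  | w'_w' i j => simp only [evalGen, dg_mul_dg, mul_comm]
  | w_wi i => simp [evalGen, dg_mul_dg, wVal_ne_zero P hc, dg_const]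
  | wi_w i => simp [evalGen, dg_mul_dg, wVal_ne_zero P hc, dg_const]
  | w'_w'i i => simp [evalGen, dg_mul_dg, wVal'_ne_zero P hc, dg_const]
  | w'i_w' i => simp [evalGen, dg_mul_dg, wVal'_ne_zero P hc, dg_const]
  | w_e i j =>
    obtain ⟨h1, h2⟩ := wVal_e P hn c (hle i) (hle j)
    simp only [evalGen, matE_eq P hn]
    exact dg_mul_eForm h1 h2 _ _
  | w_f i j =>
    obtain ⟨h1, h2⟩ := wVal_e P hn c (hle i) (hle j)
    simp only [evalGen, matF_eq P hn]
    exact dg_mul_fForm (by rw [h1, inv_mul_cancel_left₀ (Om_ne_zero P _ _)])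
      (by rw [h2, inv_mul_cancel_left₀ (Om_ne_zero P _ _)]) _ _
  | w'_e i j =>
    obtain ⟨h1, h2⟩ := wVal'_e P hn c (hle i) (hle j)
    simp only [evalGen, matE_eq P hn]
    exact dg_mul_eForm (by rw [← h1, inv_mul_cancel_left₀ (Om_ne_zero P _ _)])
      (by rw [← h2, inv_mul_cancel_left₀ (Om_ne_zero P _ _)]) _ _
  | w'_f i j =>
    obtain ⟨h1, h2⟩ := wVal'_e P hn c (hle i) (hle j)
    simp only [evalGen, matF_eq P hn]
    exact dg_mul_fForm h1.symm h2.symm _ _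
  | e_f i j =>
    simp only [evalGen]
    by_cases hij : i = j
    · subst hij
      simp only [if_true]
      exact e_comm_f_self P hn (hle i) hαβ
    · rw [if_neg hij]
      exact e_comm_f_ne P hn (hle i) (hle j) (fun hh => hij (Fin.ext hh)) α β
  | serre_e i j hij =>
    simp only [evalGen, matE_eq P hn]
    have hi := hle i
    have hj := hle j
    replace hij : (i : ℕ) ≠ j := fun hh => hij (Fin.ext hh)
    generalize (i : ℕ) = i' at *
    generalize (j : ℕ) = j' at *
    refine serre_form P hn hi hj hij ?_ ?_
    · have h2 : 1 < n := by omega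
      rintro (⟨rfl, rfl⟩ | ⟨rfl, rfl⟩)
      · simp [eX, eY, h2, (Om_specA P hn).1]
      · simp [eX, eY, h2, (Om_specA P hn).2, smul_smul]
        rw [show P.s⁻¹ * P.r⁻¹ * (P.r * P.s) = 1 by field_simp, one_smul]
    · rintro (⟨h, rfl⟩ | ⟨rfl, h⟩)
      · subst h
        have h1 : i' ≠ 0 := by omega
        simp [eX, eY, h1, (Om_specB P hn).1, Algebra.smul_def]
        linear_combination -hone
      · subst h
        have h1 : j' ≠ 0 := by omega
        simp [eX, eY, h1, (Om_specB P hn).2, Algebra.smul_def]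
  | serre_f i j hij =>
    simp only [evalGen, matF_eq P hn]
    have hi := hle i
    have hj := hle j
    replace hij : (i : ℕ) ≠ j := fun hh => hij (Fin.ext hh)
    generalize (i : ℕ) = i' at *
    generalize (j : ℕ) = j' at *
    refine serre_form' P hn hi hj hij ?_ ?_
    · have h2 : 1 < n := by omega
      have h3 : n ≠ 0 := by omega
      rintro (⟨rfl, rfl⟩ | ⟨rfl, rfl⟩)
      · simp [fX, fY, h2, (Om_specA P hn).1, Algebra.smul_def]
        linear_combination -β * hone
      · simp [fX, fY, h2, (Om_specA P hn).2, Algebra.smul_def]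
    · rintro (⟨h, rfl⟩ | ⟨rfl, h⟩)
      · subst h
        have h1 : i' ≠ 0 := by omega
        simp [fX, fY, h1, (Om_specB P hn).1, Algebra.smul_def]
        linear_combination -hone
      · subst h
        have h1 : j' ≠ 0 := by omega
        simp [fX, fY, h1, (Om_specB P hn).2, Algebra.smul_def]

end Rep4

section Eval
variable {K : Type*} [Field K] [Algebra ℂ K] (P : Params K)

/-- The value `c = r s a b` of `γ` and `γ'` in an evaluation module. -/
def level (a b : Kˣ) : K := P.r * P.s * (a * b)

theorem level_ne_zero (a b : Kˣ) : level P a b ≠ 0 :=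
  mul_ne_zero (mul_ne_zero P.r_ne_zero P.s_ne_zero) (mul_ne_zero a.ne_zero b.ne_zero)

theorem level_eq (a b : Kˣ) : (a : K) * b = level P a b * (P.r * P.s)⁻¹ := by
  have hr := P.r_ne_zero
  have hs := P.s_ne_zero
  unfold level
  field_simp

/-- The evaluation representation `ρ_u^{a,b}` of `U'_{r,s}` on `V(u) = K^{2n}`, for
`u ∈ K^×`. -/
def evalRep' {n : ℕ} (hn : 3 ≤ n) (a b u : Kˣ) :
    UAff' P n →ₐ[K] Matrix (Fin (2 * n)) (Fin (2 * n)) K :=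
  lift' (evalGen P n (level P a b) ((a : K) * u) ((b : K) * (u : K)⁻¹))
    (eval_rel P hn (level_ne_zero P a b) (by
      rw [Algebra.algebraMap_self_apply, ← level_eq, mul_mul_mul_comm,
        mul_inv_cancel₀ u.ne_zero, mul_one]))

/-- The representation `ρ_u^{a,b} ⊗ ρ_v^{a,b}` of `U'_{r,s}` on `V(u) ⊗ V(v)`, through the
coproduct; the matrix entry `((i, k), (j, l))` belongs to `E_{ij} ⊗ E_{kl}`. -/
def tensorRep' {n : ℕ} (hn : 3 ≤ n) (a b u v : Kˣ) :
    UAff' P n →ₐ[K] Matrix (Fin (2 * n) × Fin (2 * n)) (Fin (2 * n) × Fin (2 * n)) K :=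
  ((Matrix.kroneckerAlgEquiv (Fin (2 * n)) (Fin (2 * n)) K).toAlgHom.comp
    (Algebra.TensorProduct.map (evalRep' P hn a b u) (evalRep' P hn a b v))).comp (comul' P n hn)

/-! ### Evaluation modules with an indeterminate spectral parameter -/

/-- `V(u) = V ⊗ K[u, u⁻¹]` for an indeterminate `u`. -/
abbrev LoopSpace (K : Type*) [Field K] (n : ℕ) : Type _ := Fin (2 * n) → K[T;T⁻¹]

variable (K) in
/-- A matrix over `K[u, u⁻¹]`, as a `K`-linear operator on `V(u)`. -/
def loopMat (n : ℕ) :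
    Matrix (Fin (2 * n)) (Fin (2 * n)) K[T;T⁻¹] →ₐ[K] Module.End K (LoopSpace K n) :=
  AlgHom.ofLinearMap
    { toFun := fun M => (Matrix.toLin' M).restrictScalars K
      map_add' := fun M N => by ext; simp
      map_smul' := fun k M => by ext; simp }
    (by ext; simp) (fun M N => by ext; simp)

/-- The substitution `u ↦ t u` on `K[u, u⁻¹]`, that is `u^k ↦ t^k u^k`. -/
def scale (t : Kˣ) : K[T;T⁻¹] →ₐ[K] K[T;T⁻¹] :=
  AddMonoidAlgebra.lift K K[T;T⁻¹] ℤ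
    { toFun := fun k => ((t ^ k.toAdd : Kˣ) : K) • LaurentPolynomial.T k.toAdd
      map_one' := by simp
      map_mul' := fun k l => by
        rw [toAdd_mul, zpow_add, Units.val_mul, LaurentPolynomial.T_add, smul_mul_smul_comm] }

/-- The degree operator `v u^k ↦ t^k v u^k` on `V(u)`. -/
def degOp (n : ℕ) (t : Kˣ) : Module.End K (LoopSpace K n) :=
  (scale t).toLinearMap.compLeft (Fin (2 * n))

theorem scale_T (t : Kˣ) (k : ℤ) :
    scale t (LaurentPolynomial.T k) = ((t ^ k : Kˣ) : K) • LaurentPolynomial.T k := by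
  unfold scale LaurentPolynomial.T
  rw [AddMonoidAlgebra.lift_single, one_smul]
  rfl

theorem degOp_loopMat (n : ℕ) (t : Kˣ) (M : Matrix (Fin (2 * n)) (Fin (2 * n)) K[T;T⁻¹]) :
    degOp n t * loopMat K n M = loopMat K n (M.map (scale t)) * degOp n t := by
  refine LinearMap.ext fun x => funext fun i => ?_
  change scale t ((M.mulVec x) i) = ((M.map (scale t)).mulVec fun j => scale t (x j)) i
  simp [Matrix.mulVec, dotProduct]

theorem degOp_mul (n : ℕ) (t t' : Kˣ) : degOp n t * degOp n t' = degOp n (t * t') := by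
  have h : (scale t).comp (scale t') = scale (t * t') := by
    refine AddMonoidAlgebra.algHom_ext (fun k => ?_) (by ext)
    change scale t (scale t' (LaurentPolynomial.T k)) = scale (t * t') (LaurentPolynomial.T k)
    rw [scale_T, scale_T, map_smul, scale_T, smul_smul, mul_zpow, Units.val_mul, mul_comm]
  refine LinearMap.ext fun x => funext fun i => ?_
  exact DFunLike.congr_fun h (x i)

theorem degOp_one (n : ℕ) : degOp n (1 : Kˣ) = 1 := by
  have h : scale (1 : Kˣ) = AlgHom.id K _ := by
    refine AddMonoidAlgebra.algHom_ext (fun k => ?_) (by ext)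
    change scale 1 (LaurentPolynomial.T k) = LaurentPolynomial.T k
    rw [scale_T, one_zpow, Units.val_one, one_smul]
  refine LinearMap.ext fun x => funext fun i => ?_
  exact DFunLike.congr_fun h (x i)

section

variable {A B : Type*} [CommRing A] [Algebra K A] [CommRing B] [Algebra K B] (φ : A →ₐ[K] B)

theorem E_map (n i j : ℕ) : (E A n i j).map φ = E B n i j := by
  ext x y
  simp [E, apply_ite φ]

theorem dg_map (n : ℕ) (d : ℕ → K) : (dg A n d).map φ = dg B n d := by
  ext x y
  simp [dg, Matrix.diagonal_apply, apply_ite φ]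

theorem matE_map (n : ℕ) (α : A) (i : ℕ) : (matE P n α i).map φ = matE P n (φ α) i := by
  unfold matE
  ext x y
  split_ifs <;> simp [← E_map φ]

theorem matF_map (n : ℕ) (β : A) (i : ℕ) : (matF P n β i).map φ = matF P n (φ β) i := by
  unfold matF
  ext x y
  split_ifs <;> simp [← E_map φ]

end

/-- The parameter `r` as a unit. -/
def Params.rU : Kˣ := Units.mk0 P.r P.r_ne_zero

/-- The parameter `s` as a unit. -/
def Params.sU : Kˣ := Units.mk0 P.s P.s_ne_zero

/-- The values of `ρ_u^{a,b}` on the generators of `U_{r,s}`, for an indeterminate `u`. -/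
def loopGen (n : ℕ) (a b : Kˣ) : Gen n ⊕ DegGen → Module.End K (LoopSpace K n)
  | .inl y => loopMat K n (evalGen P n (level P a b)
      ((a : K) • LaurentPolynomial.T 1) ((b : K) • LaurentPolynomial.T (-1)) y)
  | .inr .d => degOp n P.rU
  | .inr .di => degOp n P.rU⁻¹
  | .inr .d' => degOp n P.sU
  | .inr .d'i => degOp n P.sU⁻¹

theorem degOp_conj (n : ℕ) (t : Kˣ) (M N : Matrix (Fin (2 * n)) (Fin (2 * n)) K[T;T⁻¹]) (k : K)
    (h : M.map (scale t) = k • N) :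
    degOp n t * loopMat K n M * degOp n t⁻¹ = k • loopMat K n N := by
  rw [degOp_loopMat, mul_assoc, degOp_mul, mul_inv_cancel, degOp_one, mul_one, h, map_smul]

theorem matE_smul (n : ℕ) (i : Fin (n + 1)) (t : Kˣ) (a : K) :
    (matE P n (a • (LaurentPolynomial.T 1 : K[T;T⁻¹])) i).map (scale t) =
      (if i = 0 then (t : K) else 1) • matE P n (a • (LaurentPolynomial.T 1 : K[T;T⁻¹])) i := by
  rw [matE_map, map_smul, scale_T, zpow_one]
  have hi : (i : ℕ) = 0 ↔ i = 0 := by rw [Fin.ext_iff, Fin.val_zero]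
  unfold matE
  by_cases h : i = 0
  · rw [if_pos (hi.2 h), if_pos (hi.2 h), if_pos h, smul_comm a (t : K), smul_assoc]
  · rw [if_neg (fun h' => h (hi.1 h')), if_neg (fun h' => h (hi.1 h')), if_neg h, one_smul]

theorem matF_smul (n : ℕ) (i : Fin (n + 1)) (t : Kˣ) (b : K) :
    (matF P n (b • (LaurentPolynomial.T (-1) : K[T;T⁻¹])) i).map (scale t) =
      (if i = 0 then (t : K)⁻¹ else 1) • matF P n (b • (LaurentPolynomial.T (-1) : K[T;T⁻¹])) i := by
  rw [matF_map, map_smul, scale_T, zpow_neg_one, Units.val_inv_eq_inv_val]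
  have hi : (i : ℕ) = 0 ↔ i = 0 := by rw [Fin.ext_iff, Fin.val_zero]
  unfold matF
  by_cases h : i = 0
  · rw [if_pos (hi.2 h), if_pos (hi.2 h), if_pos h, smul_comm b (t : K)⁻¹, smul_assoc]
  · rw [if_neg (fun h' => h (hi.1 h')), if_neg (fun h' => h (hi.1 h')), if_neg h, one_smul]

theorem loop_rel {n : ℕ} (hn : 3 ≤ n) (a b : Kˣ) :
    ∀ x y, FullRel P n (loopGen P n a b) x y → x = y := by
  have hdg : ∀ (t : Kˣ) (d : ℕ → K), degOp n t * loopMat K n (dg _ n d) =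
      loopMat K n (dg _ n d) * degOp n t := fun t d => by
    rw [degOp_loopMat, dg_map]
  intro x y h
  cases h with
  | aff h =>
    obtain ⟨x', y', h', rfl, rfl⟩ := AffRel.exists_lift P (loopMat K n) h
    refine congrArg _ (eval_rel P hn (level_ne_zero P a b) ?_ _ _ h')
    rw [smul_mul_smul_comm, ← LaurentPolynomial.T_add, level_eq P a b]
    simp [Algebra.smul_def]
  | d_di => simp only [loopGen, degOp_mul, mul_inv_cancel, degOp_one]
  | di_d => simp only [loopGen, degOp_mul, inv_mul_cancel, degOp_one]
  | d'_d'i => simp only [loopGen, degOp_mul, mul_inv_cancel, degOp_one]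
  | d'i_d' => simp only [loopGen, degOp_mul, inv_mul_cancel, degOp_one]
  | d_d' => simp only [loopGen, degOp_mul, mul_comm]
  | d_w i => exact hdg _ _
  | d_w' i => exact hdg _ _
  | d'_w i => exact hdg _ _
  | d'_w' i => exact hdg _ _
  | d_e i => exact degOp_conj n _ _ _ _ (matE_smul P n i P.rU a)
  | d_f i => exact degOp_conj n _ _ _ _ (matF_smul P n i P.rU b)
  | d'_e i => exact degOp_conj n _ _ _ _ (matE_smul P n i P.sU a)
  | d'_f i => exact degOp_conj n _ _ _ _ (matF_smul P n i P.sU b)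

/-- The evaluation representation `ρ_u^{a,b}` of `U_{r,s}` on `V(u)`, for an indeterminate `u`. -/
def evalRep {n : ℕ} (hn : 3 ≤ n) (a b : Kˣ) : UAff P n →ₐ[K] Module.End K (LoopSpace K n) :=
  lift (loopGen P n a b) (loop_rel P hn a b)

/-- The representation `ρ_u^{a,b} ⊗ ρ_v^{a,b}` of `U_{r,s}` on `V(u) ⊗ V(v)`, through the
coproduct, for indeterminates `u`, `v`. -/
def tensorRep {n : ℕ} (hn : 3 ≤ n) (a b : Kˣ) :
    UAff P n →ₐ[K] Module.End K (LoopSpace K n ⊗[K] LoopSpace K n) :=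
  (Module.endTensorEndAlgHom.comp
    (Algebra.TensorProduct.map (evalRep P hn a b) (evalRep P hn a b))).comp (comul P n hn)

end Eval

/-! ### The affine `R`-matrix -/

section RMatrix
variable {K : Type*} [Field K] [Algebra ℂ K] (P : Params K)

/-- The signs `σ_i`: `1` for `i ≤ n`, `-1` for `i > n`. -/
def sgn (n i : ℕ) : ℤ := if i ≤ n then 1 else -1

/-- `t_i`. -/
def tCoef (n i : ℕ) : K := if i ≤ n then P.s ^ ((i : ℤ) - n) else P.r ^ ((n : ℤ) + 1 - i)

/-- `ξ = r^{-n+1} s^{n-1}`. -/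
def xi (n : ℕ) : K := P.r ^ (-(n : ℤ) + 1) * P.s ^ ((n : ℤ) - 1)

variable {A : Type*} [CommRing A] [Algebra K A]

/-- The exponent `∓ σ_i σ_j` of `(rs)^{1/2}` in `a_ij(z)`. -/
def aExp (n i j : ℕ) : ℤ :=
  if (i < j ∧ i < bar n j) ∨ (i > j ∧ i > bar n j) then -(sgn n i * sgn n j)
  else sgn n i * sgn n j

/-- `a_ij(z)`, for `j ≠ i, i'`; here `p = r^{1/2}` and `q = s^{1/2}`. -/
def aCoef (p q : K) (n : ℕ) (z : A) (i j : ℕ) : A :=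
  (p⁻¹ * q * (p * q) ^ aExp n i j) • ((z - 1) * (z - algebraMap K A (xi P n)))

/-- `b_ij(z)`. -/
def bCoef (n : ℕ) (z : A) (i j : ℕ) : A :=
  let δ : A := if i = bar n j then 1 else 0
  if j = i then ((P.r⁻¹ * P.s) • z - algebraMap K A (xi P n)) * (z - 1)
  else if i < j then
    (P.r⁻¹ * P.s - 1) • ((xi P n * tCoef P n i * (tCoef P n j)⁻¹) • (z - 1)
      - δ * (z - algebraMap K A (xi P n)))
  else
    (P.r⁻¹ * P.s - 1) • (z * ((tCoef P n i * (tCoef P n j)⁻¹) • (z - 1)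
      - δ * (z - algebraMap K A (xi P n))))

/-- The operator `R̂(z)`, as a matrix over a commutative `K`-algebra containing `z`; the entry
`((i, k), (j, l))` is the coefficient of `E_{ij} ⊗ E_{kl}`. -/
def Rhat (p q : K) (n : ℕ) (z : A) :
    Matrix (Fin (2 * n) × Fin (2 * n)) (Fin (2 * n) × Fin (2 * n)) A :=
  let I := Finset.Icc 1 (2 * n)
  ((z - algebraMap K A (P.r⁻¹ * P.s)) * (z - algebraMap K A (xi P n))) •
      ∑ i ∈ I, E A n i i ⊗ₖ E A n i i
  + ∑ i ∈ I, ∑ j ∈ I with j ≠ i ∧ j ≠ bar n i,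
      aCoef P p q n z i j • (E A n i j ⊗ₖ E A n j i)
  + ((1 - P.r⁻¹ * P.s) • (z - algebraMap K A (xi P n))) •
      ∑ i ∈ I, ∑ j ∈ I with i > j ∧ j ≠ bar n i, E A n i i ⊗ₖ E A n j j
  + ((1 - P.r⁻¹ * P.s) • (z * (z - algebraMap K A (xi P n)))) •
      ∑ i ∈ I, ∑ j ∈ I with i < j ∧ j ≠ bar n i, E A n i i ⊗ₖ E A n j j
  + ∑ i ∈ I, ∑ j ∈ I, bCoef P n z i j • (E A n (bar n i) j ⊗ₖ E A n i (bar n j))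

/-- The operator `R̂(u/v) : V(u) ⊗ V(v) → V(v) ⊗ V(u)` for indeterminates `u`, `v`. In the source
`u` acts on the first and `v` on the second factor; in the target it is the other way round. It
sends `v_j f(u) ⊗ v_l g(v)` to the sum over `i, k` of `f(u) g(v) R̂(u/v)_{(i,k),(j,l)} v_i ⊗ v_k`.
-/
def RhatLoop (p q : K) (n : ℕ) :
    LoopSpace K n ⊗[K] LoopSpace K n →ₗ[K] LoopSpace K n ⊗[K] LoopSpace K n :=
  let R := Rhat P p q n ((LaurentPolynomial.T 1 : K[T;T⁻¹]) ⊗ₜ[K]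
    (LaurentPolynomial.T (-1) : K[T;T⁻¹]))
  ∑ x, ∑ y,
    TensorProduct.map (LinearMap.single K (fun _ => K[T;T⁻¹]) x.1)
        (LinearMap.single K (fun _ => K[T;T⁻¹]) x.2)
      ∘ₗ (TensorProduct.comm K K[T;T⁻¹] K[T;T⁻¹]).toLinearMap
      ∘ₗ LinearMap.mulLeft K (R x y)
      ∘ₗ TensorProduct.map (LinearMap.proj y.1) (LinearMap.proj y.2)

/-- The flip `τ` of `V ⊗ V`. -/
def flipMat (K : Type*) [Field K] (N : Type*) [DecidableEq N] : Matrix (N × N) (N × N) K :=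
  Matrix.of fun x y => if x = y.swap then 1 else 0

section Leg

variable {N : Type*} [Fintype N] [DecidableEq N] (M : Matrix (N × N) (N × N) K)

/-- The action of `M` on the first two factors of `V ⊗ V ⊗ V`. -/
def leg12 : Matrix (N × N × N) (N × N × N) K :=
  Matrix.reindex (Equiv.prodAssoc N N N) (Equiv.prodAssoc N N N) (M ⊗ₖ (1 : Matrix N N K))

/-- The action of `M` on the last two factors. -/
def leg23 : Matrix (N × N × N) (N × N × N) K := (1 : Matrix N N K) ⊗ₖ M

/-- The action of `M` on the first and third factor. -/
def leg13 : Matrix (N × N × N) (N × N × N) K :=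
  leg23 (flipMat K N) * leg12 M * leg23 (flipMat K N)

end Leg

end RMatrix

end TwoParam

end

/-! Part (a). It suffices to treat generators. The relation ab = (rs)⁻¹ puts the modules at level
one, so γ and γ' act trivially and u, v enter only through e_0 and f_0. Every e_i and f_i is
represented by a matrix x E_{pq} + y E_{q'p'}. The operator R̂(z) is of vertex type (`IsVertex`): it
mixes the zero-weight vectors v_{i'} ⊗ v_i among themselves, and otherwise it stays in the span of
v_c ⊗ v_d and v_d ⊗ v_c. Evaluating on basis vectors reduces the commutation with a two-term
coproduct to a list of scalar identities (`VertexConds`, `IsVertex.intertwine`). These are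
polynomial consequences of r r⁻¹ = s s⁻¹ = 1 and of the recursion satisfied by the t_i. They are
verified over any commutative ring, separately for the nodes 1 ≤ i < n, i = n and i = 0.

For indeterminate u, v the space V(u) ⊗ V(v) splits into blocks K[u,u⁻¹] ⊗ K[v,v⁻¹] on which the
generators of U' act by multiplication. The same matrix identity over that ring applies, twisted by
the exchange of u and v (`RhatLoop_intertwine`). The degree operators rescale u and v together and
so leave u/v alone.

Part (b). The familiar argument would combine (a) with irreducibility of the threefold tensor
product for generic parameters; here a degeneration takes its place. Let D(x, y) be the difference
of the two sides of the braid relation (`braidDefect`), with x = u/v and y = v/w. By (a) both sides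
carry the action with parameters (u, v, w) to the one with (w, v, u), hence so does D. Moreover D
kills v_j ⊗ v_j ⊗ v_j, since R̂ multiplies v_j ⊗ v_j by a scalar. Replace (x, y) by (xt, yt). If D
were nonzero, dividing by the highest power of t and setting t = 0 would give a nonzero matrix M
with the specialized relations (`eq_zero_of_specialization`). At t = 0 the coproduct of e_0 has
become ω_0 ⊗ ω_0 ⊗ e_0 and that of f_0 has become f_0 ⊗ ω'_0 ⊗ ω'_0, so each acts, up to invertible
weights, on one outer factor. Together with the finite generators they produce all of V ⊗ V ⊗ V from
the vectors v_j ⊗ v_j ⊗ v_j, so M = 0 (`eq_zero_of_degenerate_relations`). Setting t = 1 in D = 0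
gives the braid relation for all x, y, and the Yang–Baxter equation for R = R̂τ follows by moving
the flips (`yangBaxter_of_braid`). -/

noncomputable section

namespace TwoParam

/-! ### Operators of vertex type and a scalar criterion for intertwining. -/

section Vertex

open Matrix

variable {ι A : Type*} [Fintype ι] [DecidableEq ι] [CommRing A]

/-- The basis vector `v_c ⊗ v_d`. -/
def bv (A : Type*) [CommRing A] {ι : Type*} [DecidableEq ι] (c d : ι) : ι × ι → A :=
  Pi.single (c, d) 1

/-- An operator on `V ⊗ V` of vertex type: it preserves the span of `v_c ⊗ v_d` and `v_d ⊗ v_c`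
unless `d = c'`, and the span of all `v_{i'} ⊗ v_i`. -/
structure IsVertex (bar : ι → ι) (R : Matrix (ι × ι) (ι × ι) A) (h₀ : A) (h g Z : ι → ι → A) :
    Prop where
  diag : ∀ c, R *ᵥ bv A c c = h₀ • bv A c c
  gen : ∀ c d, d ≠ c → d ≠ bar c → R *ᵥ bv A c d = h c d • bv A c d + g c d • bv A d c
  zero : ∀ c, R *ᵥ bv A c (bar c) = ∑ i, Z i c • bv A (bar i) i

/-- `x E_{pq} + y E_{q'p'}`. -/
def twoUnit (bar : ι → ι) (p q : ι) (x y : A) : Matrix ι ι A :=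
  Matrix.single p q x + Matrix.single (bar q) (bar p) y

theorem kronecker_mulVec_bv (M N : Matrix ι ι A) (c d : ι) :
    (M ⊗ₖ N) *ᵥ bv A c d = fun z => M z.1 c * N z.2 d := by
  funext z
  simp [bv, Matrix.mulVec_single, Matrix.kroneckerMap_apply]

theorem twoUnit_kronecker_diagonal (bar : ι → ι) (p q : ι) (x y : A) (δ : ι → A) (c d : ι) :
    (twoUnit bar p q x y ⊗ₖ Matrix.diagonal δ) *ᵥ bv A c d =
      (if c = q then (x * δ d) • bv A p d else 0) +
      (if c = bar p then (y * δ d) • bv A (bar q) d else 0) := by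
  rw [kronecker_mulVec_bv]
  funext ⟨a, b⟩
  simp only [twoUnit, Matrix.add_apply, Matrix.single_apply, Matrix.diagonal_apply, bv,
    Pi.add_apply, ite_apply, Pi.smul_apply, Pi.single_apply, Prod.mk.injEq, smul_eq_mul,
    Pi.zero_apply]
  by_cases hb : b = d
  · subst hb
    simp only [if_true, and_true, eq_comm (a := a), eq_comm (a := c)]
    rw [add_mul]
    congr 1
    · by_cases h1 : p = a <;> by_cases h2 : q = c <;> simp [h1, h2]
    · by_cases h1 : bar q = a <;> by_cases h2 : bar p = c <;> simp [h1, h2]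
  · simp [hb]

theorem diagonal_kronecker_twoUnit (bar : ι → ι) (p q : ι) (x y : A) (δ : ι → A) (c d : ι) :
    (Matrix.diagonal δ ⊗ₖ twoUnit bar p q x y) *ᵥ bv A c d =
      (if d = q then (x * δ c) • bv A c p else 0) +
      (if d = bar p then (y * δ c) • bv A c (bar q) else 0) := by
  rw [kronecker_mulVec_bv]
  funext ⟨a, b⟩
  simp only [twoUnit, Matrix.add_apply, Matrix.single_apply, Matrix.diagonal_apply, bv,
    Pi.add_apply, ite_apply, Pi.smul_apply, Pi.single_apply, Prod.mk.injEq, smul_eq_mul,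
    Pi.zero_apply]
  by_cases hb : a = c
  · subst hb
    simp only [if_true, true_and, eq_comm (a := b), eq_comm (a := d)]
    rw [mul_add]
    congr 1
    · by_cases h1 : p = b <;> by_cases h2 : q = d <;> simp [h1, h2, mul_comm]
    · by_cases h1 : bar q = b <;> by_cases h2 : bar p = d <;> simp [h1, h2, mul_comm]
  · simp [hb]

/-- Scalar conditions for `R (λ m ⊗ d₁ + μ d₂ ⊗ m) = (λ' m ⊗ d₁ + μ' d₂ ⊗ m) R`, where
`m = x E_{pq} + y E_{q'p'}`; the four coefficients are `k₁, k₂, k₃, k₄`. -/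
structure VertexConds (bar : ι → ι) (h₀ : A) (h g Z : ι → ι → A) (p q : ι) (x y : A)
    (d₁ d₂ : ι → A) (k₁ k₂ k₃ k₄ : A) : Prop where
  -- Each of the fields up to `q'p'` is named after its test vector: `jq` comes from v_j ⊗ v_q with
  -- j outside {p, q, p', q'}. Factors common to both sides are cancelled.
  jq : ∀ j, j ≠ p → j ≠ q → j ≠ bar p → j ≠ bar q →
    k₂ * h j p = k₄ * h j q ∧ k₂ * d₂ j * g j p = k₃ * d₁ j * g j q
  jp' : ∀ j, j ≠ p → j ≠ q → j ≠ bar p → j ≠ bar q →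
    k₂ * h j (bar q) = k₄ * h j (bar p) ∧ k₂ * d₂ j * g j (bar q) = k₃ * d₁ j * g j (bar p)
  qj : ∀ j, j ≠ p → j ≠ q → j ≠ bar p → j ≠ bar q →
    k₁ * h p j = k₃ * h q j ∧ k₁ * d₁ j * g p j = k₄ * d₂ j * g q j
  p'j : ∀ j, j ≠ p → j ≠ q → j ≠ bar p → j ≠ bar q →
    k₁ * h (bar q) j = k₃ * h (bar p) j ∧ k₁ * d₁ j * g (bar q) j = k₄ * d₂ j * g (bar p) j
  qq : k₁ * d₁ q * h p q + k₂ * d₂ q * g q p = k₃ * d₁ q * h₀ ∧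
    k₁ * d₁ q * g p q + k₂ * d₂ q * h q p = k₄ * d₂ q * h₀
  p'p' : k₁ * d₁ (bar p) * h (bar q) (bar p) + k₂ * d₂ (bar p) * g (bar p) (bar q) =
      k₃ * d₁ (bar p) * h₀ ∧
    k₁ * d₁ (bar p) * g (bar q) (bar p) + k₂ * d₂ (bar p) * h (bar p) (bar q) =
      k₄ * d₂ (bar p) * h₀
  -- On v_q ⊗ v_{p'} and v_{p'} ⊗ v_q the matrix m is nonzero on either factor and both results have
  -- weight zero. R spreads them over all v_{i'} ⊗ v_i, whence one equation for each i.
  qp' : ∀ i, k₁ * x * d₁ (bar p) * Z i p + k₂ * d₂ q * y * Z i q =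
    (if i = bar p then k₃ * x * d₁ (bar p) * h q (bar p) else 0)
    + (if i = bar q then k₄ * d₂ q * y * h q (bar p) else 0)
    + (if i = q then g q (bar p) * k₃ * y * d₁ q else 0)
    + (if i = p then g q (bar p) * k₄ * d₂ (bar p) * x else 0)
  p'q : ∀ i, k₁ * y * d₁ q * Z i (bar q) + k₂ * d₂ (bar p) * x * Z i (bar p) =
    (if i = q then k₃ * y * d₁ q * h (bar p) q else 0)
    + (if i = p then k₄ * d₂ (bar p) * x * h (bar p) q else 0)
    + (if i = bar p then g (bar p) q * k₃ * x * d₁ (bar p) else 0)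
    + (if i = bar q then g (bar p) q * k₄ * d₂ q * y else 0)
  qp : k₁ * d₁ p * h₀ = k₃ * d₁ p * h q p + k₄ * d₂ p * g q p
  pq : k₂ * d₂ p * h₀ = k₄ * d₂ p * h p q + k₃ * d₁ p * g p q
  p'q' : k₁ * d₁ (bar q) * h₀ =
    k₃ * d₁ (bar q) * h (bar p) (bar q) + k₄ * d₂ (bar q) * g (bar p) (bar q)
  q'p' : k₂ * d₂ (bar q) * h₀ =
    k₄ * d₂ (bar q) * h (bar q) (bar p) + k₃ * d₁ (bar q) * g (bar q) (bar p)
  -- The last two fields test v_c ⊗ v_{c'}: they compare the coefficients of v_p ⊗ v_{q'} and of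
  -- v_{q'} ⊗ v_p respectively.
  zero₁ : ∀ c,
    (if c = q then k₁ * x * d₁ (bar q) * h p (bar q) else 0)
    + (if c = p then k₂ * d₂ p * y * h p (bar q) else 0)
    + (if c = bar p then k₁ * y * d₁ p * g (bar q) p else 0)
    + (if c = bar q then k₂ * d₂ (bar q) * x * g (bar q) p else 0) =
    k₃ * x * d₁ (bar q) * Z (bar q) c + k₄ * d₂ p * y * Z (bar p) c
  zero₂ : ∀ c,
    (if c = q then k₁ * x * d₁ (bar q) * g p (bar q) else 0)
    + (if c = p then k₂ * d₂ p * y * g p (bar q) else 0)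
    + (if c = bar p then k₁ * y * d₁ p * h (bar q) p else 0)
    + (if c = bar q then k₂ * d₂ (bar q) * x * h (bar q) p else 0) =
    k₃ * y * d₁ p * Z p c + k₄ * d₂ (bar q) * x * Z q c

theorem matrix_ext_bv {M N : Matrix (ι × ι) (ι × ι) A} (h : ∀ c d, M *ᵥ bv A c d = N *ᵥ bv A c d) :
    M = N := by
  ext ⟨a, b⟩ ⟨c, d⟩
  have := congrFun (h c d) (a, b)
  simpa [bv, Matrix.mulVec_single] using this

variable {bar : ι → ι} {p q : ι} {x y : A} {d₁ d₂ : ι → A}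

/-- The operator `k m ⊗ d₁ + k' d₂ ⊗ m`. -/
def twoStep (bar : ι → ι) (p q : ι) (x y : A) (d₁ d₂ : ι → A) (k k' : A) :
    Matrix (ι × ι) (ι × ι) A :=
  k • (twoUnit bar p q x y ⊗ₖ Matrix.diagonal d₁) +
    k' • (Matrix.diagonal d₂ ⊗ₖ twoUnit bar p q x y)

theorem twoStep_bv (k k' : A) (c d : ι) :
    twoStep bar p q x y d₁ d₂ k k' *ᵥ bv A c d =
      (if c = q then (k * x * d₁ d) • bv A p d else 0)
      + (if c = bar p then (k * y * d₁ d) • bv A (bar q) d else 0)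
      + (if d = q then (k' * x * d₂ c) • bv A c p else 0)
      + (if d = bar p then (k' * y * d₂ c) • bv A c (bar q) else 0) := by
  simp only [twoStep, Matrix.add_mulVec, Matrix.smul_mulVec, twoUnit_kronecker_diagonal,
    diagonal_kronecker_twoUnit, smul_add, smul_ite, smul_zero, smul_smul, mul_assoc, ← add_assoc]

/-- Only i = p, q, p', q' contribute. The zero-weight space is mapped into the plane of v_p ⊗ v_{q'}
and v_{q'} ⊗ v_p, where a vertex operator acts by its generic coefficients. -/
theorem twoStep_zero (hb : ∀ i, bar (bar i) = i) (k k' : A) (f : ι → A) :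
    twoStep bar p q x y d₁ d₂ k k' *ᵥ (∑ i, f i • bv A (bar i) i) =
      (k * x * d₁ (bar q) * f (bar q) + k' * y * d₂ p * f (bar p)) • bv A p (bar q)
      + (k * y * d₁ p * f p + k' * x * d₂ (bar q) * f q) • bv A (bar q) p := by
  have bi : ∀ i j, bar i = j ↔ i = bar j := fun i j =>
    ⟨fun e => by rw [← e, hb], fun e => by rw [e, hb]⟩
  have bi2 : ∀ i j, bar i = bar j ↔ i = j := fun i j => by rw [bi, hb]
  simp only [Matrix.mulVec_sum, Matrix.mulVec_smul, twoStep_bv, smul_add, Finset.sum_add_distrib,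
    bi, smul_ite, smul_zero, Finset.sum_ite_eq', Finset.mem_univ, if_true, hb]
  module

/-- Both sides are compared on each v_c ⊗ v_d. The hypotheses make p, q, p', q' four distinct
indices, so the position of c and d among them decides which field of `VertexConds` is needed; if
neither c nor d is q or p', and d ≠ c', both sides vanish. -/
theorem IsVertex.intertwine (hb : ∀ i, bar (bar i) = i) (hb' : ∀ i, bar i ≠ i)
    {R : Matrix (ι × ι) (ι × ι) A} {h₀ : A} {h g Z : ι → ι → A} (hR : IsVertex bar R h₀ h g Z)
    (hpq : p ≠ q) (hpq' : p ≠ bar q) {k₁ k₂ k₃ k₄ : A}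
    (hc : VertexConds bar h₀ h g Z p q x y d₁ d₂ k₁ k₂ k₃ k₄) :
    R * twoStep bar p q x y d₁ d₂ k₁ k₂ = twoStep bar p q x y d₁ d₂ k₃ k₄ * R := by
  have n1 : bar p ≠ q := fun e => hpq' (by rw [← e, hb])
  have n2 : bar p ≠ bar q := fun e => hpq (by rw [← hb p, e, hb])
  have n3 := hb' p
  have n4 := hb' q
  have bi : ∀ i j, bar i = j ↔ i = bar j := fun i j =>
    ⟨fun e => by rw [← e, hb], fun e => by rw [e, hb]⟩
  have bi2 : ∀ i j, bar i = bar j ↔ i = j := fun i j => by rw [bi, hb]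
  refine matrix_ext_bv fun c d => ?_
  rw [← Matrix.mulVec_mulVec, ← Matrix.mulVec_mulVec, twoStep_bv]
  have hR1 := hR.diag
  have hR2 := hR.gen
  have hR3 := hR.zero
  have hR3' : ∀ c, R *ᵥ bv A (bar c) c = ∑ i, Z i (bar c) • bv A (bar i) i := fun c => by
    rw [← hR3, hb]
  by_cases hzero : d = bar c
  · subst hzero
    rw [hR3, twoStep_zero hb]
    have z1 := hc.zero₁ c
    have z2 := hc.zero₂ c
    have r1 := hR2 p (bar q) (Ne.symm hpq') (fun e => hpq ((bi2 _ _).1 e).symm)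
    have r2 := hR2 (bar q) p hpq' (by rw [hb]; exact hpq)
    simp only [bi2, bi c, Matrix.mulVec_add, apply_ite (R *ᵥ ·), Matrix.mulVec_smul,
      Matrix.mulVec_zero]
    by_cases e1 : c = q
    · subst e1
      simp only [hpq.symm, n1.symm, n4.symm, if_true, if_false, add_zero] at z1 z2 ⊢
      rw [r1]
      linear_combination (norm := module) z1 • bv A p (bar c) + z2 • bv A (bar c) p
    by_cases e2 : c = p
    · subst e2
      simp only [hpq, hpq', n3.symm, if_true, if_false, add_zero, zero_add] at z1 z2 ⊢
      rw [r1]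
      linear_combination (norm := module) z1 • bv A c (bar q) + z2 • bv A (bar q) c
    by_cases e3 : c = bar p
    · subst e3
      simp only [n1, n2, n3, if_true, if_false, add_zero, zero_add, hb] at z1 z2 ⊢
      rw [r2]
      linear_combination (norm := module) z1 • bv A p (bar q) + z2 • bv A (bar q) p
    by_cases e4 : c = bar q
    · subst e4
      simp only [hpq'.symm, n4, n2.symm, if_true, if_false, add_zero, zero_add, hb] at z1 z2 ⊢
      rw [r2]
      linear_combination (norm := module) z1 • bv A p (bar q) + z2 • bv A (bar q) p
    simp only [e1, e2, e3, e4, if_false, add_zero] at z1 z2 ⊢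
    linear_combination (norm := module) z1 • bv A p (bar q) + z2 • bv A (bar q) p
  by_cases hdc : d = c
  · subst hdc
    rw [hR1, Matrix.mulVec_smul, twoStep_bv]
    by_cases e1 : d = q
    · subst e1
      simp only [n1.symm, if_true, if_false, add_zero, Matrix.mulVec_add, Matrix.mulVec_smul]
      rw [hR2 p d hpq.symm (Ne.symm n1), hR2 d p hpq hpq']
      linear_combination (norm := module) (x * hc.qq.1) • bv A p d + (x * hc.qq.2) • bv A d p
    by_cases e2 : d = bar p
    · subst e2
      simp only [n1, if_true, if_false, add_zero, zero_add, Matrix.mulVec_add, Matrix.mulVec_smul]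
      rw [hR2 (bar p) (bar q) n2.symm (by rw [hb]; exact hpq'.symm),
        hR2 (bar q) (bar p) n2 (by rw [hb]; exact n1)]
      linear_combination (norm := module) (y * hc.p'p'.1) • bv A (bar q) (bar p) +
        (y * hc.p'p'.2) • bv A (bar p) (bar q)
    simp [e1, e2]
  rw [hR2 c d hdc hzero, Matrix.mulVec_add (twoStep bar p q x y d₁ d₂ k₃ k₄), Matrix.mulVec_smul,
    Matrix.mulVec_smul, twoStep_bv, twoStep_bv]
  by_cases e1 : c = q
  · subst e1
    by_cases e2 : d = bar p
    · subst e2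
      -- The scalar equations are summed against v_{i'} ⊗ v_i; the four conditional terms collapse
      -- to the four basis vectors with i = p', q', q, p.
      have hz := fun i => congrArg (· • bv A (bar i) i) (hc.qp' i)
      have hz := Finset.sum_congr (rfl : (Finset.univ : Finset ι) = _) fun i _ => hz i
      simp only [add_smul, ite_smul, zero_smul, Finset.sum_add_distrib, Finset.sum_ite_eq',
        Finset.mem_univ, if_true, mul_smul _ (Z _ _), ← Finset.smul_sum, hb] at hz
      simp only [n1, n1.symm, if_true, if_false, add_zero, zero_add, Matrix.mulVec_add,
        Matrix.mulVec_smul, hR3]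
      rw [show (k₁ * x * d₁ (bar p)) • ∑ i, Z i p • bv A (bar i) i +
        (k₂ * y * d₂ c) • ∑ i, Z i c • bv A (bar i) i =
        (k₁ * x * d₁ (bar p)) • ∑ i, Z i p • bv A (bar i) i +
        (k₂ * d₂ c * y) • ∑ i, Z i c • bv A (bar i) i by module, hz]
      module
    by_cases e3 : d = p
    · subst e3
      simp only [n1.symm, hpq, n3.symm, if_true, if_false, add_zero, Matrix.mulVec_smul, hR1, zero_add]
      linear_combination (norm := module) (x * hc.qp) • bv A d d
    have j := hc.qj d e3 hdc e2 hzero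
    simp only [hdc, e2, n1.symm, if_true, if_false, add_zero, zero_add, Matrix.mulVec_smul]
    rw [hR2 p d e3 e2]
    linear_combination (norm := module) (x * d₁ d * j.1) • bv A p d + (x * j.2) • bv A d p
  by_cases e2 : c = bar p
  · subst e2
    rw [hb] at hzero
    by_cases e3 : d = q
    · subst e3
      have hz := fun i => congrArg (· • bv A (bar i) i) (hc.p'q i)
      have hz := Finset.sum_congr (rfl : (Finset.univ : Finset ι) = _) fun i _ => hz i
      simp only [add_smul, ite_smul, zero_smul, Finset.sum_add_distrib, Finset.sum_ite_eq',
        Finset.mem_univ, if_true, mul_smul _ (Z _ _), ← Finset.smul_sum, hb] at hz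
      simp only [n1, n1.symm, if_true, if_false, add_zero, zero_add, Matrix.mulVec_add,
        Matrix.mulVec_smul, hR3']
      rw [show (k₁ * y * d₁ d) • ∑ i, Z i (bar d) • bv A (bar i) i +
        (k₂ * x * d₂ (bar p)) • ∑ i, Z i (bar p) • bv A (bar i) i =
        (k₁ * y * d₁ d) • ∑ i, Z i (bar d) • bv A (bar i) i +
        (k₂ * d₂ (bar p) * x) • ∑ i, Z i (bar p) • bv A (bar i) i by module, hz]
      module
    by_cases e4 : d = bar q
    · subst e4
      simp only [n1, n2.symm, n4, if_true, if_false, add_zero, zero_add, Matrix.mulVec_smul, hR1]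
      linear_combination (norm := module) (y * hc.p'q') • bv A (bar q) (bar q)
    have j := hc.p'j d hzero e3 hdc e4
    simp only [hdc, e3, n1, if_true, if_false, add_zero, zero_add, Matrix.mulVec_smul]
    rw [hR2 (bar q) d e4 (by rw [hb]; exact e3)]
    linear_combination (norm := module) (y * d₁ d * j.1) • bv A (bar q) d + (y * j.2) • bv A d (bar q)
  by_cases e3 : d = q
  · subst e3
    by_cases e4 : c = p
    · subst e4
      simp only [hpq, n1.symm, n3.symm, if_true, if_false, add_zero, zero_add, Matrix.mulVec_smul,
        hR1]
      linear_combination (norm := module) (x * hc.pq) • bv A c c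
    have e5 : c ≠ bar d := fun e => hzero (by rw [e, hb])
    have j := hc.jq c e4 e1 e2 e5
    simp only [e1, e2, n1.symm, if_true, if_false, add_zero, zero_add, Matrix.mulVec_smul]
    rw [hR2 c p (Ne.symm e4) (fun e => e2 (by rw [e, hb]))]
    linear_combination (norm := module) (x * d₂ c * j.1) • bv A c p + (x * j.2) • bv A p c
  by_cases e4 : d = bar p
  · subst e4
    by_cases e5 : c = bar q
    · subst e5
      simp only [n4, n1, n2.symm, if_true, if_false, add_zero, zero_add, Matrix.mulVec_smul,
        hR1]
      linear_combination (norm := module) (y * hc.q'p') • bv A (bar q) (bar q)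
    have e6 : c ≠ p := fun e => hzero (by rw [e])
    have j := hc.jp' c e6 e1 e2 e5
    simp only [e1, e2, n1, if_true, if_false, add_zero, zero_add, Matrix.mulVec_smul]
    rw [hR2 c (bar q) (Ne.symm e5) (fun e => e1 ((bi2 _ _).1 e).symm)]
    linear_combination (norm := module) (y * d₂ c * j.1) • bv A c (bar q) + (y * j.2) • bv A (bar q) c
  simp [e1, e2, e3, e4]

end Vertex

end TwoParam
end

noncomputable section

namespace TwoParam

/-! ### R̂(z) is of vertex type. -/

section RhatVertex

open Matrix

variable {K : Type*} [Field K] [Algebra ℂ K] (P : Params K) {A : Type*} [CommRing A] [Algebra K A]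
  {n : ℕ}

theorem sum_Icc_eq_sum_fin {M : Type*} [AddCommMonoid M] (m : ℕ) (f : ℕ → M) :
    ∑ i ∈ Finset.Icc 1 m, f i = ∑ x : Fin m, f ((x : ℕ) + 1) := by
  rw [Fin.sum_univ_eq_sum_range (fun i => f (i + 1)) m, Finset.range_eq_Ico,
    Finset.sum_Ico_add' f 0 m 1]
  exact Finset.sum_congr (by ext; simp) fun _ _ => rfl

theorem E_eq_single (x y : Fin (2 * n)) :
    E A n ((x : ℕ) + 1) ((y : ℕ) + 1) = Matrix.single x y 1 := by
  ext a b
  simp [E, Matrix.single_apply, Fin.ext_iff, eq_comm]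

theorem bar_eq_rev (x : Fin (2 * n)) : bar n ((x : ℕ) + 1) = (x.rev : ℕ) + 1 := by
  simp only [bar, Fin.val_rev]
  omega

theorem single_kronecker_bv {ι : Type*} [Fintype ι] [DecidableEq ι] (x y u v c d : ι) :
    (Matrix.single x y (1 : A) ⊗ₖ Matrix.single u v (1 : A)) *ᵥ bv A c d =
      if y = c then if v = d then bv A x u else 0 else 0 := by
  rw [kronecker_mulVec_bv]
  funext ⟨a, b⟩
  simp only [Matrix.single_apply, bv]
  split_ifs <;> simp_all [eq_comm]

/-- The scalar by which `a_ij(z)` differs from `(z - 1) (z - ξ)`. -/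
def aScal (n i j : ℕ) : K := if aExp n i j = 1 then P.s else P.r⁻¹

theorem aExp_cases (n i j : ℕ) : aExp n i j = 1 ∨ aExp n i j = -1 := by
  unfold aExp sgn
  split_ifs <;> simp

/-- The square roots occur only as p⁻¹q(pq)^{±1}, which is q² = s or p⁻² = r⁻¹; no half-integral
power survives. -/
theorem aCoef_eq {p q : K} (hp : p ^ 2 = P.r) (hq : q ^ 2 = P.s) (z : A) (i j : ℕ) :
    aCoef P p q n z i j = aScal P n i j • ((z - 1) * (z - algebraMap K A (xi P n))) := by
  have hp0 : p ≠ 0 := fun h => P.r_ne_zero (by rw [← hp, h]; simp)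
  have hq0 : q ≠ 0 := fun h => P.s_ne_zero (by rw [← hq, h]; simp)
  unfold aCoef aScal
  congr 1
  rcases aExp_cases n i j with h | h
  · rw [h, if_pos rfl, ← hq, zpow_one]
    field_simp
  · rw [h, if_neg (by norm_num), ← hp, _root_.zpow_neg_one]
    field_simp

/-- The coefficient of `v_c ⊗ v_d` in `R̂(z) (v_c ⊗ v_d)`, for `d ≠ c, c'`. -/
def hFun (n : ℕ) (z : A) (c d : Fin (2 * n)) : A :=
  (1 - P.r⁻¹ * P.s) • ((if c < d then z else 1) * (z - algebraMap K A (xi P n)))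

/-- The coefficient of `v_d ⊗ v_c` in `R̂(z) (v_c ⊗ v_d)`, for `d ≠ c, c'`. -/
def gFun (n : ℕ) (z : A) (c d : Fin (2 * n)) : A :=
  aScal P n ((d : ℕ) + 1) ((c : ℕ) + 1) • ((z - 1) * (z - algebraMap K A (xi P n)))

/-- The coefficient of `v_{i'} ⊗ v_i` in `R̂(z) (v_c ⊗ v_{c'})`. -/
def zFun (n : ℕ) (z : A) (i c : Fin (2 * n)) : A := bCoef P n z ((i : ℕ) + 1) ((c : ℕ) + 1)

/-- The eigenvalue of `R̂(z)` on `v_c ⊗ v_c`. -/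
def diagFun (n : ℕ) (z : A) : A :=
  (z - algebraMap K A (P.r⁻¹ * P.s)) * (z - algebraMap K A (xi P n))

/-- Indices are shifted to start at 0, so that i' becomes `Fin.rev`, and the two triangular diagonal
sums are merged into a single one weighted by `hFun`. -/
theorem Rhat_eq_fin {p q : K} (hp : p ^ 2 = P.r) (hq : q ^ 2 = P.s) (z : A) :
    Rhat P p q n z = diagFun P n z • ∑ x, Matrix.single x x 1 ⊗ₖ Matrix.single x x 1
    + ∑ x, ∑ y, (if y ≠ x ∧ y ≠ x.rev then
        gFun P n z y x • (Matrix.single x y 1 ⊗ₖ Matrix.single y x 1) else 0)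
    + ∑ x, ∑ y, (if y ≠ x ∧ y ≠ x.rev then
        hFun P n z x y • (Matrix.single x x 1 ⊗ₖ Matrix.single y y 1) else 0)
    + ∑ x, ∑ y, zFun P n z x y • (Matrix.single x.rev y 1 ⊗ₖ Matrix.single x y.rev 1) := by
  unfold Rhat
  simp only [Finset.sum_filter, sum_Icc_eq_sum_fin, bar_eq_rev, E_eq_single, aCoef_eq P hp hq]
  have inj : ∀ x y : Fin (2 * n), (x : ℕ) + 1 = (y : ℕ) + 1 ↔ x = y := fun x y => by
    rw [add_left_inj, Fin.val_inj]
  simp only [ne_eq, inj, gt_iff_lt, add_lt_add_iff_right, Fin.val_fin_lt]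
  congr 1
  rw [add_assoc]
  congr 1
  simp only [Finset.smul_sum, ← Finset.sum_add_distrib]
  refine Finset.sum_congr rfl fun x _ => Finset.sum_congr rfl fun y _ => ?_
  unfold hFun
  by_cases h2 : y = x.rev
  · simp [h2]
  rcases lt_trichotomy x y with h | h | h
  · simp [h, h.ne', h2, h.not_gt]
  · simp [h]
  · simp [h, h.ne, h2, h.not_gt]

theorem Rhat_isVertex {p q : K} (hp : p ^ 2 = P.r) (hq : q ^ 2 = P.s) (z : A) :
    IsVertex Fin.rev (Rhat P p q n z) (diagFun P n z) (hFun P n z) (gFun P n z) (zFun P n z) := by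
  have hne : ∀ x : Fin (2 * n), x.rev ≠ x := fun x h => by
    have := congrArg Fin.val h
    rw [Fin.val_rev] at this
    omega
  have key : ∀ c d, Rhat P p q n z *ᵥ bv A c d =
      (if d = c then diagFun P n z • bv A c c else 0)
      + (if c ≠ d ∧ c ≠ d.rev then gFun P n z c d • bv A d c else 0)
      + (if d ≠ c ∧ d ≠ c.rev then hFun P n z c d • bv A c d else 0)
      + (if c.rev = d then ∑ i, zFun P n z i c • bv A i.rev i else 0) := by
    intro c d
    rw [Rhat_eq_fin P hp hq]
    simp only [Matrix.add_mulVec, Matrix.smul_mulVec, Matrix.sum_mulVec, single_kronecker_bv,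
      ← ite_and, apply_ite (· *ᵥ bv A c d), Matrix.zero_mulVec]
    congr 1
    · congr 1
      · congr 1
        · rw [Finset.sum_eq_single c]
          · simp [eq_comm]
          · intro b _ hb; simp [hb]
          · simp
        · rw [Finset.sum_eq_single d, Finset.sum_eq_single c]
          · simp
          · intro b _ hb; simp [hb]
          · simp
          · intro b _ hb; simp [hb]
          · simp
      · rw [Finset.sum_eq_single c, Finset.sum_eq_single d]
        · simp
        · intro b _ hb; simp [hb]
        · simp
        · intro b _ hb; simp [hb]
        · simp
    · rw [Finset.sum_comm, Finset.sum_eq_single c]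
      · by_cases h : c.rev = d <;> simp [h]
      · intro b _ hb; simp [hb]
      · simp
  have hrev : ∀ c d : Fin (2 * n), d = c.rev ↔ c = d.rev := fun c d =>
    ⟨fun h => by rw [h, Fin.rev_rev], fun h => by rw [h, Fin.rev_rev]⟩
  refine ⟨fun c => ?_, fun c d h1 h2 => ?_, fun c => ?_⟩
  · rw [key]; simp [hne]
  · rw [key]
    have h3 : c ≠ d.rev := fun h => h2 ((hrev _ _).2 h)
    simp [h1, h1.symm, h2, h2.symm, h3, add_comm]
  · rw [key]; simp [hne]

end RhatVertex

end TwoParam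
end

noncomputable section

namespace TwoParam

/-! ### The scalar identities, node by node. -/

section Conds

/-- The constants which enter `R̂(z)`, as elements of a commutative ring: `R, R'` stand for
`r, r⁻¹`, `S, S'` for `s, s⁻¹`, `X` for `ξ` and `t, t'` for `t_i, t_i⁻¹`. -/
structure Consts (A : Type*) [CommRing A] (n : ℕ) where
  R : A
  R' : A
  S : A
  S' : A
  X : A
  t : ℕ → A
  t' : ℕ → A
  hR : R * R' = 1
  hS : S * S' = 1
  ht : ∀ i, t i * t' i = 1
  -- The explicit powers are not needed: the indices attached to a node are adjacent, or meet across
  -- the middle, or lie at the two ends, so only these local ratios of the t_i enter.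
  t_low : ∀ i, 1 ≤ i → i < n → t (i + 1) = S * t i
  t'_low : ∀ i, 1 ≤ i → i < n → S * t' (i + 1) = t' i
  t_mid : t n = 1
  t_mid' : t (n + 1) = 1
  t'_mid : t' n = 1
  t'_mid' : t' (n + 1) = 1
  t_high : ∀ i, n + 1 ≤ i → i < 2 * n → t (i + 1) = R' * t i
  t'_high : ∀ i, n + 1 ≤ i → i < 2 * n → R' * t' (i + 1) = t' i
  -- This relation closes the chain of the t_i into a cycle with holonomy ξ; it is what the affine
  -- node uses.
  t_end : X * t 1 = t (2 * n)
  t'_end : X * t' (2 * n) = t' 1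

variable {A : Type*} [CommRing A] {n : ℕ} (C : Consts A n) (z : A)

namespace Consts

/-- This and the next functions are the coefficients of R̂(z) over any commutative ring. Inverses
are separate letters tied by the relations in `Consts`, so every condition is a polynomial identity.
-/
def h (c d : Fin (2 * n)) : A :=
  (1 - C.R' * C.S) * ((if c < d then z else 1) * (z - C.X))

/-- `a_{dc}(z) / ((z - 1) (z - ξ))`. -/
def gs (n c d : ℕ) : Prop := ((d < c ∧ d + c < 2 * n + 1) ∨ (c < d ∧ 2 * n + 1 < d + c)) ↔
  (d ≤ n ↔ c ≤ n)

/-- `gs` expresses that the exponent of (rs)^{1/2} in a_{dc} is −1, which leaves r⁻¹; otherwise it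
is 1, which leaves s. -/
def g (c d : Fin (2 * n)) : A := open Classical in
  (if gs n ((c : ℕ) + 1) ((d : ℕ) + 1) then C.R' else C.S) * ((z - 1) * (z - C.X))

def Z (i c : Fin (2 * n)) : A :=
  if i = c then (C.R' * C.S * z - C.X) * (z - 1)
  else if i < c then (C.R' * C.S - 1) *
    (C.X * C.t (i + 1) * C.t' (c + 1) * (z - 1) - (if i = c.rev then z - C.X else 0))
  else (C.R' * C.S - 1) * z *
    (C.t (i + 1) * C.t' (c + 1) * (z - 1) - (if i = c.rev then z - C.X else 0))

def h₀ : A := (z - C.R' * C.S) * (z - C.X)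

/-- The eigenvalues of `ω_m`, `1 ≤ m < n`, for given values of `r, r⁻¹, s, s⁻¹`. -/
def wMid (n : ℕ) (R R' S S' : A) (m j : ℕ) : A :=
  if j = m then R else if j = m + 1 then S else if j + m = 2 * n + 1 then R'
      else if j + m = 2 * n then S' else 1

/-- The eigenvalues of `ω_n`. -/
def wEnd (n : ℕ) (R R' S S' : A) (j : ℕ) : A :=
  if j + 1 = n then S' else if j = n then R else if j = n + 2 then S
      else if j = n + 1 then R' else if j ≤ n then R' * S' else R * S

/-- The eigenvalues of `ω_0` at level `1`. -/
def wZero (n : ℕ) (R R' S S' : A) (j : ℕ) : A :=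
  if j = 1 then S else if j = 2 then R' else if j + 1 = 2 * n then R
      else if j = 2 * n then S' else if j ≤ n then R' * S' else R * S

set_option maxHeartbeats 4000000 in
-- The node is i = a + 1; p and q are the positions of v_i and v_{i+1}, counted from 0. Since they
-- are adjacent, all other indices compare with p and q alike, and only the ratios t_q / t_p = s and
-- t_{p'} / t_{q'} = r⁻¹ matter.
theorem conds_e_mid {a : ℕ} (hmn : a + 1 < n) {p q : Fin (2 * n)}
    (hp : (p : ℕ) = a) (hq : (q : ℕ) = a + 1) :
    VertexConds Fin.rev (C.h₀ z) (C.h z) (C.g z) (C.Z z) p q (1) (-1)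
      (fun _ => 1) (fun j => wMid n C.R C.R' C.S C.S' (a + 1) ((j : ℕ) + 1)) 1 1 1 1 := by
  have h1 := C.hR
  have h2 := C.hS
  have h3 := C.t_low (a + 1) (by omega) hmn
  have h4 := C.t'_low (a + 1) (by omega) hmn
  have h5 := C.t_high (2 * n - (a + 1 + 1) + 1) (by omega) (by omega)
  have h6 := C.t'_high (2 * n - (a + 1 + 1) + 1) (by omega) (by omega)
  rw [show 2 * n - (a + 1 + 1) + 1 + 1 = 2 * n - (a + 1) + 1 by omega] at h5 h6
  have h7 := C.ht (a + 1)
  have h8 := C.ht (a + 1 + 1)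
  have h9 := C.ht (2 * n - (a + 1) + 1)
  have h10 := C.ht (2 * n - (a + 1 + 1) + 1)
  constructor
  case jq | jp' | qj | p'j =>
    intro j j1 j2 j3 j4
    simp only [ne_eq, Fin.ext_iff, Fin.val_rev, hp, hq] at j1 j2 j3 j4
    simp only [Consts.h, Consts.g, wMid, gs, Fin.lt_def, Fin.val_rev, hp, hq]
    grind
  case qq | p'p' | qp | pq | p'q' | q'p' =>
    simp only [Consts.h, Consts.h₀, Consts.g, gs, wMid, Fin.lt_def, Fin.val_rev, hp, hq]
    simp (disch := omega) only [if_pos, if_neg]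
    grind
  case qp' | p'q | zero₁ | zero₂ =>
    intro i
    simp only [Consts.h, Consts.Z, Consts.g, gs, wMid, Fin.lt_def, Fin.ext_iff,
      Fin.val_rev, hp, hq]
    obtain ⟨i, hi⟩ := i
    simp only
    -- The coefficients depend on i through t_i and through its order relative to p, q, q', p'. The
    -- four special positions and the three intervals between them therefore exhaust the cases.
    rcases (by omega : i = a ∨ i = a + 1 ∨ i = 2 * n - (a + 1) ∨ i = 2 * n - (a + 1 + 1) ∨ i < a ∨ (a + 1 < i ∧ i < 2 * n - (a + 1 + 1)) ∨ 2 * n - (a + 1) < i)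
      with rfl | rfl | rfl | rfl | h | h | h
    all_goals
      simp (disch := omega) only [if_pos, if_neg]
      grind

set_option maxHeartbeats 4000000 in
-- For f_i the indices p and q exchange roles, r and s are exchanged in the weights because ω'_i
-- replaces ω_i, and the weights stand in the term f_i ⊗ ω'_i.
theorem conds_f_mid {a : ℕ} (hmn : a + 1 < n) {p q : Fin (2 * n)}
    (hp : (p : ℕ) = a) (hq : (q : ℕ) = a + 1) :
    VertexConds Fin.rev (C.h₀ z) (C.h z) (C.g z) (C.Z z) q p (1) (-(C.R' * C.S'))
      (fun j => wMid n C.S C.S' C.R C.R' (a + 1) ((j : ℕ) + 1)) (fun _ => 1) 1 1 1 1 := by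
  have h1 := C.hR
  have h2 := C.hS
  have h3 := C.t_low (a + 1) (by omega) hmn
  have h4 := C.t'_low (a + 1) (by omega) hmn
  have h5 := C.t_high (2 * n - (a + 1 + 1) + 1) (by omega) (by omega)
  have h6 := C.t'_high (2 * n - (a + 1 + 1) + 1) (by omega) (by omega)
  rw [show 2 * n - (a + 1 + 1) + 1 + 1 = 2 * n - (a + 1) + 1 by omega] at h5 h6
  have h7 := C.ht (a + 1)
  have h8 := C.ht (a + 1 + 1)
  have h9 := C.ht (2 * n - (a + 1) + 1)
  have h10 := C.ht (2 * n - (a + 1 + 1) + 1)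
  constructor
  case jq | jp' | qj | p'j =>
    intro j j1 j2 j3 j4
    simp only [ne_eq, Fin.ext_iff, Fin.val_rev, hp, hq] at j1 j2 j3 j4
    simp only [Consts.h, Consts.g, wMid, gs, Fin.lt_def, Fin.val_rev, hp, hq]
    grind
  case qq | p'p' | qp | pq | p'q' | q'p' =>
    simp only [Consts.h, Consts.h₀, Consts.g, gs, wMid, Fin.lt_def, Fin.val_rev, hp, hq]
    simp (disch := omega) only [if_pos, if_neg]
    grind
  case qp' | p'q | zero₁ | zero₂ =>
    intro i
    simp only [Consts.h, Consts.Z, Consts.g, gs, wMid, Fin.lt_def, Fin.ext_iff,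
      Fin.val_rev, hp, hq]
    obtain ⟨i, hi⟩ := i
    simp only
    rcases (by omega : i = a ∨ i = a + 1 ∨ i = 2 * n - (a + 1) ∨ i = 2 * n - (a + 1 + 1) ∨ i < a ∨ (a + 1 < i ∧ i < 2 * n - (a + 1 + 1)) ∨ 2 * n - (a + 1) < i)
      with rfl | rfl | rfl | rfl | h | h | h
    all_goals
      simp (disch := omega) only [if_pos, if_neg]
      grind

set_option maxHeartbeats 4000000 in
-- With n = b + 2, the node n joins v_{n-1} to v_{n+1}, and q', p' belong to v_n, v_{n+2}. The two
-- branches of t meet here, which is why t_n = t_{n+1} = 1 is used.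
theorem conds_e_end {b : ℕ} (C : Consts A (b + 2)) {p q : Fin (2 * (b + 2))}
    (hp : (p : ℕ) = b) (hq : (q : ℕ) = b + 2) :
    VertexConds Fin.rev (C.h₀ z) (C.h z) (C.g z) (C.Z z) p q (C.R' * C.S') (-1)
      (fun _ => 1) (fun j => wEnd (b + 2) C.R C.R' C.S C.S' ((j : ℕ) + 1)) 1 1 1 1 := by
  have h1 := C.hR
  have h2 := C.hS
  have h3 := C.t_low (b + 1) (by omega) (by omega)
  have h4 := C.t'_low (b + 1) (by omega) (by omega)
  have h5 := C.t_high (b + 2 + 1) (by omega) (by omega)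
  have h6 := C.t'_high (b + 2 + 1) (by omega) (by omega)
  have h7 := C.t_mid
  have h8 := C.t_mid'
  have h9 := C.t'_mid
  have h10 := C.t'_mid'
  have h11 := C.ht (b + 1)
  have h12 := C.ht (b + 2 + 1 + 1)
  have r1 : 2 * (b + 2) - (b + 1) = b + 3 := by omega
  have r2 : 2 * (b + 2) - (b + 2 + 1) = b + 1 := by omega
  constructor
  case jq | jp' | qj | p'j =>
    intro j j1 j2 j3 j4
    simp only [ne_eq, Fin.ext_iff, Fin.val_rev, hp, hq, r1, r2] at j1 j2 j3 j4
    simp only [Consts.h, Consts.g, wEnd, gs, Fin.lt_def, Fin.val_rev, hp, hq, r1, r2]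
    grind
  case qq | p'p' | qp | pq | p'q' | q'p' =>
    simp only [Consts.h, Consts.h₀, Consts.g, gs, wEnd, Fin.lt_def, Fin.val_rev, hp, hq, r1, r2]
    simp (disch := omega) only [if_pos, if_neg]
    grind
  case qp' | p'q | zero₁ | zero₂ =>
    intro i
    simp only [Consts.h, Consts.Z, Consts.g, gs, wEnd, Fin.lt_def, Fin.ext_iff,
      Fin.val_rev, hp, hq, r1, r2]
    obtain ⟨i, hi⟩ := i
    simp only
    rcases (by omega : i = b ∨ i = b + 2 ∨ i = b + 3 ∨ i = b + 1 ∨ i < b ∨ b + 3 < i)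
      with rfl | rfl | rfl | rfl | h | h
    all_goals
      simp (disch := omega) only [if_pos, if_neg]
      grind

set_option maxHeartbeats 4000000 in
theorem conds_f_end {b : ℕ} (C : Consts A (b + 2)) {p q : Fin (2 * (b + 2))}
    (hp : (p : ℕ) = b) (hq : (q : ℕ) = b + 2) :
    VertexConds Fin.rev (C.h₀ z) (C.h z) (C.g z) (C.Z z) q p (1) (-1)
      (fun j => wEnd (b + 2) C.S C.S' C.R C.R' ((j : ℕ) + 1)) (fun _ => 1) 1 1 1 1 := by
  have h1 := C.hR
  have h2 := C.hS
  have h3 := C.t_low (b + 1) (by omega) (by omega)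
  have h4 := C.t'_low (b + 1) (by omega) (by omega)
  have h5 := C.t_high (b + 2 + 1) (by omega) (by omega)
  have h6 := C.t'_high (b + 2 + 1) (by omega) (by omega)
  have h7 := C.t_mid
  have h8 := C.t_mid'
  have h9 := C.t'_mid
  have h10 := C.t'_mid'
  have h11 := C.ht (b + 1)
  have h12 := C.ht (b + 2 + 1 + 1)
  have r1 : 2 * (b + 2) - (b + 1) = b + 3 := by omega
  have r2 : 2 * (b + 2) - (b + 2 + 1) = b + 1 := by omega
  constructor
  case jq | jp' | qj | p'j =>
    intro j j1 j2 j3 j4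
    simp only [ne_eq, Fin.ext_iff, Fin.val_rev, hp, hq, r1, r2] at j1 j2 j3 j4
    simp only [Consts.h, Consts.g, wEnd, gs, Fin.lt_def, Fin.val_rev, hp, hq, r1, r2]
    grind
  case qq | p'p' | qp | pq | p'q' | q'p' =>
    simp only [Consts.h, Consts.h₀, Consts.g, gs, wEnd, Fin.lt_def, Fin.val_rev, hp, hq, r1, r2]
    simp (disch := omega) only [if_pos, if_neg]
    grind
  case qp' | p'q | zero₁ | zero₂ =>
    intro i
    simp only [Consts.h, Consts.Z, Consts.g, gs, wEnd, Fin.lt_def, Fin.ext_iff,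
      Fin.val_rev, hp, hq, r1, r2]
    obtain ⟨i, hi⟩ := i
    simp only
    rcases (by omega : i = b ∨ i = b + 2 ∨ i = b + 3 ∨ i = b + 1 ∨ i < b ∨ b + 3 < i)
      with rfl | rfl | rfl | rfl | h | h
    all_goals
      simp (disch := omega) only [if_pos, if_neg]
      grind

set_option maxHeartbeats 4000000 in
-- The affine node joins v_2 to v_{2n}, and their opposites v_{2n-1} to v_1. An index j strictly
-- between q and p has j < p but j > q, so h(j, p) and h(j, q) differ by a factor z; the factor z in
-- the coefficients k₁ and k₄ compensates this. The relation ξ t_1 = t_{2n} handles the zero-weight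
-- part.
theorem conds_e_zero {b : ℕ} (hb : 1 ≤ b) (C : Consts A (b + 2)) {p q : Fin (2 * (b + 2))}
    (hp : (p : ℕ) = 2 * b + 3) (hq : (q : ℕ) = 1) :
    VertexConds Fin.rev (C.h₀ z) (C.h z) (C.g z) (C.Z z) p q (1) (-(C.R * C.S))
      (fun _ => 1) (fun j => wZero (b + 2) C.R C.R' C.S C.S' ((j : ℕ) + 1)) z 1 1 z := by
  have h1 := C.hR
  have h2 := C.hS
  have h3 := C.t_low 1 (by omega) (by omega)
  have h4 := C.t'_low 1 (by omega) (by omega)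
  have h5 := C.t_high (2 * b + 3) (by omega) (by omega)
  have h6 := C.t'_high (2 * b + 3) (by omega) (by omega)
  have h7 := C.t_end
  have h8 := C.t'_end
  have h11 := C.ht 1
  have h12 := C.ht (2 * b + 4)
  have r0 : 2 * (b + 2) = 2 * b + 4 := by omega
  have r1 : 2 * b + 4 - (1 + 1) = 2 * b + 2 := by omega
  have r2 : 2 * b + 4 - (2 * b + 3 + 1) = 0 := by omega
  rw [r0] at h7 h8
  constructor
  case jq | jp' | qj | p'j =>
    intro j j1 j2 j3 j4
    simp only [ne_eq, Fin.ext_iff, Fin.val_rev, hp, hq, r0, r1, r2] at j1 j2 j3 j4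
    simp only [Consts.h, Consts.g, wZero, gs, Fin.lt_def, Fin.val_rev, hp, hq, r0, r1, r2]
    grind
  case qq | p'p' | qp | pq | p'q' | q'p' =>
    simp only [Consts.h, Consts.h₀, Consts.g, gs, wZero, Fin.lt_def, Fin.val_rev, hp, hq, r0, r1, r2]
    simp (disch := omega) only [if_pos, if_neg]
    grind
  case qp' | p'q | zero₁ | zero₂ =>
    intro i
    simp only [Consts.h, Consts.Z, Consts.g, gs, wZero, Fin.lt_def, Fin.ext_iff,
      Fin.val_rev, hp, hq, r0, r1, r2]
    obtain ⟨i, hi⟩ := i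
    simp only
    rcases (by omega : i = 2 * b + 3 ∨ i = 1 ∨ i = 2 * b + 2 ∨ i = 0 ∨ 1 < i ∧ i < 2 * b + 2)
      with rfl | rfl | rfl | rfl | h
    all_goals
      simp (disch := omega) only [if_pos, if_neg]
      grind

set_option maxHeartbeats 4000000 in
theorem conds_f_zero {b : ℕ} (hb : 1 ≤ b) (C : Consts A (b + 2)) {p q : Fin (2 * (b + 2))}
    (hp : (p : ℕ) = 2 * b + 3) (hq : (q : ℕ) = 1) :
    VertexConds Fin.rev (C.h₀ z) (C.h z) (C.g z) (C.Z z) q p (1) (-1)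
      (fun j => wZero (b + 2) C.S C.S' C.R C.R' ((j : ℕ) + 1)) (fun _ => 1) 1 z z 1 := by
  have h1 := C.hR
  have h2 := C.hS
  have h3 := C.t_low 1 (by omega) (by omega)
  have h4 := C.t'_low 1 (by omega) (by omega)
  have h5 := C.t_high (2 * b + 3) (by omega) (by omega)
  have h6 := C.t'_high (2 * b + 3) (by omega) (by omega)
  have h7 := C.t_end
  have h8 := C.t'_end
  have h11 := C.ht 1
  have h12 := C.ht (2 * b + 4)
  have r0 : 2 * (b + 2) = 2 * b + 4 := by omega
  have r1 : 2 * b + 4 - (1 + 1) = 2 * b + 2 := by omega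
  have r2 : 2 * b + 4 - (2 * b + 3 + 1) = 0 := by omega
  rw [r0] at h7 h8
  constructor
  case jq | jp' | qj | p'j =>
    intro j j1 j2 j3 j4
    simp only [ne_eq, Fin.ext_iff, Fin.val_rev, hp, hq, r0, r1, r2] at j1 j2 j3 j4
    simp only [Consts.h, Consts.g, wZero, gs, Fin.lt_def, Fin.val_rev, hp, hq, r0, r1, r2]
    grind
  case qq | p'p' | qp | pq | p'q' | q'p' =>
    simp only [Consts.h, Consts.h₀, Consts.g, gs, wZero, Fin.lt_def, Fin.val_rev, hp, hq, r0, r1, r2]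
    simp (disch := omega) only [if_pos, if_neg]
    grind
  case qp' | p'q | zero₁ | zero₂ =>
    intro i
    simp only [Consts.h, Consts.Z, Consts.g, gs, wZero, Fin.lt_def, Fin.ext_iff,
      Fin.val_rev, hp, hq, r0, r1, r2]
    obtain ⟨i, hi⟩ := i
    simp only
    rcases (by omega : i = 2 * b + 3 ∨ i = 1 ∨ i = 2 * b + 2 ∨ i = 0 ∨ 1 < i ∧ i < 2 * b + 2)
      with rfl | rfl | rfl | rfl | h
    all_goals
      simp (disch := omega) only [if_pos, if_neg]
      grind

end Consts

end Conds

end TwoParam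
end

noncomputable section

namespace TwoParam

/-! ### Commutation of R̂(z) with the coproducts of the generators. -/

section Core

open Matrix

variable {K : Type*} [Field K] [Algebra ℂ K] (P : Params K) (A : Type*) [CommRing A] [Algebra K A]
  {n : ℕ}

theorem tCoef_ne_zero (i : ℕ) : tCoef P n i ≠ 0 := by
  unfold tCoef
  split_ifs
  · exact zpow_ne_zero _ P.s_ne_zero
  · exact zpow_ne_zero _ P.r_ne_zero

theorem tCoef_low {i : ℕ} (h : i < n) : tCoef P n (i + 1) = P.s * tCoef P n i := by
  unfold tCoef
  rw [if_pos (Nat.succ_le_of_lt h), if_pos h.le, mul_comm, ← zpow_add_one₀ P.s_ne_zero]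
  congr 1
  push_cast
  ring

theorem tCoef_high {i : ℕ} (h : n + 1 ≤ i) : tCoef P n (i + 1) = P.r⁻¹ * tCoef P n i := by
  unfold tCoef
  rw [if_neg (by omega), if_neg (by omega), mul_comm, ← zpow_sub_one₀ P.r_ne_zero]
  congr 1
  push_cast
  ring

theorem tCoef_end (hn : 1 ≤ n) : xi P n * tCoef P n 1 = tCoef P n (2 * n) := by
  unfold tCoef xi
  rw [if_pos hn, if_neg (by omega), mul_assoc, ← zpow_add₀ P.s_ne_zero]
  push_cast
  rw [show (n : ℤ) - 1 + (1 - n) = 0 by ring, zpow_zero, mul_one]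
  congr 1
  ring

/-- The constants of `R̂(z)` in a `K`-algebra. -/
def Params.consts (hn : 1 ≤ n) : Consts A n where
  R := algebraMap K A P.r
  R' := algebraMap K A P.r⁻¹
  S := algebraMap K A P.s
  S' := algebraMap K A P.s⁻¹
  X := algebraMap K A (xi P n)
  t i := algebraMap K A (tCoef P n i)
  t' i := algebraMap K A (tCoef P n i)⁻¹
  hR := by rw [← map_mul, mul_inv_cancel₀ P.r_ne_zero, map_one]
  hS := by rw [← map_mul, mul_inv_cancel₀ P.s_ne_zero, map_one]
  ht i := by rw [← map_mul, mul_inv_cancel₀ (tCoef_ne_zero P i), map_one]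
  t_low i _ h := by rw [tCoef_low P h, map_mul]
  t'_low i _ h := by
    rw [tCoef_low P h, ← map_mul, mul_inv, mul_inv_cancel_left₀ P.s_ne_zero]
  t_mid := by simp [tCoef]
  t_mid' := by simp [tCoef]
  t'_mid := by simp [tCoef]
  t'_mid' := by simp [tCoef]
  t_high i h _ := by rw [tCoef_high P h, map_mul]
  t'_high i h _ := by
    rw [tCoef_high P h, ← map_mul, mul_inv, mul_inv_cancel_left₀ (inv_ne_zero P.r_ne_zero)]
  t_end := by rw [← map_mul, tCoef_end P hn]
  t'_end := by
    have h : xi P n ≠ 0 :=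
      mul_ne_zero (zpow_ne_zero _ P.r_ne_zero) (zpow_ne_zero _ P.s_ne_zero)
    rw [← map_mul, ← tCoef_end P hn, mul_inv, mul_inv_cancel_left₀ h]

variable {A}

theorem gs_iff {c : ℕ} (hc : c < 2 * n) (d : ℕ) :
    Consts.gs n (c + 1) (d + 1) ↔ aExp n (d + 1) (c + 1) ≠ 1 := by
  unfold Consts.gs aExp sgn bar
  grind (splits := 40)

theorem Rhat_isVertex_consts {p q : K} (hp : p ^ 2 = P.r) (hq : q ^ 2 = P.s) (hn : 1 ≤ n) (z : A) :
    IsVertex Fin.rev (Rhat P p q n z) ((P.consts A hn).h₀ z) ((P.consts A hn).h z)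
      ((P.consts A hn).g z) ((P.consts A hn).Z z) := by
  have h := Rhat_isVertex P hp hq (n := n) z
  have e1 : diagFun P n z = (P.consts A hn).h₀ z := by
    simp [diagFun, Consts.h₀, Params.consts]
  have e2 : hFun P n z = (P.consts A hn).h z := by
    funext c d
    simp [hFun, Consts.h, Params.consts, Algebra.smul_def]
  have e3 : gFun P n z = (P.consts A hn).g z := by
    funext c d
    simp only [gFun, Consts.g, aScal, Params.consts, Algebra.smul_def]
    congr 1
    by_cases h : aExp n ((d : ℕ) + 1) ((c : ℕ) + 1) = 1
    · rw [if_pos h, if_neg (fun h' => (gs_iff c.2 d).1 h' h)]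
    · rw [if_neg h, if_pos ((gs_iff c.2 d).2 h)]
  have e4 : zFun P n z = (P.consts A hn).Z z := by
    funext i c
    have inj : ∀ x y : Fin (2 * n), (x : ℕ) + 1 = (y : ℕ) + 1 ↔ x = y := fun x y => by
      rw [add_left_inj, Fin.val_inj]
    simp only [zFun, bCoef, Consts.Z, Params.consts, bar_eq_rev, inj, eq_comm (a := c),
      add_lt_add_iff_right, Fin.val_fin_lt, Algebra.smul_def, map_mul, map_sub, map_one, ite_mul,
      one_mul, zero_mul, mul_assoc]
  rwa [e1, e2, e3, e4] at h

/-- The index `pI - 1` as an element of `Fin (2 n)`. -/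
def pF (hn : 3 ≤ n) (i : ℕ) : Fin (2 * n) := ⟨pI n i - 1, by have := pI_range hn i; omega⟩

/-- The index `qI - 1` as an element of `Fin (2 n)`. -/
def qF (hn : 3 ≤ n) (i : ℕ) : Fin (2 * n) := ⟨qI n i - 1, by have := qI_range hn i; omega⟩

theorem pF_succ (hn : 3 ≤ n) (i : ℕ) : (pF hn i : ℕ) + 1 = pI n i := by
  have := pI_range hn i
  simp only [pF]
  omega

theorem qF_succ (hn : 3 ≤ n) (i : ℕ) : (qF hn i : ℕ) + 1 = qI n i := by
  have := qI_range hn i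
  simp only [qF]
  omega

theorem eForm_eq_twoUnit (hn : 3 ≤ n) (i : ℕ) (x y : A) :
    eForm A n i x y = twoUnit Fin.rev (pF hn i) (qF hn i) x y := by
  unfold eForm twoUnit
  rw [← pF_succ hn, ← qF_succ hn, bar_eq_rev, bar_eq_rev, E_eq_single, E_eq_single]
  simp

theorem fForm_eq_twoUnit (hn : 3 ≤ n) (i : ℕ) (x y : A) :
    fForm A n i x y = twoUnit Fin.rev (qF hn i) (pF hn i) x y := by
  unfold fForm twoUnit
  rw [← pF_succ hn, ← qF_succ hn, bar_eq_rev, bar_eq_rev, E_eq_single, E_eq_single]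
  simp

theorem rev_ne (x : Fin (2 * n)) : x.rev ≠ x := fun h => by
  have := congrArg Fin.val h
  rw [Fin.val_rev] at this
  omega

theorem pF_ne (hn : 3 ≤ n) {i : ℕ} (hi : i ≤ n) :
    pF hn i ≠ qF hn i ∧ pF hn i ≠ (qF hn i).rev ∧ qF hn i ≠ (pF hn i).rev := by
  simp only [ne_eq, Fin.ext_iff, Fin.val_rev, pF, qF, pI, qI]
  grind

/-- `Δ(e_i)` on `V(u) ⊗ V(v)`, where `e_i` acts by `k e_i` and `k' e_i` on the two factors. -/
def deltaE (n : ℕ) (i : ℕ) (k k' : A) :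
    Matrix (Fin (2 * n) × Fin (2 * n)) (Fin (2 * n) × Fin (2 * n)) A :=
  k • (matE P n (1 : A) i ⊗ₖ (1 : Matrix (Fin (2 * n)) (Fin (2 * n)) A))
    + k' • (dg A n (wVal P n 1 i) ⊗ₖ matE P n (1 : A) i)

/-- `Δ(f_i)` on `V(u) ⊗ V(v)`, where `f_i` acts by `k f_i` and `k' f_i` on the two factors. -/
def deltaF (n : ℕ) (i : ℕ) (k k' : A) :
    Matrix (Fin (2 * n) × Fin (2 * n)) (Fin (2 * n) × Fin (2 * n)) A :=
  k • (matF P n (1 : A) i ⊗ₖ dg A n (wVal' P n 1 i))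
    + k' • ((1 : Matrix (Fin (2 * n)) (Fin (2 * n)) A) ⊗ₖ matF P n (1 : A) i)

theorem deltaE_eq (hn : 3 ≤ n) (i : ℕ) (k k' : A) :
    deltaE P n i k k' = twoStep Fin.rev (pF hn i) (qF hn i) (eX P n (1 : A) i) (eY P (1 : A) i)
      (fun _ => 1) (fun j => algebraMap K A (wVal P n 1 i ((j : ℕ) + 1))) k k' := by
  unfold deltaE twoStep
  rw [matE_eq P hn, eForm_eq_twoUnit hn, dg, Matrix.diagonal_one]

theorem deltaF_eq (hn : 3 ≤ n) (i : ℕ) (k k' : A) :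
    deltaF P n i k k' = twoStep Fin.rev (qF hn i) (pF hn i) (fX (1 : A) i) (fY P n (1 : A) i)
      (fun j => algebraMap K A (wVal' P n 1 i ((j : ℕ) + 1))) (fun _ => 1) k k' := by
  unfold deltaF twoStep
  rw [matF_eq P hn, fForm_eq_twoUnit hn, dg, Matrix.diagonal_one]

theorem wVal_mid (hn : 1 ≤ n) {i : ℕ} (hi : i ≠ 0) (hin : i < n) (j : Fin (2 * n)) (c : K) :
    algebraMap K A (wVal P n c i ((j : ℕ) + 1)) = Consts.wMid n (P.consts A hn).R
      (P.consts A hn).R' (P.consts A hn).S (P.consts A hn).S' i ((j : ℕ) + 1) := by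
  simp only [wVal, Consts.wMid, hi, hin, if_true, if_false, Params.consts,
    apply_ite (algebraMap K A), bar]
  grind

theorem wVal'_mid (hn : 1 ≤ n) {i : ℕ} (hi : i ≠ 0) (hin : i < n) (j : Fin (2 * n)) (c : K) :
    algebraMap K A (wVal' P n c i ((j : ℕ) + 1)) = Consts.wMid n (P.consts A hn).S
      (P.consts A hn).S' (P.consts A hn).R (P.consts A hn).R' i ((j : ℕ) + 1) := by
  simp only [wVal', Consts.wMid, hi, hin, if_true, if_false, Params.consts,
    apply_ite (algebraMap K A), bar]
  grind

theorem wVal_end (hn : 3 ≤ n) (j : Fin (2 * n)) (c : K) :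
    algebraMap K A (wVal P n c n ((j : ℕ) + 1)) = Consts.wEnd n (P.consts A (by omega : 1 ≤ n)).R
      (P.consts A (by omega : 1 ≤ n)).R' (P.consts A (by omega : 1 ≤ n)).S (P.consts A (by omega : 1 ≤ n)).S'
      ((j : ℕ) + 1) := by
  have h0 : n ≠ 0 := by omega
  simp only [wVal, Consts.wEnd, h0, lt_irrefl, if_false, Params.consts,
    apply_ite (algebraMap K A), bar]
  grind

theorem wVal'_end (hn : 3 ≤ n) (j : Fin (2 * n)) (c : K) :
    algebraMap K A (wVal' P n c n ((j : ℕ) + 1)) = Consts.wEnd n (P.consts A (by omega : 1 ≤ n)).S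
      (P.consts A (by omega : 1 ≤ n)).S' (P.consts A (by omega : 1 ≤ n)).R (P.consts A (by omega : 1 ≤ n)).R'
      ((j : ℕ) + 1) := by
  have h0 : n ≠ 0 := by omega
  simp only [wVal', Consts.wEnd, h0, lt_irrefl, if_false, Params.consts,
    apply_ite (algebraMap K A), bar]
  grind

theorem wVal_zero (hn : 3 ≤ n) (j : Fin (2 * n)) :
    algebraMap K A (wVal P n 1 0 ((j : ℕ) + 1)) = Consts.wZero n (P.consts A (by omega : 1 ≤ n)).R
      (P.consts A (by omega : 1 ≤ n)).R' (P.consts A (by omega : 1 ≤ n)).S (P.consts A (by omega : 1 ≤ n)).S'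
      ((j : ℕ) + 1) := by
  simp only [wVal, Consts.wZero, if_true, Params.consts,
    apply_ite (algebraMap K A), bar, one_mul]
  grind

theorem wVal'_zero (hn : 3 ≤ n) (j : Fin (2 * n)) :
    algebraMap K A (wVal' P n 1 0 ((j : ℕ) + 1)) = Consts.wZero n (P.consts A (by omega : 1 ≤ n)).S
      (P.consts A (by omega : 1 ≤ n)).S' (P.consts A (by omega : 1 ≤ n)).R (P.consts A (by omega : 1 ≤ n)).R'
      ((j : ℕ) + 1) := by
  simp only [wVal', Consts.wZero, if_true, Params.consts,
    apply_ite (algebraMap K A), bar, one_mul]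
  grind

/-- The spectral factor of the affine node. -/
def kz (z : A) (i : ℕ) : A := if i = 0 then z else 1

/-- The parameters are normalized so that e_0 carries z on the factor V(u) and 1 on V(v). R̂
exchanges the two modules, hence the exchanged coefficients on the right. The three cases are the
affine node, the linear part of the diagram and the node n. -/
theorem Rhat_deltaE {p q : K} (hp : p ^ 2 = P.r) (hq : q ^ 2 = P.s) (hn : 3 ≤ n) (z : A) {i : ℕ}
    (hi : i ≤ n) :
    Rhat P p q n z * deltaE P n i (kz z i) 1 = deltaE P n i 1 (kz z i) * Rhat P p q n z := by
  have hV := Rhat_isVertex_consts P hp hq (by omega : 1 ≤ n) z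
  obtain ⟨n1, n2, n3⟩ := pF_ne hn hi
  simp only [deltaE_eq P hn]
  refine hV.intertwine Fin.rev_rev rev_ne n1 n2 ?_
  by_cases h0 : i = 0
  · subst h0
    obtain ⟨b, rfl⟩ : ∃ b, n = b + 2 := ⟨n - 2, by omega⟩
    simp only [wVal_zero P hn, eX, eY, kz, if_true]
    have := (P.consts A (by omega : 1 ≤ b + 2)).conds_e_zero z (by omega)
      (p := pF hn 0) (q := qF hn 0) (by change pI _ 0 - 1 = _; simp [pI]; omega) (by change qI _ 0 - 1 = 1; simp [qI])
    convert this using 1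
    · simp [Params.consts, Algebra.smul_def]
  by_cases hin : i < n
  · simp only [wVal_mid P (by omega : 1 ≤ n) h0 hin, eX, eY, kz, h0, hin, if_true, if_false]
    have := (P.consts A (by omega : 1 ≤ n)).conds_e_mid z (a := i - 1) (by omega)
      (p := pF hn i) (q := qF hn i) (by simp [pF, pI, h0, hin]) (by simp [qF, qI, h0, hin]; omega)
    rwa [Nat.sub_add_cancel (by omega)] at this
  · obtain rfl : i = n := by omega
    obtain ⟨b, rfl⟩ : ∃ b, i = b + 2 := ⟨i - 2, by omega⟩
    simp only [wVal_end P hn, eX, eY, kz, h0, hin, if_false]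
    have := Consts.conds_e_end z (P.consts A (by omega : 1 ≤ b + 2))
      (p := pF hn (b + 2)) (q := qF hn (b + 2)) (by simp [pF, pI]) (by simp [qF, qI])
    convert this using 1
    simp [Params.consts, mul_comm]

/-- Since f_0 depends on the inverse parameter, the factor z now belongs to V(v). -/
theorem Rhat_deltaF {p q : K} (hp : p ^ 2 = P.r) (hq : q ^ 2 = P.s) (hn : 3 ≤ n) (z : A) {i : ℕ}
    (hi : i ≤ n) :
    Rhat P p q n z * deltaF P n i 1 (kz z i) = deltaF P n i (kz z i) 1 * Rhat P p q n z := by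
  have hV := Rhat_isVertex_consts P hp hq (by omega : 1 ≤ n) z
  obtain ⟨n1, n2, n3⟩ := pF_ne hn hi
  simp only [deltaF_eq P hn]
  refine hV.intertwine Fin.rev_rev rev_ne n1.symm n3 ?_
  by_cases h0 : i = 0
  · subst h0
    obtain ⟨b, rfl⟩ : ∃ b, n = b + 2 := ⟨n - 2, by omega⟩
    simp only [wVal'_zero P hn, fX, fY, kz, if_true]
    exact (P.consts A (by omega : 1 ≤ b + 2)).conds_f_zero z (by omega)
      (p := pF hn 0) (q := qF hn 0) (by change pI _ 0 - 1 = _; simp [pI]; omega) (by change qI _ 0 - 1 = 1; simp [qI])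
  by_cases hin : i < n
  · simp only [wVal'_mid P (by omega : 1 ≤ n) h0 hin, fX, fY, kz, h0, hin, if_true, if_false]
    have := (P.consts A (by omega : 1 ≤ n)).conds_f_mid z (a := i - 1) (by omega)
      (p := pF hn i) (q := qF hn i) (by simp [pF, pI, h0, hin]) (by simp [qF, qI, h0, hin]; omega)
    rw [Nat.sub_add_cancel (by omega)] at this
    convert this using 1
    simp [Params.consts, mul_comm]
  · obtain rfl : i = n := by omega
    obtain ⟨b, rfl⟩ : ∃ b, i = b + 2 := ⟨i - 2, by omega⟩
    simp only [wVal'_end P hn, fX, fY, kz, h0, hin, if_false]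
    exact Consts.conds_f_end z (P.consts A (by omega : 1 ≤ b + 2))
      (p := pF hn (b + 2)) (q := qF hn (b + 2)) (by simp [pF, pI]) (by simp [qF, qI])

/-- The diagonal operator is scalar on each subspace that a vertex operator preserves: d_c d_e is
symmetric in c and e, and d_i d_{i'} does not depend on i. -/
theorem IsVertex.commute_diagonal {ι : Type*} [Fintype ι] [DecidableEq ι] {bar : ι → ι}
    {R : Matrix (ι × ι) (ι × ι) A} {h₀ : A} {h g Z : ι → ι → A}
    (hR : IsVertex bar R h₀ h g Z) {d : ι → A} {k : A} (hd : ∀ i, d i * d (bar i) = k) :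
    R * (Matrix.diagonal d ⊗ₖ Matrix.diagonal d) = (Matrix.diagonal d ⊗ₖ Matrix.diagonal d) * R := by
  have key : ∀ c e, (Matrix.diagonal d ⊗ₖ Matrix.diagonal d) *ᵥ bv A c e =
      (d c * d e) • bv A c e := by
    intro c e
    rw [kronecker_mulVec_bv]
    funext ⟨a, b⟩
    by_cases h1 : a = c <;> by_cases h2 : b = e <;>
      simp [bv, h1, h2]
  refine matrix_ext_bv fun c e => ?_
  rw [← Matrix.mulVec_mulVec, ← Matrix.mulVec_mulVec, key, Matrix.mulVec_smul]
  by_cases h1 : e = bar c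
  · subst h1
    rw [hR.zero, Matrix.mulVec_sum, Finset.smul_sum]
    refine Finset.sum_congr rfl fun i _ => ?_
    rw [Matrix.mulVec_smul, key, hd, mul_comm, hd, smul_comm]
  by_cases h2 : e = c
  · subst h2
    rw [hR.diag, Matrix.mulVec_smul, key, smul_comm]
  · rw [hR.gen c e h2 h1, Matrix.mulVec_add, Matrix.mulVec_smul, Matrix.mulVec_smul, key, key]
    module

/-- v_j and v_{j'} have opposite weights, so the powers of r and s cancel and only the level of ω_0
remains. -/
theorem wVal_mul_bar (hn : 3 ≤ n) {i : ℕ} (hi : i ≤ n) (c : K) {j : ℕ} (hj : 1 ≤ j)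
    (hj2 : j ≤ 2 * n) :
    wVal P n c i j * wVal P n c i (bar n j) = (if i = 0 then c else 1) ^ 2 := by
  have hr := P.r_ne_zero
  have hs := P.s_ne_zero
  rw [wVal_eq, wVal_eq, wX_bar hn hi hj hj2, wY_bar hn hi hj hj2, _root_.zpow_neg, _root_.zpow_neg]
  field_simp

theorem wVal'_mul_bar (hn : 3 ≤ n) {i : ℕ} (hi : i ≤ n) (c : K) {j : ℕ} (hj : 1 ≤ j)
    (hj2 : j ≤ 2 * n) :
    wVal' P n c i j * wVal' P n c i (bar n j) = (if i = 0 then c else 1) ^ 2 := by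
  have hr := P.r_ne_zero
  have hs := P.s_ne_zero
  rw [wVal'_eq, wVal'_eq, wX_bar hn hi hj hj2, wY_bar hn hi hj hj2, _root_.zpow_neg, _root_.zpow_neg]
  field_simp

theorem Rhat_dg {p q : K} (hp : p ^ 2 = P.r) (hq : q ^ 2 = P.s) (z : A) {d : ℕ → K} {k : K}
    (hd : ∀ j, 1 ≤ j → j ≤ 2 * n → d j * d (bar n j) = k) :
    Rhat P p q n z * (dg A n d ⊗ₖ dg A n d) = (dg A n d ⊗ₖ dg A n d) * Rhat P p q n z := by
  refine (Rhat_isVertex P hp hq z).commute_diagonal (k := algebraMap K A k) fun i => ?_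
  rw [← map_mul, ← bar_eq_rev, hd _ (by omega) (by omega)]

end Core

end TwoParam
end

/-! ### Reduction to generators, base change, and (a) for numerical parameters. -/

noncomputable section

namespace TwoParam

/-- The elements x with r F(x) = G(x) r form a subalgebra. -/
theorem intertwine_of_generators {K X Q B : Type*} [Field K] [Ring Q] [Algebra K Q] [Ring B]
    [Algebra K B] {π : FreeAlgebra K X →ₐ[K] Q} (hπ : Function.Surjective π) (F G : Q →ₐ[K] B)
    (r : B) (h : ∀ y, r * F (π (FreeAlgebra.ι K y)) = G (π (FreeAlgebra.ι K y)) * r) (x : Q) :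
    r * F x = G x * r := by
  obtain ⟨w, rfl⟩ := hπ x
  induction w using FreeAlgebra.induction with
  | grade0 k => rw [AlgHom.commutes, AlgHom.commutes, AlgHom.commutes, Algebra.commutes]
  | grade1 y => exact h y
  | mul a b ha hb => rw [map_mul, map_mul, map_mul, ← mul_assoc, ha, mul_assoc, hb, mul_assoc]
  | add a b ha hb => rw [map_add, map_add, map_add, mul_add, add_mul, ha, hb]

section Maps

open Matrix

variable {K : Type*} [Field K] [Algebra ℂ K] (P : Params K) {A B : Type*} [CommRing A] [Algebra K A]
  [CommRing B] [Algebra K B] (φ : A →ₐ[K] B) {n : ℕ}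

theorem E_map_apply (i j : ℕ) (x y : Fin (2 * n)) : φ (E A n i j x y) = E B n i j x y := by
  rw [← E_map φ, Matrix.map_apply]

theorem aCoef_map (p q : K) (z : A) (i j : ℕ) :
    φ (aCoef P p q n z i j) = aCoef P p q n (φ z) i j := by
  simp [aCoef]

theorem bCoef_map (z : A) (i j : ℕ) : φ (bCoef P n z i j) = bCoef P n (φ z) i j := by
  simp only [bCoef]
  split_ifs <;> simp

/-- The entries are polynomials in z over K. This serves both the degree operators, which fix z =
u/v, and the specializations of t in the braid relation. -/
theorem Rhat_map (p q : K) (z : A) : (Rhat P p q n z).map φ = Rhat P p q n (φ z) := by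
  ext x y
  simp only [Rhat, Matrix.map_apply, Matrix.add_apply, Matrix.smul_apply, Matrix.sum_apply,
    Matrix.kroneckerMap_apply, smul_eq_mul, map_add, map_mul, map_sum, map_sub, map_smul,
    AlgHom.commutes, E_map_apply, aCoef_map, bCoef_map]

theorem matE_eq_smul (α : A) (i : ℕ) : matE P n α i = kz α i • matE P n (1 : A) i := by
  unfold matE kz
  split_ifs <;> simp

theorem matF_eq_smul (β : A) (i : ℕ) : matF P n β i = kz β i • matF P n (1 : A) i := by
  unfold matF kz
  split_ifs <;> simp

theorem kz_map (z : A) (i : ℕ) : φ (kz z i) = kz (φ z) i := by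
  unfold kz
  split_ifs <;> simp

theorem kz_mul (z w : A) (i : ℕ) : kz (z * w) i = kz z i * kz w i := by
  unfold kz
  split_ifs <;> simp

theorem kronecker_map {l m : Type*} (M : Matrix l l A) (N : Matrix m m A) :
    (M ⊗ₖ N).map φ = M.map φ ⊗ₖ N.map φ := by
  ext x y
  simp

theorem deltaE_map (i : ℕ) (k k' : A) : (deltaE P n i k k').map φ = deltaE P n i (φ k) (φ k') := by
  have h : ∀ (k : A) (M : Matrix (Fin (2 * n) × Fin (2 * n)) (Fin (2 * n) × Fin (2 * n)) A),
      (k • M).map φ = φ k • M.map φ := fun k M => by ext; simp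
  unfold deltaE
  rw [Matrix.map_add _ (fun x y => map_add φ x y), h, h, kronecker_map, kronecker_map, matE_map,
    map_one, dg_map, Matrix.map_one _ (map_zero φ) (map_one φ)]

theorem deltaF_map (i : ℕ) (k k' : A) : (deltaF P n i k k').map φ = deltaF P n i (φ k) (φ k') := by
  have h : ∀ (k : A) (M : Matrix (Fin (2 * n) × Fin (2 * n)) (Fin (2 * n) × Fin (2 * n)) A),
      (k • M).map φ = φ k • M.map φ := fun k M => by ext; simp
  unfold deltaF
  rw [Matrix.map_add _ (fun x y => map_add φ x y), h, h, kronecker_map, kronecker_map, matF_map,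
    map_one, dg_map, Matrix.map_one _ (map_zero φ) (map_one φ)]

theorem deltaE_smul (i : ℕ) (m k k' : A) : deltaE P n i (m * k) (m * k') = m • deltaE P n i k k' := by
  simp only [deltaE, smul_add, smul_smul]

theorem deltaF_smul (i : ℕ) (m k k' : A) : deltaF P n i (m * k) (m * k') = m • deltaF P n i k k' := by
  simp only [deltaF, smul_add, smul_smul]

variable {P}

/-- The intertwining relation for `e_i` acting by `α` and `β` on the two factors. -/
theorem Rhat_deltaE_kz {p q : K} (hp : p ^ 2 = P.r) (hq : q ^ 2 = P.s) (hn : 3 ≤ n) {z α β : A}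
    (h : α = β * z) {i : ℕ} (hi : i ≤ n) :
    Rhat P p q n z * deltaE P n i (kz α i) (kz β i) =
      deltaE P n i (kz β i) (kz α i) * Rhat P p q n z := by
  have := Rhat_deltaE P hp hq hn z hi
  -- Only the ratio of the two parameters matters: the common factor `kz β i` is taken out on both
  -- sides, which leaves the normalized relation.
  rw [h, kz_mul]
  nth_rw 2 [← mul_one (kz β i)]
  nth_rw 3 [← mul_one (kz β i)]
  rw [deltaE_smul, deltaE_smul, Matrix.mul_smul, Matrix.smul_mul, this]

/-- The intertwining relation for `f_i` acting by `α` and `β` on the two factors. -/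
theorem Rhat_deltaF_kz {p q : K} (hp : p ^ 2 = P.r) (hq : q ^ 2 = P.s) (hn : 3 ≤ n) {z α β : A}
    (h : β = α * z) {i : ℕ} (hi : i ≤ n) :
    Rhat P p q n z * deltaF P n i (kz α i) (kz β i) =
      deltaF P n i (kz β i) (kz α i) * Rhat P p q n z := by
  have := Rhat_deltaF P hp hq hn z hi
  rw [h, kz_mul]
  nth_rw 1 [← mul_one (kz α i)]
  nth_rw 4 [← mul_one (kz α i)]
  rw [deltaF_smul, deltaF_smul, Matrix.mul_smul, Matrix.smul_mul, this]

/-- All uses of the relation between a and b pass through this: at level one ω_0 and ω'_0 have the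
eigenvalues for which the conditions at the affine node were verified. -/
theorem level_eq_one {a b : Kˣ} (hab : (a : K) * b = (P.r * P.s)⁻¹) : level P a b = 1 := by
  rw [level, hab, mul_inv_cancel₀ (mul_ne_zero P.r_ne_zero P.s_ne_zero)]

variable (P)

/-- The matrices by which the generators of `U'_{r,s}` act on `V(u) ⊗ V(v)` at level `1`, where
`e_0` is scaled by `α`, `α'` and `f_0` by `β`, `β'` on the two factors. -/
def deltaGen (n : ℕ) (α α' β β' : A) :
    Gen n → Matrix (Fin (2 * n) × Fin (2 * n)) (Fin (2 * n) × Fin (2 * n)) A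
  | .e i => deltaE P n i (kz α i) (kz α' i)
  | .f i => deltaF P n i (kz β i) (kz β' i)
  | .w i => dg A n (wVal P n 1 i) ⊗ₖ dg A n (wVal P n 1 i)
  | .wi i => dg A n (fun j => (wVal P n 1 i j)⁻¹) ⊗ₖ dg A n (fun j => (wVal P n 1 i j)⁻¹)
  | .w' i => dg A n (wVal' P n 1 i) ⊗ₖ dg A n (wVal' P n 1 i)
  | .w'i i => dg A n (fun j => (wVal' P n 1 i j)⁻¹) ⊗ₖ dg A n (fun j => (wVal' P n 1 i j)⁻¹)
  | .g => 1
  | .gi => 1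
  | .g' => 1
  | .g'i => 1

/-- In the application e_0 is scaled by au, av and f_0 by bu⁻¹, bv⁻¹; this is why z is α/α' for the
first pair and β'/β for the second. The result holds over any commutative K-algebra, so it covers
numbers and indeterminates alike. -/
theorem Rhat_deltaGen {p q : K} (hp : p ^ 2 = P.r) (hq : q ^ 2 = P.s) (hn : 3 ≤ n)
    {z α α' β β' : A} (hα : α = α' * z) (hβ : β' = β * z) (y : Gen n) :
    Rhat P p q n z * deltaGen P n α α' β β' y = deltaGen P n α' α β' β y * Rhat P p q n z := by
  have hle : ∀ i : Fin (n + 1), (i : ℕ) ≤ n := fun i => Nat.lt_succ_iff.1 i.2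
  cases y with
  | e i => exact Rhat_deltaE_kz hp hq hn hα (hle i)
  | f i => exact Rhat_deltaF_kz hp hq hn hβ (hle i)
  | w i => exact Rhat_dg P hp hq z fun j h1 h2 => wVal_mul_bar P hn (hle i) 1 h1 h2
  | wi i =>
    exact Rhat_dg P hp hq z fun j h1 h2 => by rw [← mul_inv, wVal_mul_bar P hn (hle i) 1 h1 h2]
  | w' i => exact Rhat_dg P hp hq z fun j h1 h2 => wVal'_mul_bar P hn (hle i) 1 h1 h2
  | w'i i =>
    exact Rhat_dg P hp hq z fun j h1 h2 => by rw [← mul_inv, wVal'_mul_bar P hn (hle i) 1 h1 h2]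
  | g => simp [deltaGen]
  | gi => simp [deltaGen]
  | g' => simp [deltaGen]
  | g'i => simp [deltaGen]

theorem deltaGen_map (α α' β β' : A) (y : Gen n) :
    (deltaGen P n α α' β β' y).map φ = deltaGen P n (φ α) (φ α') (φ β) (φ β') y := by
  cases y <;>
    simp [deltaGen, deltaE_map, deltaF_map, kz_map, kronecker_map, dg_map]

theorem tensorRep'_gen' (hn : 3 ≤ n) {a b : Kˣ} (hab : (a : K) * b = (P.r * P.s)⁻¹) (u v : Kˣ)
    (y : Gen n) : tensorRep' P hn a b u v (gen' P y) =
      deltaGen P n ((a : K) * u) ((a : K) * v) ((b : K) * (u : K)⁻¹) ((b : K) * (v : K)⁻¹) y := by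
  have h1 := level_eq_one hab
  cases y with
  | e i =>
    simp [tensorRep', comul', evalRep', comulGen, deltaGen, evalGen, deltaE, h1,
      matE_eq_smul P ((a : K) * u), matE_eq_smul P ((a : K) * v), Matrix.smul_kronecker]
  | f i =>
    simp [tensorRep', comul', evalRep', comulGen, deltaGen, evalGen, deltaF, h1,
      matF_eq_smul P ((b : K) * (u : K)⁻¹), matF_eq_smul P ((b : K) * (v : K)⁻¹),
      Matrix.smul_kronecker, add_comm]
  | _ => simp [tensorRep', comul', evalRep', comulGen, deltaGen, evalGen, h1]

theorem Rhat_tensorRep' {p q : K} (hp : p ^ 2 = P.r) (hq : q ^ 2 = P.s) (hn : 3 ≤ n) {a b : Kˣ}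
    (hab : (a : K) * b = (P.r * P.s)⁻¹) (u v : Kˣ) (x : UAff' P n) :
    Rhat P p q n ((u : K) / v) * tensorRep' P hn a b u v x =
      tensorRep' P hn a b v u x * Rhat P p q n ((u : K) / v) := by
  refine intertwine_of_generators (RingQuot.mkAlgHom_surjective K _) _ _ _ (fun y => ?_) x
  have hu := u.ne_zero
  have hv := v.ne_zero
  change _ * tensorRep' P hn a b u v (gen' P y) = tensorRep' P hn a b v u (gen' P y) * _
  rw [tensorRep'_gen' P hn hab, tensorRep'_gen' P hn hab]
  exact Rhat_deltaGen P hp hq hn (by field_simp) (by field_simp) y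

end Maps

end TwoParam
end

noncomputable section

namespace TwoParam

/-! ### Part (a) for indeterminate spectral parameters. -/

section Loop

open Matrix

variable {K : Type*} [Field K] [Algebra ℂ K] (P : Params K) {n : ℕ}

/-- The endomorphisms of `K[u, u⁻¹] ⊗ K[v, v⁻¹]`. -/
abbrev LL (K : Type*) [Field K] : Type _ := K[T;T⁻¹] ⊗[K] K[T;T⁻¹]

/-- The inclusion of the summand of `V(u) ⊗ V(v)` with index `x`. -/
def inc (K : Type*) [Field K] {n : ℕ} (x : Fin (2 * n) × Fin (2 * n)) :
    LL K →ₗ[K] LoopSpace K n ⊗[K] LoopSpace K n :=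
  TensorProduct.map (LinearMap.single K (fun _ => K[T;T⁻¹]) x.1)
    (LinearMap.single K (fun _ => K[T;T⁻¹]) x.2)

/-- The projection to the summand of `V(u) ⊗ V(v)` with index `x`. -/
def prj (K : Type*) [Field K] {n : ℕ} (x : Fin (2 * n) × Fin (2 * n)) :
    LoopSpace K n ⊗[K] LoopSpace K n →ₗ[K] LL K :=
  TensorProduct.map (LinearMap.proj x.1) (LinearMap.proj x.2)

set_option linter.unusedSectionVars false

theorem comp_fsum {ι M₁ M₂ M₃ : Type*} [AddCommMonoid M₁] [AddCommMonoid M₂] [AddCommMonoid M₃]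
    [Module K M₁] [Module K M₂] [Module K M₃] (s : Finset ι) (g : M₂ →ₗ[K] M₃)
    (f : ι → M₁ →ₗ[K] M₂) : g ∘ₗ (∑ i ∈ s, f i) = ∑ i ∈ s, g ∘ₗ f i := by
  refine LinearMap.ext fun x => ?_
  simp only [LinearMap.comp_apply, LinearMap.sum_apply, map_sum]

theorem fsum_comp {ι M₁ M₂ M₃ : Type*} [AddCommMonoid M₁] [AddCommMonoid M₂] [AddCommMonoid M₃]
    [Module K M₁] [Module K M₂] [Module K M₃] (s : Finset ι) (g : ι → M₂ →ₗ[K] M₃)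
    (f : M₁ →ₗ[K] M₂) : (∑ i ∈ s, g i) ∘ₗ f = ∑ i ∈ s, g i ∘ₗ f := by
  refine LinearMap.ext fun x => ?_
  simp only [LinearMap.comp_apply, LinearMap.sum_apply]

theorem prj_inc (x y : Fin (2 * n) × Fin (2 * n)) :
    prj K x ∘ₗ inc K y = if x = y then LinearMap.id else 0 := by
  rw [prj, inc, ← TensorProduct.map_comp]
  obtain ⟨x1, x2⟩ := x
  obtain ⟨y1, y2⟩ := y
  by_cases h1 : x1 = y1
  · by_cases h2 : x2 = y2
    · subst h1 h2
      simp only [if_true, LinearMap.proj_comp_single_same, TensorProduct.map_id]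
    · rw [LinearMap.proj_comp_single_ne K _ x2 y2 h2, TensorProduct.map_zero_right,
        if_neg (by simp [h2])]
  · rw [LinearMap.proj_comp_single_ne K _ x1 y1 h1, TensorProduct.map_zero_left,
      if_neg (by simp [h1])]

theorem sum_inc_prj : ∑ x, inc K x ∘ₗ prj K x =
    (LinearMap.id : LoopSpace K n ⊗[K] LoopSpace K n →ₗ[K] _) := by
  refine TensorProduct.ext' fun f g => ?_
  simp only [LinearMap.sum_apply, LinearMap.comp_apply, prj, inc, TensorProduct.map_tmul,
    LinearMap.proj_apply, LinearMap.id_apply, Fintype.sum_prod_type, LinearMap.single_apply,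
    ← TensorProduct.tmul_sum, ← TensorProduct.sum_tmul, Finset.univ_sum_single]

/-- V(u) ⊗ V(v) is the direct sum of (2n)² copies of K[u,u⁻¹] ⊗ K[v,v⁻¹], so an operator is the
matrix of its blocks, although the blocks are only K-linear. -/
theorem loop_ext {S T : Module.End K (LoopSpace K n ⊗[K] LoopSpace K n)}
    (h : ∀ x y, prj K x ∘ₗ S ∘ₗ inc K y = prj K x ∘ₗ T ∘ₗ inc K y) : S = T := by
  have key : ∀ S : Module.End K (LoopSpace K n ⊗[K] LoopSpace K n),
      S = ∑ x, ∑ y, inc K x ∘ₗ (prj K x ∘ₗ S ∘ₗ inc K y) ∘ₗ prj K y := by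
    intro S
    conv_lhs => rw [← LinearMap.id_comp S, ← LinearMap.comp_id S, ← sum_inc_prj]
    simp only [comp_fsum, fsum_comp, LinearMap.comp_assoc]
    exact Finset.sum_comm
  rw [key S, key T]
  simp only [h]

theorem block_mul (S T : Module.End K (LoopSpace K n ⊗[K] LoopSpace K n))
    (x y : Fin (2 * n) × Fin (2 * n)) :
    prj K x ∘ₗ (S ∘ₗ T) ∘ₗ inc K y =
      ∑ w, (prj K x ∘ₗ S ∘ₗ inc K w) ∘ₗ (prj K w ∘ₗ T ∘ₗ inc K y) := by
  conv_lhs => rw [← LinearMap.id_comp T, ← sum_inc_prj]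
  simp only [comp_fsum, fsum_comp, LinearMap.comp_assoc]

theorem block_sum (F : Fin (2 * n) × Fin (2 * n) → Fin (2 * n) × Fin (2 * n) → LL K →ₗ[K] LL K)
    (x y : Fin (2 * n) × Fin (2 * n)) :
    prj K x ∘ₗ (∑ x, ∑ y, inc K x ∘ₗ F x y ∘ₗ prj K y) ∘ₗ inc K y = F x y := by
  have h : ∀ w z, prj K x ∘ₗ (inc K w ∘ₗ F w z ∘ₗ prj K z) ∘ₗ inc K y =
      if x = w then (if z = y then F w z else 0) else 0 := by
    intro w z
    rw [show prj K x ∘ₗ (inc K w ∘ₗ F w z ∘ₗ prj K z) ∘ₗ inc K y =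
      (prj K x ∘ₗ inc K w) ∘ₗ F w z ∘ₗ (prj K z ∘ₗ inc K y) from rfl, prj_inc, prj_inc]
    split_ifs <;> simp
  simp only [comp_fsum, fsum_comp, h]
  simp

theorem block_RhatLoop (p q : K) (x y : Fin (2 * n) × Fin (2 * n)) :
    prj K x ∘ₗ RhatLoop P p q n ∘ₗ inc K y =
      (TensorProduct.comm K K[T;T⁻¹] K[T;T⁻¹]).toLinearMap ∘ₗ LinearMap.mulLeft K
        (Rhat P p q n ((LaurentPolynomial.T 1 : K[T;T⁻¹]) ⊗ₜ[K]
          (LaurentPolynomial.T (-1) : K[T;T⁻¹])) x y) :=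
  block_sum (fun x y => (TensorProduct.comm K K[T;T⁻¹] K[T;T⁻¹]).toLinearMap ∘ₗ
    LinearMap.mulLeft K (Rhat P p q n ((LaurentPolynomial.T 1 : K[T;T⁻¹]) ⊗ₜ[K]
          (LaurentPolynomial.T (-1) : K[T;T⁻¹])) x y)) x y

theorem commAlg_apply (a : LL K) : TensorProduct.comm K K[T;T⁻¹] K[T;T⁻¹] a =
    Algebra.TensorProduct.comm K K[T;T⁻¹] K[T;T⁻¹] a := rfl

/-- The blocks of R̂ are multiplications followed by the exchange of variables. Moving that exchange
past multiplication by f turns f into its image under the exchange, which explains the twist on one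
side of the matrix identity. -/
theorem RhatLoop_intertwine (p q : K) {S : Module.End K (LoopSpace K n ⊗[K] LoopSpace K n)}
    {X : Matrix (Fin (2 * n) × Fin (2 * n)) (Fin (2 * n) × Fin (2 * n)) (LL K)}
    (hS : ∀ x y, prj K x ∘ₗ S ∘ₗ inc K y = LinearMap.mulLeft K (X x y))
    (hX : Rhat P p q n ((LaurentPolynomial.T 1 : K[T;T⁻¹]) ⊗ₜ[K]
        (LaurentPolynomial.T (-1) : K[T;T⁻¹])) * X =
      X.map (Algebra.TensorProduct.comm K K[T;T⁻¹] K[T;T⁻¹]) *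
        Rhat P p q n ((LaurentPolynomial.T 1 : K[T;T⁻¹]) ⊗ₜ[K]
          (LaurentPolynomial.T (-1) : K[T;T⁻¹]))) :
    RhatLoop P p q n ∘ₗ S = S ∘ₗ RhatLoop P p q n := by
  refine loop_ext fun x y => ?_
  rw [block_mul, block_mul]
  simp only [hS, block_RhatLoop]
  refine LinearMap.ext fun a => ?_
  have hxy := congrFun (congrFun hX x) y
  simp only [Matrix.mul_apply, Matrix.map_apply] at hxy
  simp only [LinearMap.sum_apply, LinearMap.comp_apply, LinearMap.mulLeft_apply,
    LinearEquiv.coe_coe, commAlg_apply, map_mul, ← mul_assoc]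
  rw [← Finset.sum_mul, ← Finset.sum_mul]
  congr 1
  have h2 := congrArg (Algebra.TensorProduct.comm K K[T;T⁻¹] K[T;T⁻¹]) hxy
  simp only [map_sum, map_mul] at h2
  rw [h2]
  refine Finset.sum_congr rfl fun w _ => ?_
  congr 1
  -- What remains is that exchanging the two variables twice is the identity.
  generalize X x w = t
  induction t using TensorProduct.induction_on with
  | zero => simp
  | tmul a b => simp
  | add a b ha hb => simp only [map_add, ha, hb]

theorem loopMat_single (M : Matrix (Fin (2 * n)) (Fin (2 * n)) K[T;T⁻¹]) (i j : Fin (2 * n)) :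
    LinearMap.proj i ∘ₗ loopMat K n M ∘ₗ LinearMap.single K (fun _ => K[T;T⁻¹]) j =
      LinearMap.mulLeft K (M i j) := by
  refine LinearMap.ext fun f => ?_
  change (M.mulVec (Pi.single j f)) i = M i j * f
  rw [Matrix.mulVec_single]
  simp

theorem block_map (F G : Module.End K (LoopSpace K n)) (x y : Fin (2 * n) × Fin (2 * n)) :
    prj K x ∘ₗ TensorProduct.map F G ∘ₗ inc K y =
      TensorProduct.map (LinearMap.proj x.1 ∘ₗ F ∘ₗ LinearMap.single K (fun _ => K[T;T⁻¹]) y.1)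
        (LinearMap.proj x.2 ∘ₗ G ∘ₗ LinearMap.single K (fun _ => K[T;T⁻¹]) y.2) := by
  simp only [prj, inc, ← TensorProduct.map_comp]

theorem block_loopMat (M N : Matrix (Fin (2 * n)) (Fin (2 * n)) K[T;T⁻¹])
    (x y : Fin (2 * n) × Fin (2 * n)) :
    prj K x ∘ₗ TensorProduct.map (loopMat K n M) (loopMat K n N) ∘ₗ inc K y =
      LinearMap.mulLeft K ((M.map (Algebra.TensorProduct.includeLeft : K[T;T⁻¹] →ₐ[K] LL K) ⊗ₖ
        N.map (Algebra.TensorProduct.includeRight : K[T;T⁻¹] →ₐ[K] LL K)) x y) := by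
  rw [block_map, loopMat_single, loopMat_single]
  refine TensorProduct.ext' fun f g => ?_
  simp

/-- A generator of U' acts by a matrix over K[u,u⁻¹] ⊗ K[v,v⁻¹], where u and v are T ⊗ 1 and 1 ⊗ T.
The identities valid over any K-algebra thereby become available. -/
theorem tensorRep_gen_inl (hn : 3 ≤ n) {a b : Kˣ} (hab : (a : K) * b = (P.r * P.s)⁻¹)
    (y : Gen n) (x w : Fin (2 * n) × Fin (2 * n)) :
    prj K x ∘ₗ tensorRep P hn a b (gen P (.inl y)) ∘ₗ inc K w =
      LinearMap.mulLeft K (deltaGen P n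
        (((a : K) • (LaurentPolynomial.T 1 : K[T;T⁻¹])) ⊗ₜ[K] (1 : K[T;T⁻¹]))
        ((1 : K[T;T⁻¹]) ⊗ₜ[K] ((a : K) • (LaurentPolynomial.T 1 : K[T;T⁻¹])))
        (((b : K) • (LaurentPolynomial.T (-1) : K[T;T⁻¹])) ⊗ₜ[K] (1 : K[T;T⁻¹]))
        ((1 : K[T;T⁻¹]) ⊗ₜ[K] ((b : K) • (LaurentPolynomial.T (-1) : K[T;T⁻¹]))) y x w) := by
  have h1 := level_eq_one hab
  have hone : (1 : Module.End K (LoopSpace K n)) = loopMat K n 1 := (map_one _).symm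
  have hL : ∀ α : K[T;T⁻¹], (Algebra.TensorProduct.includeLeft : K[T;T⁻¹] →ₐ[K] LL K) α =
    α ⊗ₜ 1 := fun _ => rfl
  have hR : ∀ α : K[T;T⁻¹], (Algebra.TensorProduct.includeRight : K[T;T⁻¹] →ₐ[K] LL K) α =
    1 ⊗ₜ α := fun _ => rfl
  have hadd : ∀ f g : LL K, LinearMap.mulLeft K (f + g) =
    LinearMap.mulLeft K f + LinearMap.mulLeft K g := fun f g => by ext; simp [add_mul]
  have key : ∀ z, tensorRep P hn a b z = Module.endTensorEndAlgHom
    (Algebra.TensorProduct.map (evalRep P hn a b) (evalRep P hn a b) (comul P n hn z)) :=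
    fun _ => rfl
  have key2 : ∀ F G : Module.End K (LoopSpace K n),
    (Module.endTensorEndAlgHom (R := K) (S := K) (A := K) (M := LoopSpace K n)
      (N := LoopSpace K n)) (F ⊗ₜ[K] G) = TensorProduct.map F G :=
    fun _ _ => rfl
  rw [key]
  cases y with
  | e i =>
    simp only [comul, lift_gen, comulGenFull, comulGen, map_add, Algebra.TensorProduct.map_tmul,
      map_one]
    simp only [evalRep, lift_gen, loopGen, hone, key2, LinearMap.add_comp, LinearMap.comp_add, block_loopMat,
      ← hadd, ← Matrix.add_apply, evalGen, h1, deltaGen, deltaE, matE_map, dg_map, hL, hR]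
    rw [matE_eq_smul P (_ ⊗ₜ[K] _), matE_eq_smul P ((1 : K[T;T⁻¹]) ⊗ₜ[K] _),
      Matrix.smul_kronecker, Matrix.kronecker_smul, Matrix.map_one _ (map_zero _) (map_one _)]
  | f i =>
    simp only [comul, lift_gen, comulGenFull, comulGen, map_add, Algebra.TensorProduct.map_tmul,
      map_one]
    simp only [evalRep, lift_gen, loopGen, hone, key2, LinearMap.add_comp, LinearMap.comp_add, block_loopMat,
      ← hadd, ← Matrix.add_apply, evalGen, h1, deltaGen, deltaF, matF_map, dg_map, hL, hR]
    rw [matF_eq_smul P (_ ⊗ₜ[K] (1 : K[T;T⁻¹])), matF_eq_smul P ((1 : K[T;T⁻¹]) ⊗ₜ[K] _),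
      Matrix.smul_kronecker, Matrix.kronecker_smul, Matrix.map_one _ (map_zero _) (map_one _),
      add_comm]
  | w i | w' i | wi i | w'i i =>
    simp only [comul, lift_gen, comulGenFull, comulGen, Algebra.TensorProduct.map_tmul,
      evalRep, loopGen, key2, block_loopMat, evalGen, h1, deltaGen, dg_map]
  | g | g' | gi | g'i =>
    simp only [comul, lift_gen, comulGenFull, comulGen, Algebra.TensorProduct.map_tmul,
      evalRep, loopGen, key2, block_loopMat, evalGen, h1, deltaGen, one_smul, inv_one]
    rw [Matrix.map_one _ (map_zero _) (map_one _), Matrix.map_one _ (map_zero _) (map_one _),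
      Matrix.one_kronecker_one]

/-- The degree operator substitutes tu for u and tv for v, which fixes u/v and with it every entry
of R̂(u/v). -/
theorem RhatLoop_degOp (p q : K) (t : Kˣ) :
    RhatLoop P p q n ∘ₗ TensorProduct.map (degOp n t) (degOp n t) =
      TensorProduct.map (degOp n t) (degOp n t) ∘ₗ RhatLoop P p q n := by
  have hdeg : ∀ i j : Fin (2 * n), LinearMap.proj i ∘ₗ degOp n t ∘ₗ
      LinearMap.single K (fun _ => K[T;T⁻¹]) j =
      if i = j then (scale t).toLinearMap else 0 := by
    intro i j
    refine LinearMap.ext fun f => ?_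
    change scale t ((Pi.single j f : Fin (2 * n) → K[T;T⁻¹]) i) = _
    by_cases h : i = j
    · subst h; simp
    · simp [h]
  have hb : ∀ x y : Fin (2 * n) × Fin (2 * n),
      prj K x ∘ₗ TensorProduct.map (degOp n t) (degOp n t) ∘ₗ inc K y =
      if x = y then TensorProduct.map (scale t).toLinearMap (scale t).toLinearMap else 0 := by
    intro x y
    obtain ⟨x1, x2⟩ := x
    obtain ⟨y1, y2⟩ := y
    simp only [block_map, hdeg, Prod.mk.injEq]
    by_cases h1 : x1 = y1 <;> by_cases h2 : x2 = y2 <;> simp [h1, h2]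
  refine loop_ext fun x y => ?_
  rw [block_mul, block_mul, Finset.sum_eq_single y, Finset.sum_eq_single x, hb, hb, if_pos rfl,
    if_pos rfl, block_RhatLoop]
  · set z := (LaurentPolynomial.T 1 : K[T;T⁻¹]) ⊗ₜ[K] (LaurentPolynomial.T (-1) : K[T;T⁻¹]) with hz
    have hφ : Algebra.TensorProduct.map (scale t) (scale t) z = z := by
      rw [hz, Algebra.TensorProduct.map_tmul, scale_T, scale_T, TensorProduct.smul_tmul_smul,
        ← Units.val_mul, ← _root_.zpow_add]
      simp
    have hR := congrFun (congrFun (Rhat_map P (Algebra.TensorProduct.map (scale t) (scale t)) p q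
      (n := n) z) x) y
    rw [hφ, Matrix.map_apply] at hR
    have hS : ∀ a : LL K, TensorProduct.map (scale t).toLinearMap (scale t).toLinearMap a =
      Algebra.TensorProduct.map (scale t) (scale t) a := fun _ => rfl
    refine LinearMap.ext fun a => ?_
    have hcomm : ∀ a : LL K, Algebra.TensorProduct.map (scale t) (scale t)
        (TensorProduct.comm K K[T;T⁻¹] K[T;T⁻¹] a) =
        TensorProduct.comm K K[T;T⁻¹] K[T;T⁻¹]
          (Algebra.TensorProduct.map (scale t) (scale t) a) := by
      intro a
      induction a using TensorProduct.induction_on with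
      | zero => simp
      | tmul a b => simp
      | add a b ha hb => simp only [map_add, ha, hb]
    simp only [LinearMap.comp_apply, LinearMap.mulLeft_apply, LinearEquiv.coe_coe, hS, hcomm,
      map_mul, hR]
  · intro w _ hw
    rw [hb, if_neg hw.symm, LinearMap.zero_comp]
  · simp
  · intro w _ hw
    rw [hb, if_neg hw, LinearMap.comp_zero]
  · simp

theorem RhatLoop_tensorRep {p q : K} (hp : p ^ 2 = P.r) (hq : q ^ 2 = P.s) (hn : 3 ≤ n) {a b : Kˣ}
    (hab : (a : K) * b = (P.r * P.s)⁻¹) (x : UAff P n) :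
    RhatLoop P p q n ∘ₗ tensorRep P hn a b x = tensorRep P hn a b x ∘ₗ RhatLoop P p q n := by
  refine intertwine_of_generators (RingQuot.mkAlgHom_surjective K _) (tensorRep P hn a b)
    (tensorRep P hn a b) (RhatLoop P p q n) (fun y => ?_) x
  change RhatLoop P p q n ∘ₗ tensorRep P hn a b (gen P y) =
    tensorRep P hn a b (gen P y) ∘ₗ RhatLoop P p q n
  rcases y with y | y
  · refine RhatLoop_intertwine P p q (tensorRep_gen_inl P hn hab y) ?_
    have hT : (LaurentPolynomial.T 1 : K[T;T⁻¹]) * LaurentPolynomial.T (-1) = 1 := by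
      rw [← LaurentPolynomial.T_add]; simp
    -- The exchange of variables interchanges au with av and bu⁻¹ with bv⁻¹, so the twisted matrix
    -- is the one that acts on the target.
    have hm := deltaGen_map P (Algebra.TensorProduct.comm K K[T;T⁻¹] K[T;T⁻¹]).toAlgHom
      (((a : K) • (LaurentPolynomial.T 1 : K[T;T⁻¹])) ⊗ₜ[K] (1 : K[T;T⁻¹]))
      ((1 : K[T;T⁻¹]) ⊗ₜ[K] ((a : K) • (LaurentPolynomial.T 1 : K[T;T⁻¹])))
      (((b : K) • (LaurentPolynomial.T (-1) : K[T;T⁻¹])) ⊗ₜ[K] (1 : K[T;T⁻¹]))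
      ((1 : K[T;T⁻¹]) ⊗ₜ[K] ((b : K) • (LaurentPolynomial.T (-1) : K[T;T⁻¹]))) y
    refine (Rhat_deltaGen P hp hq hn ?_ ?_ y).trans (congrArg (· * _) hm.symm)
    · rw [Algebra.TensorProduct.tmul_mul_tmul, one_mul, smul_mul_assoc, hT, TensorProduct.smul_tmul]
    · rw [Algebra.TensorProduct.tmul_mul_tmul, one_mul, smul_mul_assoc, mul_comm, hT,
        TensorProduct.smul_tmul]
  · have key : ∀ (y : DegGen) (F : Module.End K (LoopSpace K n)),
        loopGen P n a b (.inr y) = F →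
        tensorRep P hn a b (gen P (.inr y)) = TensorProduct.map F F := by
      rintro y F rfl
      change Module.endTensorEndAlgHom (Algebra.TensorProduct.map (evalRep P hn a b)
        (evalRep P hn a b) (comul P n hn (gen P (.inr y)))) = _
      simp only [comul, lift_gen, comulGenFull, Algebra.TensorProduct.map_tmul, evalRep]
      rfl
    cases y
    all_goals
      rw [key _ _ rfl]
      exact RhatLoop_degOp P p q _

end Loop

end TwoParam
end

noncomputable section

namespace TwoParam

/-! ### A matrix over K[t] vanishes if its specializations at t = 0 are forced to vanish. -/

section Descent

open Polynomial

/-- A matrix over `K[t]` vanishes as soon as, for the matrices `M` over `K` which inherit its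
intertwining relations at `t = 0`, vanishing on the given vectors implies `M = 0`. -/
theorem eq_zero_of_specialization {K m : Type*} [Field K] [Fintype m] [DecidableEq m]
    (D : Matrix m m K[X]) (V : Set (m → K))
    (hV : ∀ v ∈ V, D.mulVec (fun i => C (v i)) = 0)
    (h : ∀ M : Matrix m m K, (∀ X Y : Matrix m m K[X], D * X = Y * D →
      M * X.map (evalRingHom 0) = Y.map (evalRingHom 0) * M) →
      (∀ v ∈ V, M.mulVec v = 0) → M = 0) : D = 0 := by
  -- D is divisible by every power of t. If D = t^k D', then D' inherits the relations and the
  -- vanishing of D because K[t] has no zero divisors. Its value at t = 0 is then zero by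
  -- hypothesis, which supplies one more factor t.
  have key : ∀ k : ℕ, ∃ D' : Matrix m m K[X], D = (X : K[X]) ^ k • D' := by
    intro k
    induction k with
    | zero => exact ⟨D, by simp⟩
    | succ k ih =>
      obtain ⟨D', hD⟩ := ih
      have hk : (X : K[X]) ^ k ≠ 0 := pow_ne_zero _ X_ne_zero
      have h0 : D'.map (evalRingHom (0 : K)) = 0 := by
        refine h _ (fun Y Z hYZ => ?_) fun v hv => ?_
        · have h1 : D' * Y = Z * D' := by
            rw [hD, Matrix.smul_mul, Matrix.mul_smul] at hYZ
            exact smul_right_injective _ hk hYZ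
          rw [← Matrix.map_mul, ← Matrix.map_mul, h1]
        · have h1 : D'.mulVec (fun i => C (v i)) = 0 := by
            have := hV v hv
            rw [hD, Matrix.smul_mulVec] at this
            exact (smul_eq_zero_iff_right hk).1 this
          funext i
          have h2 := congrArg (evalRingHom (0 : K)) (congrFun h1 i)
          simpa [Matrix.mulVec, dotProduct, eval_finsetSum] using h2
      have h1 : ∀ i j, (X : K[X]) ∣ D' i j := fun i j => by
        rw [X_dvd_iff, coeff_zero_eq_eval_zero]
        exact congrFun (congrFun h0 i) j
      choose F hF using h1
      refine ⟨Matrix.of F, ?_⟩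
      rw [hD]
      ext1 i j
      simp [hF i j, pow_succ, mul_assoc]
  ext1 i j
  refine Polynomial.ext fun d => ?_
  obtain ⟨D', hD⟩ := key (d + 1)
  rw [hD, Matrix.smul_apply, smul_eq_mul, Matrix.zero_apply, coeff_zero]
  exact X_pow_dvd_iff.1 (dvd_mul_right _ _) d (Nat.lt_succ_self d)

end Descent

/-! ### Threefold tensors and coproducts. -/

section Triple

set_option linter.unusedSectionVars false

open Matrix

variable {ι A : Type*} [Fintype ι] [DecidableEq ι] [CommRing A]

/-- The tensor `a ⊗ b ⊗ c`. -/
def tens (a b c : ι → A) : ι × ι × ι → A := fun z => a z.1 * (b z.2.1 * c z.2.2)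

theorem kron_tens (M N L : Matrix ι ι A) (a b c : ι → A) :
    (M ⊗ₖ (N ⊗ₖ L)) *ᵥ tens a b c = tens (M *ᵥ a) (N *ᵥ b) (L *ᵥ c) := by
  funext ⟨i, j, k⟩
  simp only [tens, mulVec, dotProduct, Fintype.sum_prod_type, kroneckerMap_apply]
  rw [Finset.sum_mul_sum, Finset.sum_mul]
  refine Finset.sum_congr rfl fun _ _ => ?_
  rw [Finset.mul_sum]
  refine Finset.sum_congr rfl fun _ _ => ?_
  rw [Finset.mul_sum]
  exact Finset.sum_congr rfl fun _ _ => by ring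

theorem tens_smul_left (k : A) (a b c : ι → A) : tens (k • a) b c = k • tens a b c := by
  funext z; simp [tens, mul_assoc]

theorem tens_smul_mid (k : A) (a b c : ι → A) : tens a (k • b) c = k • tens a b c := by
  funext z; simp [tens, mul_left_comm, mul_assoc]

theorem tens_smul_right (k : A) (a b c : ι → A) : tens a b (k • c) = k • tens a b c := by
  funext z; simp [tens, mul_left_comm]

theorem tens_zero_left (b c : ι → A) : tens 0 b c = 0 := by
  funext z; simp [tens]

theorem tens_zero_mid (a c : ι → A) : tens a 0 c = 0 := by
  funext z; simp [tens]

/-- The standard basis of `V`. -/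
def stdv (A : Type*) [CommRing A] {ι : Type*} [DecidableEq ι] (j : ι) : ι → A := Pi.single j 1

theorem diagonal_stdv (d : ι → A) (j : ι) : diagonal d *ᵥ stdv A j = d j • stdv A j := by
  funext k
  rw [mulVec_diagonal]
  by_cases h : k = j
  · subst h; simp [stdv]
  · simp [stdv, h]

theorem sum_smul_stdv (a : ι → A) : a = ∑ j, a j • stdv A j := by
  funext k
  simp [stdv, Pi.single_apply]

theorem tens_sum_left {κ : Type*} (s : Finset κ) (a : κ → ι → A) (b c : ι → A) :
    tens (∑ j ∈ s, a j) b c = ∑ j ∈ s, tens (a j) b c := by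
  funext z; simp [tens, Finset.sum_mul, Finset.sum_apply]

theorem tens_sum_right {κ : Type*} (s : Finset κ) (a b : ι → A) (c : κ → ι → A) :
    tens a b (∑ j ∈ s, c j) = ∑ j ∈ s, tens a b (c j) := by
  funext z; simp [tens, Finset.mul_sum, Finset.sum_apply]

/-- Three-fold coproduct of `e`. -/
def triE (g D : Matrix ι ι A) (k₁ k₂ k₃ : A) : Matrix (ι × ι × ι) (ι × ι × ι) A :=
  k₁ • (g ⊗ₖ ((1 : Matrix ι ι A) ⊗ₖ (1 : Matrix ι ι A))) + k₂ • (D ⊗ₖ (g ⊗ₖ (1 : Matrix ι ι A)))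
    + k₃ • (D ⊗ₖ (D ⊗ₖ g))

/-- Three-fold coproduct of `f`. -/
def triF (g D : Matrix ι ι A) (k₁ k₂ k₃ : A) : Matrix (ι × ι × ι) (ι × ι × ι) A :=
  k₁ • (g ⊗ₖ (D ⊗ₖ D)) + k₂ • ((1 : Matrix ι ι A) ⊗ₖ (g ⊗ₖ D))
    + k₃ • ((1 : Matrix ι ι A) ⊗ₖ ((1 : Matrix ι ι A) ⊗ₖ g))

theorem triE_tens (g D : Matrix ι ι A) (k₁ k₂ k₃ : A) (a b c : ι → A) :
    triE g D k₁ k₂ k₃ *ᵥ tens a b c = k₁ • tens (g *ᵥ a) b c + k₂ • tens (D *ᵥ a) (g *ᵥ b) c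
      + k₃ • tens (D *ᵥ a) (D *ᵥ b) (g *ᵥ c) := by
  simp only [triE, add_mulVec, smul_mulVec, kron_tens, one_mulVec]

theorem triF_tens (g D : Matrix ι ι A) (k₁ k₂ k₃ : A) (a b c : ι → A) :
    triF g D k₁ k₂ k₃ *ᵥ tens a b c = k₁ • tens (g *ᵥ a) (D *ᵥ b) (D *ᵥ c)
      + k₂ • tens a (g *ᵥ b) (D *ᵥ c) + k₃ • tens a b (g *ᵥ c) := by
  simp only [triF, add_mulVec, smul_mulVec, kron_tens, one_mulVec]

end Triple

/-! ### Moving vectors inside a subspace stable under threefold coproducts. -/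

section Cyclic

open Matrix

variable {ι K : Type*} [Fintype ι] [DecidableEq ι] [Field K]

/-- `g` maps `v_j` to a nonzero multiple of `v_k` and kills `v_k`; the weights `d` of `v_j` and
`v_k` are not opposite. -/
def Arrow (g : Matrix ι ι K) (d : ι → K) (j k : ι) : Prop :=
  ∃ x : K, x ≠ 0 ∧ g *ᵥ stdv K j = x • stdv K k ∧ g *ᵥ stdv K k = 0 ∧ d j + d k ≠ 0

theorem diagonal_inv_mulVec {d : ι → K} (hd : ∀ j, d j ≠ 0) (c : ι → K) :
    diagonal d *ᵥ (diagonal (fun j => (d j)⁻¹) *ᵥ c) = c := by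
  funext k
  rw [mulVec_diagonal, mulVec_diagonal, mul_inv_cancel_left₀ (hd k)]

theorem diagonal_mul_inv {d : ι → K} (hd : ∀ j, d j ≠ 0) :
    diagonal d * diagonal (fun j => (d j)⁻¹) = 1 := by
  rw [diagonal_mul_diagonal, ← diagonal_one]
  congr 1
  funext k
  exact mul_inv_cancel₀ (hd k)

variable {N : Submodule K (ι × ι × ι → K)} {g : Matrix ι ι K} {d : ι → K}

/-- Replacing c by D⁻¹c cancels the weight on the third factor, and the term with g on that factor
lies in N by hypothesis. One application of the coproduct gives v_j ⊗ v_k + d_j v_k ⊗ v_j; a second,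
using g v_k = 0, gives x(d_j + d_k) v_k ⊗ v_k, where the scalar is nonzero. -/
theorem tens_square_step (hd : ∀ j, d j ≠ 0)
    (hN : ∀ w ∈ N, triF g (diagonal d) 1 1 1 *ᵥ w ∈ N) {j k : ι} (h : Arrow g d j k)
    (hj : ∀ c, tens (stdv K j) (stdv K j) c ∈ N) (c : ι → K) :
    tens (stdv K k) (stdv K k) c ∈ N := by
  obtain ⟨x, hx, h1, h2, h3⟩ := h
  have step : ∀ c, tens (stdv K j) (stdv K k) c + d j • tens (stdv K k) (stdv K j) c ∈ N := by
    intro c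
    have := N.sub_mem (hN _ (hj (diagonal (fun j => (d j)⁻¹) *ᵥ c)))
      (hj (g *ᵥ (diagonal (fun j => (d j)⁻¹) *ᵥ c)))
    rw [triF_tens, diagonal_inv_mulVec hd, h1, diagonal_stdv] at this
    simp only [tens_smul_left, tens_smul_mid, one_smul, add_sub_cancel_right] at this
    have := N.smul_mem x⁻¹ this
    convert this using 1
    rw [eq_inv_smul_iff₀ hx]
    module
  have := N.sub_mem (hN _ (step (diagonal (fun j => (d j)⁻¹) *ᵥ c)))
    (step (g *ᵥ (diagonal (fun j => (d j)⁻¹) *ᵥ c)))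
  rw [mulVec_add, mulVec_smul, triF_tens, triF_tens, diagonal_inv_mulVec hd, h1, h2,
    diagonal_stdv] at this
  simp only [tens_smul_left, tens_smul_mid, tens_zero_left, tens_zero_mid, one_smul, smul_zero,
    zero_add, add_zero] at this
  have := N.smul_mem (x * (d j + d k))⁻¹ this
  convert this using 1
  rw [eq_inv_smul_iff₀ (mul_ne_zero hx h3)]
  module

/-- When the outer factors are arbitrary, the terms in which g acts on them are already in N.
Subtracting them isolates the action of g on the middle factor. -/
theorem tens_mid_step (hd : ∀ j, d j ≠ 0)
    (hN : ∀ w ∈ N, triE g (diagonal d) 1 1 1 *ᵥ w ∈ N) {j k : ι} (h : Arrow g d j k)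
    (hj : ∀ a c, tens a (stdv K j) c ∈ N) (a c : ι → K) : tens a (stdv K k) c ∈ N := by
  obtain ⟨x, hx, h1, -, -⟩ := h
  have := N.sub_mem (N.sub_mem (hN _ (hj (diagonal (fun j => (d j)⁻¹) *ᵥ a) c))
    (hj (g *ᵥ (diagonal (fun j => (d j)⁻¹) *ᵥ a)) c)) (N.smul_mem (d j) (hj a (g *ᵥ c)))
  rw [triE_tens, diagonal_inv_mulVec hd, h1, diagonal_stdv] at this
  simp only [tens_smul_mid, one_smul] at this
  have := N.smul_mem x⁻¹ this
  convert this using 1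
  rw [eq_inv_smul_iff₀ hx]
  module

/-- Two of the three terms of the coproduct have 1 on the first factor and commute with a ⊗ 1 ⊗ 1;
the remaining commutator is [g, a] ⊗ D ⊗ D. Operators on the first factor alone thus yield further
such operators. -/
theorem commutator_left (hd : ∀ j, d j ≠ 0) (a : Matrix ι ι K) :
    ((g * a - a * g) * diagonal (fun j => (d j)⁻¹)) ⊗ₖ ((1 : Matrix ι ι K) ⊗ₖ (1 : Matrix ι ι K)) =
      (triF g (diagonal d) 1 1 1 * (a ⊗ₖ ((1 : Matrix ι ι K) ⊗ₖ (1 : Matrix ι ι K)))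
        - (a ⊗ₖ ((1 : Matrix ι ι K) ⊗ₖ (1 : Matrix ι ι K))) * triF g (diagonal d) 1 1 1)
      * (diagonal (fun j => (d j)⁻¹) ⊗ₖ
        (diagonal (fun j => (d j)⁻¹) ⊗ₖ diagonal (fun j => (d j)⁻¹))) := by
  simp only [triF, one_smul, add_mul, mul_add, sub_mul, ← mul_kronecker_mul, one_mul, mul_one,
    diagonal_mul_inv hd]
  rw [sub_eq_add_neg (g * a * _), add_kronecker, ← neg_mul, ← neg_one_smul K (a * g),
    smul_mul_assoc, smul_kronecker, neg_one_smul]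
  abel

/-- The counterpart on the third factor does not use that a commutes with D: both D-terms of the
first two summands are offset against 1 on the third factor. -/
theorem commutator_right (hd : ∀ j, d j ≠ 0) (a : Matrix ι ι K) :
    (1 : Matrix ι ι K) ⊗ₖ ((1 : Matrix ι ι K) ⊗ₖ
      ((g * a - a * g) * diagonal (fun j => (d j)⁻¹))) =
      (triE g (diagonal d) 1 1 1 * ((1 : Matrix ι ι K) ⊗ₖ ((1 : Matrix ι ι K) ⊗ₖ a))
        - ((1 : Matrix ι ι K) ⊗ₖ ((1 : Matrix ι ι K) ⊗ₖ a)) * triE g (diagonal d) 1 1 1)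
      * (diagonal (fun j => (d j)⁻¹) ⊗ₖ
        (diagonal (fun j => (d j)⁻¹) ⊗ₖ diagonal (fun j => (d j)⁻¹))) := by
  simp only [triE, one_smul, add_mul, mul_add, sub_mul, ← mul_kronecker_mul, one_mul, mul_one,
    diagonal_mul_inv hd]
  rw [sub_eq_add_neg (g * a * _), kronecker_add, kronecker_add, ← neg_mul, ← neg_one_smul K (a * g),
    smul_mul_assoc, kronecker_smul, kronecker_smul, neg_one_smul]
  abel

end Cyclic

/-! ### Paths through the basis of the vector representation. -/

section Chain

open Matrix

variable {n : ℕ}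

/-- The operators f_1, …, f_n lead from v_1 to every basis vector: v_1 → v_2 → … → v_n, then the
branch v_{n-1} → v_{n+1} at node n, as no arrow joins v_n to v_{n+1}, and finally v_{n+1} → … →
v_{2n} along the opposite matrix units. -/
theorem chain_induction (hn : 3 ≤ n) {Q : Fin (2 * n) → Prop} (h0 : Q (pF hn 0).rev)
    (h1 : ∀ i, 1 ≤ i → i ≤ n → Q (pF hn i) → Q (qF hn i))
    (h2 : ∀ i, 1 ≤ i → i ≤ n → Q (qF hn i).rev → Q (pF hn i).rev) (x : Fin (2 * n)) : Q x := by
  have low : ∀ k (hk : k < n), Q ⟨k, by omega⟩ := by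
    intro k
    induction k with
    | zero =>
      intro _
      convert h0 using 1
      simp [Fin.ext_iff, Fin.val_rev, pF, pI]
      omega
    | succ k ih =>
      intro hk
      have := h1 (k + 1) (by omega) (by omega)
      convert this ?_ using 1
      · simp [qF, qI, hk]
      · convert ih (by omega) using 1
        simp [pF, pI, hk]
  have high : ∀ k (hk : k < n), Q ⟨n + k, by omega⟩ := by
    intro k
    induction k with
    | zero =>
      intro _
      have hn0 : n ≠ 0 := by omega
      convert h1 n (by omega) le_rfl ?_ using 1
      · simp [qF, qI, hn0]
      · convert low (n - 2) (by omega) using 1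
        simp [Fin.ext_iff, pF, pI, hn0]
        omega
    | succ k ih =>
      intro hk
      have hne : n - (k + 1) ≠ 0 := by omega
      have hlt : n - (k + 1) < n := by omega
      convert h2 (n - (k + 1)) (by omega) (by omega) ?_ using 1
      · simp [Fin.ext_iff, Fin.val_rev, pF, pI, hne, hlt]
        omega
      · convert ih (by omega) using 1
        simp [Fin.ext_iff, Fin.val_rev, qF, qI, hne, hlt]
        omega
  by_cases hx : (x : ℕ) < n
  · exact low x hx
  · convert high (x - n) (by omega) using 1
    simp [Fin.ext_iff]
    omega

variable {K : Type*} [Field K]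

/-- The common shape of the operators `f_i`, and of the operators `e_i` after renumbering the
basis by `j ↦ j'`. -/
structure IsLowering (hn : 3 ≤ n) (b : Fin (2 * n) → Fin (2 * n))
    (g : ℕ → Matrix (Fin (2 * n)) (Fin (2 * n)) K) (d : ℕ → Fin (2 * n) → K) : Prop where
  low : ∀ i, i ≤ n → Arrow (g i) (d i) (b (pF hn i)) (b (qF hn i))
  low' : ∀ i, i ≤ n → Arrow (g i) (d i) (b (qF hn i).rev) (b (pF hn i).rev)
  kill : ∀ i, 1 ≤ i → i ≤ n → g i *ᵥ stdv K (b (pF hn 0)) = 0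
  d_ne : ∀ i, i ≤ n → ∀ j, d i j ≠ 0

/-- The start vector v is killed by every g_i with i ≥ 1, so [g_i, a] v = g_i a v: commutators
follow the finite arrows while remaining in T. The affine arrow is followed by left multiplication
with g_0 D⁻¹. -/
theorem IsLowering.cyclic {hn : 3 ≤ n} {b : Fin (2 * n) → Fin (2 * n)}
    {g : ℕ → Matrix (Fin (2 * n)) (Fin (2 * n)) K} {d : ℕ → Fin (2 * n) → K}
    (h : IsLowering hn b g d) {T : Matrix (Fin (2 * n)) (Fin (2 * n)) K → Prop}
    (hmul : ∀ a a', T a → T a' → T (a * a')) (h0 : T (g 0 * diagonal fun j => (d 0 j)⁻¹))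
    (had : ∀ i, 1 ≤ i → i ≤ n → ∀ a, T a →
      T ((g i * a - a * g i) * diagonal fun j => (d i j)⁻¹)) (x : Fin (2 * n)) :
    ∃ a, T a ∧ ∃ k : K, k ≠ 0 ∧ a *ᵥ stdv K (b (pF hn 0)) = k • stdv K (b x) := by
  set Q : Fin (2 * n) → Prop := fun x =>
    ∃ a, T a ∧ ∃ k : K, k ≠ 0 ∧ a *ᵥ stdv K (b (pF hn 0)) = k • stdv K (b x) with hQ
  have step : ∀ i, 1 ≤ i → i ≤ n → ∀ x y, Arrow (g i) (d i) (b x) (b y) → Q x → Q y := by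
    rintro i hi hin x y ⟨z, hz, h1, -, -⟩ ⟨a, ha, k, hk, h2⟩
    refine ⟨_, had i hi hin a ha, (d i (b (pF hn 0)))⁻¹ * (k * z),
      mul_ne_zero (inv_ne_zero (h.d_ne i hin _)) (mul_ne_zero hk hz), ?_⟩
    rw [← mulVec_mulVec, diagonal_stdv, mulVec_smul, sub_mulVec, ← mulVec_mulVec, ← mulVec_mulVec,
      h.kill i hi hin, mulVec_zero, sub_zero, h2, mulVec_smul, h1, smul_smul, smul_smul, mul_assoc]
  have step0 : ∀ x y, Arrow (g 0) (d 0) (b x) (b y) → Q x → Q y := by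
    rintro x y ⟨z, hz, h1, -, -⟩ ⟨a, ha, k, hk, h2⟩
    refine ⟨_, hmul _ _ h0 ha, k * ((d 0 (b x))⁻¹ * z), mul_ne_zero hk
      (mul_ne_zero (inv_ne_zero (h.d_ne 0 (Nat.zero_le _) _)) hz), ?_⟩
    rw [← mulVec_mulVec, h2, mulVec_smul, ← mulVec_mulVec, diagonal_stdv, mulVec_smul, h1,
      smul_smul, smul_smul, mul_assoc]
  have hq0 : Q (qF hn 0) := by
    obtain ⟨z, hz, h1, -, -⟩ := h.low 0 (Nat.zero_le _)
    refine ⟨_, h0, (d 0 (b (pF hn 0)))⁻¹ * z,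
      mul_ne_zero (inv_ne_zero (h.d_ne 0 (Nat.zero_le _) _)) hz, ?_⟩
    rw [← mulVec_mulVec, diagonal_stdv, mulVec_smul, h1, smul_smul]
  -- The chain starts at v_1 (up to renumbering), which is not yet known to be reached. Its only use
  -- is the step v_1 → v_2, and v_2 is reached directly by g_0.
  have hall : ∀ x, x = (pF hn 0).rev ∨ Q x := by
    refine chain_induction hn (Or.inl rfl) (fun i hi hin hx => ?_) (fun i hi hin hx => ?_)
    · rcases hx with hx | hx
      · have h1 : i = 1 := by
          have := congrArg Fin.val hx
          simp only [Fin.val_rev, pF, pI] at this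
          split_ifs at this <;> omega
        subst h1
        right
        convert hq0 using 1
        have : 1 < n := by omega
        simp [qF, qI, this]
      · exact Or.inr (step i hi hin _ _ (h.low i hin) hx)
    · rcases hx with hx | hx
      · exfalso
        have := congrArg Fin.val (Fin.rev_injective hx)
        simp only [qF, qI, pF, pI] at this
        split_ifs at this <;> omega
      · exact Or.inr (step i hi hin _ _ (h.low' i hin) hx)
  -- The second arrow of g_0, from v_{2'} to v_1, supplies the exceptional vector.
  have h1 : Q (pF hn 0).rev := by
    refine step0 _ _ (h.low' 0 (Nat.zero_le _)) ((hall _).resolve_left fun hx => ?_)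
    exact (pF_ne hn (Nat.zero_le _)).1 (Fin.rev_injective hx).symm
  exact (hall x).elim (fun hx => hx ▸ h1) id

end Chain

end TwoParam
end

noncomputable section

namespace TwoParam

/-! ### The degenerate relations generate the whole threefold tensor product. -/

section Lowering

set_option linter.unusedSectionVars false

open Matrix

variable {K : Type*} [Field K] [Algebra ℂ K] (P : Params K) {n : ℕ}

theorem twoUnit_stdv {ι A : Type*} [Fintype ι] [DecidableEq ι] [CommRing A] (bar : ι → ι)
    (p q : ι) (x y : A) (c : ι) :
    twoUnit bar p q x y *ᵥ stdv A c =
      (if c = q then x • stdv A p else 0) + (if c = bar p then y • stdv A (bar q) else 0) := by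
  funext a
  simp only [twoUnit, stdv, mulVec_single_one, col_apply, Matrix.add_apply, single_apply, Pi.add_apply,
    ite_apply, Pi.smul_apply, Pi.single_apply, Pi.zero_apply, smul_eq_mul, mul_ite, mul_one,
    mul_zero, ite_and, eq_comm (a := a), eq_comm (a := c)]
  congr 1
  · split_ifs <;> rfl
  · split_ifs <;> rfl

theorem arrow_twoUnit {p q : Fin (2 * n)} (hpq : p ≠ q) (hpq' : p ≠ q.rev) {x y : K} (hx : x ≠ 0)
    {d : Fin (2 * n) → K} (hd : d p + d q ≠ 0) : Arrow (twoUnit Fin.rev p q x y) d q p := by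
  have h1 : q ≠ p.rev := fun h => hpq' (by rw [h, Fin.rev_rev])
  refine ⟨x, hx, ?_, ?_, by rwa [add_comm]⟩
  · rw [twoUnit_stdv, if_pos rfl, if_neg h1, add_zero]
  · rw [twoUnit_stdv, if_neg hpq, if_neg (rev_ne p).symm, add_zero]

theorem twoUnit_rev {ι A : Type*} [Fintype ι] [DecidableEq ι] [CommRing A] {bar : ι → ι}
    (hb : ∀ i, bar (bar i) = i) (p q : ι) (x y : A) :
    twoUnit bar p q x y = twoUnit bar (bar q) (bar p) y x := by
  rw [twoUnit, twoUnit, hb, hb, add_comm]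

/-- The two eigenvalues are r and s, or s⁻¹ and r⁻¹, and r + s ≠ 0. This is the nonvanishing
demanded of an `Arrow`. -/
theorem wVal_add_ne (hn : 3 ≤ n) (i : ℕ) :
    wVal P n 1 i (pI n i) + wVal P n 1 i (qI n i) ≠ 0 := by
  have hr := P.r_ne_zero
  have hs := P.s_ne_zero
  have h := P.r_add_s
  rw [wVal_eq, wVal_eq, (wXY_p hn).1, (wXY_p hn).2, (wXY_q hn).1, (wXY_q hn).2]
  by_cases hi : 0 < i ∧ i < n
  · simpa [hi] using h
  · have h2 : P.s⁻¹ + P.r⁻¹ ≠ 0 := by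
      rw [inv_add_inv hs hr, add_comm]
      exact div_ne_zero h (mul_ne_zero hs hr)
    simpa [hi] using h2

theorem wVal'_add_ne (hn : 3 ≤ n) (i : ℕ) :
    wVal' P n 1 i (pI n i) + wVal' P n 1 i (qI n i) ≠ 0 := by
  have hr := P.r_ne_zero
  have hs := P.s_ne_zero
  have h := P.r_add_s
  rw [wVal'_eq, wVal'_eq, (wXY_p hn).1, (wXY_p hn).2, (wXY_q hn).1, (wXY_q hn).2]
  by_cases hi : 0 < i ∧ i < n
  · simpa [hi, add_comm] using h
  · have h2 : P.r⁻¹ + P.s⁻¹ ≠ 0 := by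
      rw [inv_add_inv hr hs]
      exact div_ne_zero h (mul_ne_zero hr hs)
    simpa [hi] using h2

/-- The second matrix unit of a generator joins the opposite indices, where the eigenvalues are
inverted. -/
theorem add_ne_zero_of_mul_eq_one {x y x' y' : K} (hx : x * x' = 1) (hy : y * y' = 1)
    (h : x + y ≠ 0) : x' + y' ≠ 0 := fun h' => h (by
  linear_combination x * y * h' - y * hx - x * hy)

/-- The eigenvalues of `ω_i`. -/
def wFin (n : ℕ) (i : ℕ) (j : Fin (2 * n)) : K := wVal P n 1 i ((j : ℕ) + 1)

/-- The eigenvalues of `ω'_i`. -/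
def wFin' (n : ℕ) (i : ℕ) (j : Fin (2 * n)) : K := wVal' P n 1 i ((j : ℕ) + 1)

theorem wFin_mul_rev (hn : 3 ≤ n) {i : ℕ} (hi : i ≤ n) (j : Fin (2 * n)) :
    wFin P n i j * wFin P n i j.rev = 1 := by
  have := wVal_mul_bar P hn hi 1 (j := (j : ℕ) + 1) (by omega) (by omega)
  rw [bar_eq_rev] at this
  simpa [wFin] using this

theorem wFin'_mul_rev (hn : 3 ≤ n) {i : ℕ} (hi : i ≤ n) (j : Fin (2 * n)) :
    wFin' P n i j * wFin' P n i j.rev = 1 := by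
  have := wVal'_mul_bar P hn hi 1 (j := (j : ℕ) + 1) (by omega) (by omega)
  rw [bar_eq_rev] at this
  simpa [wFin'] using this

theorem pF_zero_ne (hn : 3 ≤ n) {i : ℕ} (hi : 1 ≤ i) (hin : i ≤ n) :
    pF hn 0 ≠ pF hn i ∧ pF hn 0 ≠ (qF hn i).rev := by
  constructor <;> intro h <;> have := congrArg Fin.val h <;>
    simp only [Fin.val_rev, pF, qF, pI, qI] at this <;> split_ifs at this <;> omega

theorem matF_isLowering (hn : 3 ≤ n) : IsLowering hn id (matF P n (1 : K)) (wFin' P n) := by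
  have hx : ∀ i, fX (1 : K) i ≠ 0 := fun i => by unfold fX; split_ifs <;> exact one_ne_zero
  have hy : ∀ i, fY P n (1 : K) i ≠ 0 := fun i => by
    unfold fY
    split_ifs
    · exact neg_ne_zero.2 one_ne_zero
    · exact neg_ne_zero.2 (inv_ne_zero (mul_ne_zero P.r_ne_zero P.s_ne_zero))
    · exact neg_ne_zero.2 one_ne_zero
  have hd : ∀ i, wFin' P n i (qF hn i) + wFin' P n i (pF hn i) ≠ 0 := fun i => by
    have := wVal'_add_ne P hn i
    rwa [← pF_succ hn, ← qF_succ hn, add_comm] at this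
  have hm : ∀ i, matF P n (1 : K) i =
      twoUnit Fin.rev (qF hn i) (pF hn i) (fX (1 : K) i) (fY P n (1 : K) i) := fun i => by
    rw [matF_eq P hn, fForm_eq_twoUnit hn]
  refine ⟨fun i hi => ?_, fun i hi => ?_, fun i hi hin => ?_, fun i hi j => ?_⟩
  · obtain ⟨n1, n2, n3⟩ := pF_ne hn hi
    rw [hm]
    exact arrow_twoUnit n1.symm n3 (hx i) (hd i)
  · obtain ⟨n1, n2, n3⟩ := pF_ne hn hi
    rw [hm, twoUnit_rev Fin.rev_rev]
    refine arrow_twoUnit (fun h => n1 (Fin.rev_injective h)) (by rw [Fin.rev_rev]; exact n3.symm)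
      (hy i) ?_
    rw [add_comm]
    exact add_ne_zero_of_mul_eq_one (wFin'_mul_rev P hn hi _) (wFin'_mul_rev P hn hi _) (hd i)
  · obtain ⟨n1, n2⟩ := pF_zero_ne hn hi hin
    rw [hm, id, twoUnit_stdv, if_neg n1, if_neg n2, add_zero]
  · exact wVal'_ne_zero P one_ne_zero _ _

theorem matE_isLowering (hn : 3 ≤ n) : IsLowering hn Fin.rev (matE P n (1 : K)) (wFin P n) := by
  have hrs := mul_ne_zero P.r_ne_zero P.s_ne_zero
  have hx : ∀ i, eX P n (1 : K) i ≠ 0 := fun i => by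
    unfold eX
    split_ifs
    · exact one_ne_zero
    · exact one_ne_zero
    · exact inv_ne_zero hrs
  have hy : ∀ i, eY P (1 : K) i ≠ 0 := fun i => by
    unfold eY
    split_ifs
    · exact neg_ne_zero.2 (smul_ne_zero hrs one_ne_zero)
    · exact neg_ne_zero.2 one_ne_zero
  have hd : ∀ i, wFin P n i (pF hn i) + wFin P n i (qF hn i) ≠ 0 := fun i => by
    have := wVal_add_ne P hn i
    rwa [← pF_succ hn, ← qF_succ hn] at this
  have hm : ∀ i, matE P n (1 : K) i =
      twoUnit Fin.rev (pF hn i) (qF hn i) (eX P n (1 : K) i) (eY P (1 : K) i) := fun i => by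
    rw [matE_eq P hn, eForm_eq_twoUnit hn]
  refine ⟨fun i hi => ?_, fun i hi => ?_, fun i hi hin => ?_, fun i hi j => ?_⟩
  · obtain ⟨n1, n2, n3⟩ := pF_ne hn hi
    rw [hm, twoUnit_rev Fin.rev_rev]
    refine arrow_twoUnit (fun h => n1 (Fin.rev_injective h).symm)
      (by rw [Fin.rev_rev]; exact n2.symm) (hy i) ?_
    rw [add_comm]
    exact add_ne_zero_of_mul_eq_one (wFin_mul_rev P hn hi _) (wFin_mul_rev P hn hi _) (hd i)
  · obtain ⟨n1, n2, n3⟩ := pF_ne hn hi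
    rw [hm, Fin.rev_rev, Fin.rev_rev]
    exact arrow_twoUnit n1 n2 (hx i) (hd i)
  · obtain ⟨n1, n2⟩ := pF_zero_ne hn hi hin
    rw [hm, twoUnit_stdv, if_neg (fun h => n2 (by rw [← h, Fin.rev_rev])),
      if_neg (fun h => n1 (Fin.rev_injective h)), add_zero]
  · exact wVal_ne_zero P one_ne_zero _ _

theorem diagonal_tens_conj {ι : Type*} [Fintype ι] [DecidableEq ι] {d : ι → K} (hd : ∀ j, d j ≠ 0)
    (g : Matrix ι ι K) :
    (g ⊗ₖ (diagonal d ⊗ₖ diagonal d)) * (diagonal (fun j => (d j)⁻¹) ⊗ₖ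
      (diagonal (fun j => (d j)⁻¹) ⊗ₖ diagonal (fun j => (d j)⁻¹))) =
      (g * diagonal (fun j => (d j)⁻¹)) ⊗ₖ ((1 : Matrix ι ι K) ⊗ₖ (1 : Matrix ι ι K)) ∧
    (diagonal d ⊗ₖ (diagonal d ⊗ₖ g)) * (diagonal (fun j => (d j)⁻¹) ⊗ₖ
      (diagonal (fun j => (d j)⁻¹) ⊗ₖ diagonal (fun j => (d j)⁻¹))) =
      (1 : Matrix ι ι K) ⊗ₖ ((1 : Matrix ι ι K) ⊗ₖ (g * diagonal (fun j => (d j)⁻¹))) := by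
  constructor <;> simp only [← mul_kronecker_mul, diagonal_mul_inv hd]

/-- A matrix which satisfies intertwining relations with the degenerate three-fold coproducts,
and vanishes on the vectors `v_j ⊗ v_j ⊗ v_j`, is zero: these vectors generate `V ⊗ V ⊗ V`. -/
theorem eq_zero_of_degenerate_relations (hn : 3 ≤ n)
    (M : Matrix (Fin (2 * n) × Fin (2 * n) × Fin (2 * n)) (Fin (2 * n) × Fin (2 * n) × Fin (2 * n)) K)
    (hE : ∀ i, i ≤ n → ∃ Y, M * triE (matE P n (1 : K) i) (diagonal (wFin P n i))
      (kz 0 i) (kz 0 i) 1 = Y * M)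
    (hF : ∀ i, i ≤ n → ∃ Y, M * triF (matF P n (1 : K) i) (diagonal (wFin' P n i))
      1 (kz 0 i) (kz 0 i) = Y * M)
    (hW : ∀ i, i ≤ n → ∃ Y, M * (diagonal (fun j => (wFin P n i j)⁻¹) ⊗ₖ
      (diagonal (fun j => (wFin P n i j)⁻¹) ⊗ₖ diagonal (fun j => (wFin P n i j)⁻¹))) = Y * M)
    (hW' : ∀ i, i ≤ n → ∃ Y, M * (diagonal (fun j => (wFin' P n i j)⁻¹) ⊗ₖ
      (diagonal (fun j => (wFin' P n i j)⁻¹) ⊗ₖ diagonal (fun j => (wFin' P n i j)⁻¹))) = Y * M)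
    (hv : ∀ j, M *ᵥ tens (stdv K j) (stdv K j) (stdv K j) = 0) : M = 0 := by
  set N : Submodule K (Fin (2 * n) × Fin (2 * n) × Fin (2 * n) → K) :=
    LinearMap.ker M.mulVecLin with hN
  have mem : ∀ w, w ∈ N ↔ M *ᵥ w = 0 := fun w => by
    rw [hN, LinearMap.mem_ker, mulVecLin_apply]
  -- An intertwining relation makes the kernel N of M stable. It remains to show that N is
  -- everything.
  have stable : ∀ X, (∃ Y, M * X = Y * M) → ∀ w ∈ N, X *ᵥ w ∈ N := by
    rintro X ⟨Y, hY⟩ w hw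
    rw [mem] at hw ⊢
    rw [mulVec_mulVec, hY, ← mulVec_mulVec, hw, mulVec_zero]
  have hf := matF_isLowering P hn
  have he := matE_isLowering P hn
  have sF : ∀ i, 1 ≤ i → i ≤ n → ∀ w ∈ N,
      triF (matF P n (1 : K) i) (diagonal (wFin' P n i)) 1 1 1 *ᵥ w ∈ N := by
    intro i hi hin
    have := stable _ (hF i hin)
    rwa [kz, if_neg (by omega)] at this
  have sE : ∀ i, 1 ≤ i → i ≤ n → ∀ w ∈ N,
      triE (matE P n (1 : K) i) (diagonal (wFin P n i)) 1 1 1 *ᵥ w ∈ N := by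
    intro i hi hin
    have := stable _ (hE i hin)
    rwa [kz, if_neg (by omega)] at this
  -- ω_0 ⊗ ω_0 ⊗ e_0, stripped of its weights, acts on the third factor only; commutators with the
  -- e_i then give operators on that factor which take v_1 to any basis vector.
  have cycE : ∀ x : Fin (2 * n), ∃ a, (∀ w ∈ N, ((1 : Matrix (Fin (2 * n)) (Fin (2 * n)) K) ⊗ₖ
      ((1 : Matrix (Fin (2 * n)) (Fin (2 * n)) K) ⊗ₖ a)) *ᵥ w ∈ N) ∧ ∃ k : K, k ≠ 0 ∧
      a *ᵥ stdv K (pF hn 0).rev = k • stdv K x.rev := by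
    refine he.cyclic (fun a a' ha ha' w hw => ?_) (fun w hw => ?_) fun i hi hin a ha w hw => ?_
    · have := ha _ (ha' w hw)
      rwa [mulVec_mulVec, ← mul_kronecker_mul, ← mul_kronecker_mul, one_mul] at this
    · have := stable _ (hE 0 (Nat.zero_le _)) _ (stable _ (hW 0 (Nat.zero_le _)) w hw)
      rwa [kz, if_pos rfl, triE, zero_smul, zero_smul, zero_add, zero_add, one_smul, mulVec_mulVec,
        (diagonal_tens_conj (he.d_ne 0 (Nat.zero_le _)) _).2] at this
    · rw [commutator_right (he.d_ne i hin), ← mulVec_mulVec, sub_mulVec, ← mulVec_mulVec,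
        ← mulVec_mulVec]
      have h1 := stable _ (hW i hin) w hw
      exact N.sub_mem (sE i hi hin _ (ha _ h1)) (ha _ (sE i hi hin _ h1))
  -- Likewise f_0 ⊗ ω'_0 ⊗ ω'_0 and the f_i give operators on the first factor, starting from
  -- v_{2n}.
  have cycF : ∀ x : Fin (2 * n), ∃ a, (∀ w ∈ N, (a ⊗ₖ ((1 : Matrix (Fin (2 * n)) (Fin (2 * n)) K) ⊗ₖ
      (1 : Matrix (Fin (2 * n)) (Fin (2 * n)) K))) *ᵥ w ∈ N) ∧ ∃ k : K, k ≠ 0 ∧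
      a *ᵥ stdv K (pF hn 0) = k • stdv K x := by
    refine hf.cyclic (fun a a' ha ha' w hw => ?_) (fun w hw => ?_) fun i hi hin a ha w hw => ?_
    · have := ha _ (ha' w hw)
      rwa [mulVec_mulVec, ← mul_kronecker_mul, ← mul_kronecker_mul, one_mul] at this
    · have := stable _ (hF 0 (Nat.zero_le _)) _ (stable _ (hW' 0 (Nat.zero_le _)) w hw)
      rwa [kz, if_pos rfl, triF, zero_smul, zero_smul, add_zero, add_zero, one_smul, mulVec_mulVec,
        (diagonal_tens_conj (hf.d_ne 0 (Nat.zero_le _)) _).1] at this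
    · rw [commutator_left (hf.d_ne i hin), ← mulVec_mulVec, sub_mulVec, ← mulVec_mulVec,
        ← mulVec_mulVec]
      have h1 := stable _ (hW' i hin) w hw
      exact N.sub_mem (sF i hi hin _ (ha _ h1)) (ha _ (sF i hi hin _ h1))
  -- From v_1 ⊗ v_1 ⊗ v_1 the third factor is freed.
  have third : ∀ c, tens (stdv K (pF hn 0).rev) (stdv K (pF hn 0).rev) c ∈ N := by
    intro c
    rw [sum_smul_stdv c, tens_sum_right]
    refine N.sum_mem fun x _ => ?_
    obtain ⟨a, ha, k, hk, h⟩ := cycE x.rev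
    have := N.smul_mem (c x * k⁻¹) (ha _ ((mem _).2 (hv (pF hn 0).rev)))
    rw [kron_tens, one_mulVec, h, Fin.rev_rev, tens_smul_right, smul_smul,
      inv_mul_cancel_right₀ hk] at this
    rwa [tens_smul_right]
  -- The f_i carry v_1 ⊗ v_1 ⊗ c down to v_j ⊗ v_j ⊗ c for every j, in particular j = 2n.
  have square : ∀ j c, tens (stdv K j) (stdv K j) c ∈ N :=
    chain_induction hn third
      (fun i hi hin h => tens_square_step (hf.d_ne i hin) (sF i hi hin) (hf.low i hin) h)
      (fun i hi hin h => tens_square_step (hf.d_ne i hin) (sF i hi hin) (hf.low' i hin) h)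
  -- From v_{2n} ⊗ v_{2n} ⊗ c the first factor is freed.
  have first : ∀ a c, tens a (stdv K (pF hn 0)) c ∈ N := by
    intro a c
    rw [sum_smul_stdv a, tens_sum_left]
    refine N.sum_mem fun x _ => ?_
    obtain ⟨a', ha, k, hk, h⟩ := cycF x
    have := N.smul_mem (a x * k⁻¹) (ha _ (square (pF hn 0) c))
    rw [kron_tens, one_mulVec, one_mulVec, h, tens_smul_left, smul_smul,
      inv_mul_cancel_right₀ hk] at this
    rwa [tens_smul_left]
  -- The e_i raise the middle factor from v_{2n} through the whole basis.
  have all : ∀ j a c, tens a (stdv K (Fin.rev j)) c ∈ N :=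
    chain_induction hn (by rw [Fin.rev_rev]; exact first)
      (fun i hi hin h => tens_mid_step (he.d_ne i hin) (sE i hi hin) (he.low i hin) h)
      (fun i hi hin h => tens_mid_step (he.d_ne i hin) (sE i hi hin) (he.low' i hin) h)
  ext x ⟨i, j, k⟩
  have h := congrFun ((mem _).1 (all j.rev (stdv K i) (stdv K k))) x
  have h2 : tens (stdv K i) (stdv K j) (stdv K k) = Pi.single (i, j, k) 1 := by
    funext ⟨a, b, c⟩
    by_cases h1 : a = i <;> by_cases h2 : b = j <;> by_cases h3 : c = k <;>
      simp [tens, stdv, h1, h2, h3]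
  rw [Fin.rev_rev, h2, mulVec_single_one] at h
  exact h

end Lowering

end TwoParam
end

noncomputable section

namespace TwoParam

/-! ### Actions on two of three factors, over any commutative ring. -/

section Legs

open Matrix

set_option linter.unusedSectionVars false

variable {N A B : Type*} [Fintype N] [DecidableEq N] [CommRing A] [CommRing B]

/-- `M ⊗ c` on `(V ⊗ V) ⊗ V`. -/
def assoc12 (M : Matrix (N × N) (N × N) A) (c : Matrix N N A) :
    Matrix (N × N × N) (N × N × N) A :=
  Matrix.reindex (Equiv.prodAssoc N N N) (Equiv.prodAssoc N N N) (M ⊗ₖ c)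

/-- The action of `M` on the first two factors. -/
def act12 (M : Matrix (N × N) (N × N) A) : Matrix (N × N × N) (N × N × N) A :=
  assoc12 M 1

/-- The action of `M` on the last two factors. -/
def act23 (M : Matrix (N × N) (N × N) A) : Matrix (N × N × N) (N × N × N) A :=
  (1 : Matrix N N A) ⊗ₖ M

theorem assoc12_apply (M : Matrix (N × N) (N × N) A) (c : Matrix N N A) (x y : N × N × N) :
    assoc12 M c x y = M (x.1, x.2.1) (y.1, y.2.1) * c x.2.2 y.2.2 := rfl

theorem act23_apply (M : Matrix (N × N) (N × N) A) (x y : N × N × N) :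
    act23 M x y = (1 : Matrix N N A) x.1 y.1 * M x.2 y.2 := rfl

theorem assoc12_mul (M M' : Matrix (N × N) (N × N) A) (c c' : Matrix N N A) :
    assoc12 M c * assoc12 M' c' = assoc12 (M * M') (c * c') := by
  unfold assoc12
  rw [reindex_apply, reindex_apply, submatrix_mul_equiv, ← mul_kronecker_mul, reindex_apply]

theorem assoc12_kronecker (a b c : Matrix N N A) : assoc12 (a ⊗ₖ b) c = a ⊗ₖ (b ⊗ₖ c) :=
  kronecker_assoc a b c

/-- This is the grouping (Δ ⊗ 1)Δ, suited to an operator on the first two factors; `triE_eq_right`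
is the grouping (1 ⊗ Δ)Δ. -/
theorem triE_eq_left (g D : Matrix N N A) (k₁ k₂ k₃ : A) :
    triE g D k₁ k₂ k₃ = assoc12 (k₁ • (g ⊗ₖ (1 : Matrix N N A)) + k₂ • (D ⊗ₖ g)) 1
      + k₃ • assoc12 (D ⊗ₖ D) g := by
  rw [assoc12_kronecker, triE, ← assoc12_kronecker g, ← assoc12_kronecker D g]
  congr 1
  ext x y
  simp only [Matrix.add_apply, Matrix.smul_apply, assoc12_apply, smul_eq_mul]
  ring

theorem triE_eq_right (g D : Matrix N N A) (k₁ k₂ k₃ : A) :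
    triE g D k₁ k₂ k₃ = k₁ • (g ⊗ₖ ((1 : Matrix N N A) ⊗ₖ (1 : Matrix N N A)))
      + D ⊗ₖ (k₂ • (g ⊗ₖ (1 : Matrix N N A)) + k₃ • (D ⊗ₖ g)) := by
  rw [triE, kronecker_add, kronecker_smul, kronecker_smul, add_assoc]

theorem triF_eq_left (g D : Matrix N N A) (k₁ k₂ k₃ : A) :
    triF g D k₁ k₂ k₃ = assoc12 (k₁ • (g ⊗ₖ D) + k₂ • ((1 : Matrix N N A) ⊗ₖ g)) D
      + k₃ • assoc12 ((1 : Matrix N N A) ⊗ₖ (1 : Matrix N N A)) g := by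
  rw [assoc12_kronecker, triF, ← assoc12_kronecker g, ← assoc12_kronecker 1 g]
  congr 1
  ext x y
  simp only [Matrix.add_apply, Matrix.smul_apply, assoc12_apply, smul_eq_mul]
  ring

theorem triF_eq_right (g D : Matrix N N A) (k₁ k₂ k₃ : A) :
    triF g D k₁ k₂ k₃ = k₁ • (g ⊗ₖ (D ⊗ₖ D))
      + (1 : Matrix N N A) ⊗ₖ (k₂ • (g ⊗ₖ D) + k₃ • ((1 : Matrix N N A) ⊗ₖ g)) := by
  rw [triF, kronecker_add, kronecker_smul, kronecker_smul, add_assoc]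

theorem triE_map (φ : A →+* B) (g D : Matrix N N A) (k₁ k₂ k₃ : A) :
    (triE g D k₁ k₂ k₃).map φ = triE (g.map φ) (D.map φ) (φ k₁) (φ k₂) (φ k₃) := by
  ext x y
  simp [triE, Matrix.one_apply, apply_ite φ]

theorem triF_map (φ : A →+* B) (g D : Matrix N N A) (k₁ k₂ k₃ : A) :
    (triF g D k₁ k₂ k₃).map φ = triF (g.map φ) (D.map φ) (φ k₁) (φ k₂) (φ k₃) := by
  ext x y
  simp [triF, Matrix.one_apply, apply_ite φ]

theorem act12_map (φ : A →+* B) (M : Matrix (N × N) (N × N) A) :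
    (act12 M).map φ = act12 (M.map φ) := by
  ext x y
  simp [act12, assoc12_apply, Matrix.one_apply, apply_ite φ]

theorem act23_map (φ : A →+* B) (M : Matrix (N × N) (N × N) A) :
    (act23 M).map φ = act23 (M.map φ) := by
  ext x y
  simp [act23_apply, Matrix.one_apply, apply_ite φ]

theorem stdv_tens (j : N) : tens (stdv A j) (stdv A j) (stdv A j) = Pi.single (j, j, j) 1 := by
  funext ⟨a, b, c⟩
  by_cases h1 : a = j <;> by_cases h2 : b = j <;> by_cases h3 : c = j <;>
    simp [tens, stdv, h1, h2, h3]

theorem act12_stdv {R : Matrix (N × N) (N × N) A} {h : A} {j : N}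
    (hR : R *ᵥ bv A j j = h • bv A j j) :
    act12 R *ᵥ tens (stdv A j) (stdv A j) (stdv A j) =
      h • tens (stdv A j) (stdv A j) (stdv A j) := by
  rw [stdv_tens, mulVec_single_one]
  funext ⟨a, b, c⟩
  have := congrFun hR (a, b)
  rw [bv, mulVec_single_one] at this
  change R (a, b) (j, j) * (1 : Matrix N N A) c j = _
  change R (a, b) (j, j) = _ at this
  rw [this]
  by_cases h1 : a = j <;> by_cases h2 : b = j <;> by_cases h3 : c = j <;>
    simp [h1, h2, h3, Matrix.one_apply]

theorem act23_stdv {R : Matrix (N × N) (N × N) A} {h : A} {j : N}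
    (hR : R *ᵥ bv A j j = h • bv A j j) :
    act23 R *ᵥ tens (stdv A j) (stdv A j) (stdv A j) =
      h • tens (stdv A j) (stdv A j) (stdv A j) := by
  rw [stdv_tens, mulVec_single_one]
  funext ⟨a, b, c⟩
  have := congrFun hR (b, c)
  rw [bv, mulVec_single_one] at this
  change (1 : Matrix N N A) a j * R (b, c) (j, j) = _
  change R (b, c) (j, j) = _ at this
  rw [this]
  by_cases h1 : a = j <;> by_cases h2 : b = j <;> by_cases h3 : c = j <;>
    simp [h1, h2, h3, Matrix.one_apply]

end Legs

/-! ### R̂ on adjacent factors permutes the spectral parameters of a threefold product. -/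

section Intertwine

open Matrix

variable {K : Type*} [Field K] [Algebra ℂ K] {P : Params K} {A : Type*} [CommRing A] [Algebra K A]
  {n : ℕ} {p q : K}

variable (P A) in
/-- The image of `e_i` in the three-fold tensor product of evaluation modules. -/
def tripleE (n i : ℕ) (α β γ : A) :=
  triE (matE P n (1 : A) i) (dg A n (wVal P n 1 i)) (kz α i) (kz β i) (kz γ i)

variable (P A) in
/-- The image of `f_i` in the three-fold tensor product of evaluation modules. -/
def tripleF (n i : ℕ) (α β γ : A) :=
  triF (matF P n (1 : A) i) (dg A n (wVal' P n 1 i)) (kz α i) (kz β i) (kz γ i)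

variable (hp : p ^ 2 = P.r) (hq : q ^ 2 = P.s)
include hp hq

theorem Rhat_wVal (hn : 3 ≤ n) (z : A) {i : ℕ} (hi : i ≤ n) :
    Rhat P p q n z * (dg A n (wVal P n 1 i) ⊗ₖ dg A n (wVal P n 1 i)) =
      (dg A n (wVal P n 1 i) ⊗ₖ dg A n (wVal P n 1 i)) * Rhat P p q n z :=
  Rhat_dg P hp hq z (k := 1) fun j h1 h2 => by
    rw [wVal_mul_bar P hn hi 1 h1 h2]; split_ifs <;> exact one_pow 2

theorem Rhat_wVal' (hn : 3 ≤ n) (z : A) {i : ℕ} (hi : i ≤ n) :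
    Rhat P p q n z * (dg A n (wVal' P n 1 i) ⊗ₖ dg A n (wVal' P n 1 i)) =
      (dg A n (wVal' P n 1 i) ⊗ₖ dg A n (wVal' P n 1 i)) * Rhat P p q n z :=
  Rhat_dg P hp hq z (k := 1) fun j h1 h2 => by
    rw [wVal'_mul_bar P hn hi 1 h1 h2]; split_ifs <;> exact one_pow 2

/-- In the grouping Δ(e_i) ⊗ 1 + (ω_i ⊗ ω_i) ⊗ e_i, the first term is the twofold relation and the
second uses that R̂ commutes with ω_i ⊗ ω_i. -/
theorem act12_tripleE (hn : 3 ≤ n) {z α β : A} (h : α = β * z) (γ : A) {i : ℕ} (hi : i ≤ n) :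
    act12 (Rhat P p q n z) * tripleE P A n i α β γ =
      tripleE P A n i β α γ * act12 (Rhat P p q n z) := by
  have h1 := Rhat_deltaE_kz hp hq hn h hi
  simp only [deltaE] at h1
  rw [tripleE, tripleE, triE_eq_left, triE_eq_left, act12, mul_add, add_mul, Matrix.mul_smul,
    Matrix.smul_mul, assoc12_mul, assoc12_mul, assoc12_mul, assoc12_mul, h1,
    Rhat_wVal hp hq hn z hi, one_mul, one_mul, mul_one]

theorem act23_tripleE (hn : 3 ≤ n) {z β γ : A} (h : β = γ * z) (α : A) {i : ℕ} (hi : i ≤ n) :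
    act23 (Rhat P p q n z) * tripleE P A n i α β γ =
      tripleE P A n i α γ β * act23 (Rhat P p q n z) := by
  have h1 := Rhat_deltaE_kz hp hq hn h hi
  simp only [deltaE] at h1
  rw [tripleE, tripleE, triE_eq_right, triE_eq_right, act23, mul_add, add_mul, Matrix.mul_smul,
    Matrix.smul_mul, ← mul_kronecker_mul, ← mul_kronecker_mul, ← mul_kronecker_mul,
    ← mul_kronecker_mul, h1, one_kronecker_one, one_mul, one_mul, mul_one, mul_one, mul_one,
    one_mul]

theorem act12_tripleF (hn : 3 ≤ n) {z α β : A} (h : β = α * z) (γ : A) {i : ℕ} (hi : i ≤ n) :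
    act12 (Rhat P p q n z) * tripleF P A n i α β γ =
      tripleF P A n i β α γ * act12 (Rhat P p q n z) := by
  have h1 := Rhat_deltaF_kz hp hq hn h hi
  simp only [deltaF] at h1
  rw [tripleF, tripleF, triF_eq_left, triF_eq_left, act12, mul_add, add_mul, Matrix.mul_smul,
    Matrix.smul_mul, assoc12_mul, assoc12_mul, assoc12_mul, assoc12_mul, h1,
    one_kronecker_one, one_mul, one_mul, mul_one, mul_one, mul_one, one_mul]

theorem act23_tripleF (hn : 3 ≤ n) {z β γ : A} (h : γ = β * z) (α : A) {i : ℕ} (hi : i ≤ n) :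
    act23 (Rhat P p q n z) * tripleF P A n i α β γ =
      tripleF P A n i α γ β * act23 (Rhat P p q n z) := by
  have h1 := Rhat_deltaF_kz hp hq hn h hi
  simp only [deltaF] at h1
  rw [tripleF, tripleF, triF_eq_right, triF_eq_right, act23, mul_add, add_mul, Matrix.mul_smul,
    Matrix.smul_mul, ← mul_kronecker_mul, ← mul_kronecker_mul, ← mul_kronecker_mul,
    ← mul_kronecker_mul, h1, Rhat_wVal' hp hq hn z hi, one_mul, mul_one, mul_one]

theorem act12_dg (z : A) {d : ℕ → K} {k : K}
    (hd : ∀ j, 1 ≤ j → j ≤ 2 * n → d j * d (bar n j) = k) :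
    act12 (Rhat P p q n z) * (dg A n d ⊗ₖ (dg A n d ⊗ₖ dg A n d)) =
      (dg A n d ⊗ₖ (dg A n d ⊗ₖ dg A n d)) * act12 (Rhat P p q n z) := by
  rw [← assoc12_kronecker, act12, assoc12_mul, assoc12_mul, Rhat_dg P hp hq z hd, one_mul, mul_one]

theorem act23_dg (z : A) {d : ℕ → K} {k : K}
    (hd : ∀ j, 1 ≤ j → j ≤ 2 * n → d j * d (bar n j) = k) :
    act23 (Rhat P p q n z) * (dg A n d ⊗ₖ (dg A n d ⊗ₖ dg A n d)) =
      (dg A n d ⊗ₖ (dg A n d ⊗ₖ dg A n d)) * act23 (Rhat P p q n z) := by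
  rw [act23, ← mul_kronecker_mul, ← mul_kronecker_mul, Rhat_dg P hp hq z hd, one_mul, mul_one]

end Intertwine

/-! ### The braid relation by degeneration. -/

section Braid

open Matrix

variable {K : Type*} [Field K] [Algebra ℂ K] (P : Params K) {A : Type*} [CommRing A] [Algebra K A]
  {n : ℕ} (p q : K)

theorem mul_three_intertwine {B : Type*} [Semiring B] {a b c X₀ X₁ X₂ X₃ : B}
    (h1 : c * X₀ = X₁ * c) (h2 : b * X₁ = X₂ * b) (h3 : a * X₂ = X₃ * a) :
    a * b * c * X₀ = X₃ * (a * b * c) := by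
  rw [mul_assoc, h1, ← mul_assoc, mul_assoc a, h2, ← mul_assoc, h3, mul_assoc, mul_assoc, mul_assoc]

/-- The difference of the two sides of the braid relation. -/
def braidDefect (n : ℕ) (x y : A) :
    Matrix (Fin (2 * n) × Fin (2 * n) × Fin (2 * n)) (Fin (2 * n) × Fin (2 * n) × Fin (2 * n)) A :=
  act12 (Rhat P p q n y) * act23 (Rhat P p q n (x * y)) * act12 (Rhat P p q n x)
    - act23 (Rhat P p q n x) * act12 (Rhat P p q n (x * y)) * act23 (Rhat P p q n y)

theorem braidDefect_map {B : Type*} [CommRing B] [Algebra K B] (φ : A →ₐ[K] B) (x y : A) :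
    (braidDefect P p q n x y).map φ = braidDefect P p q n (φ x) (φ y) := by
  have h12 : ∀ z : A, (act12 (Rhat P p q n z)).map φ = act12 (Rhat P p q n (φ z)) := fun z => by
    rw [← Rhat_map]; exact act12_map φ.toRingHom _
  have h23 : ∀ z : A, (act23 (Rhat P p q n z)).map φ = act23 (Rhat P p q n (φ z)) := fun z => by
    rw [← Rhat_map]; exact act23_map φ.toRingHom _
  rw [braidDefect, braidDefect, Matrix.map_sub _ (map_sub φ), Matrix.map_mul, Matrix.map_mul,
    Matrix.map_mul, Matrix.map_mul, h12, h12, h12, h23, h23, h23, map_mul]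

variable {P p q} (hp : p ^ 2 = P.r) (hq : q ^ 2 = P.s)
include hp hq

/-- The parameters are proportional to (u, v, w). Both sides of the braid relation reverse their
order, by the two reduced words of the longest permutation, so the difference intertwines the same
pair of actions. -/
theorem braidDefect_tripleE (hn : 3 ≤ n) (x y γ : A) {i : ℕ} (hi : i ≤ n) :
    braidDefect P p q n x y * tripleE P A n i (γ * (x * y)) (γ * y) γ =
      tripleE P A n i γ (γ * y) (γ * (x * y)) * braidDefect P p q n x y := by
  have e : γ * (x * y) = γ * y * x := by ring
  rw [braidDefect, sub_mul, mul_sub]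
  congr 1
  · exact mul_three_intertwine (act12_tripleE hp hq hn e γ hi) (act23_tripleE hp hq hn rfl _ hi)
      (act12_tripleE hp hq hn rfl _ hi)
  · exact mul_three_intertwine (act23_tripleE hp hq hn rfl _ hi) (act12_tripleE hp hq hn rfl _ hi)
      (act23_tripleE hp hq hn e _ hi)

theorem braidDefect_tripleF (hn : 3 ≤ n) (x y α : A) {i : ℕ} (hi : i ≤ n) :
    braidDefect P p q n x y * tripleF P A n i α (α * x) (α * (x * y)) =
      tripleF P A n i (α * (x * y)) (α * x) α * braidDefect P p q n x y := by
  have e : α * (x * y) = α * x * y := by ring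
  rw [braidDefect, sub_mul, mul_sub]
  congr 1
  · exact mul_three_intertwine (act12_tripleF hp hq hn rfl _ hi) (act23_tripleF hp hq hn rfl _ hi)
      (act12_tripleF hp hq hn e _ hi)
  · exact mul_three_intertwine (act23_tripleF hp hq hn e _ hi) (act12_tripleF hp hq hn rfl _ hi)
      (act23_tripleF hp hq hn rfl _ hi)

theorem braidDefect_dg (x y : A) {d : ℕ → K} {k : K}
    (hd : ∀ j, 1 ≤ j → j ≤ 2 * n → d j * d (bar n j) = k) :
    braidDefect P p q n x y * (dg A n d ⊗ₖ (dg A n d ⊗ₖ dg A n d)) =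
      (dg A n d ⊗ₖ (dg A n d ⊗ₖ dg A n d)) * braidDefect P p q n x y := by
  rw [braidDefect, sub_mul, mul_sub]
  congr 1
  · exact mul_three_intertwine (act12_dg hp hq _ hd) (act23_dg hp hq _ hd) (act12_dg hp hq _ hd)
  · exact mul_three_intertwine (act23_dg hp hq _ hd) (act12_dg hp hq _ hd) (act23_dg hp hq _ hd)

/-- Each factor acts on this vector by a scalar, and the two sides involve the same three scalars.
-/
theorem braidDefect_stdv (x y : A) (j : Fin (2 * n)) :
    braidDefect P p q n x y *ᵥ tens (stdv A j) (stdv A j) (stdv A j) = 0 := by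
  have h12 := fun z : A => act12_stdv ((Rhat_isVertex P hp hq z).diag j)
  have h23 := fun z : A => act23_stdv ((Rhat_isVertex P hp hq z).diag j)
  rw [braidDefect, sub_mulVec]
  simp only [← mulVec_mulVec, h12, h23, mulVec_smul, smul_smul]
  rw [sub_eq_zero]
  congr 1
  ring

open Polynomial in
-- Scaling both ratios by t makes u/v and v/w vanish at t = 0, which separates the three factors as
-- far as e_0 and f_0 are concerned.
theorem braidDefect_polynomial (hn : 3 ≤ n) (x y : K) :
    braidDefect P p q n (C x * X : K[X]) (C y * X) = 0 := by
  have hmap : ∀ Y : Matrix (Fin (2 * n) × Fin (2 * n) × Fin (2 * n))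
      (Fin (2 * n) × Fin (2 * n) × Fin (2 * n)) K[X],
      Y.map (evalRingHom (0 : K)) = Y.map (aeval (0 : K) : K[X] →ₐ[K] K) := fun Y => by
    ext; simp [coe_aeval_eq_eval]
  have hdiag : ∀ d : ℕ → K, (dg K[X] n d).map (aeval (0 : K) : K[X] →ₐ[K] K) = dg K n d :=
    fun d => dg_map _ n d
  refine eq_zero_of_specialization _
    (Set.range fun j => tens (stdv K j) (stdv K j) (stdv K j)) ?_ fun M hM hv => ?_
  · rintro _ ⟨j, rfl⟩
    convert braidDefect_stdv hp hq (C x * X : K[X]) (C y * X) j using 2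
    change (fun i => C (tens (stdv K j) (stdv K j) (stdv K j) i)) = _
    rw [stdv_tens, stdv_tens]
    funext i
    rw [Pi.single_apply, Pi.single_apply, apply_ite C, C_1, C_0]
  simp only [hmap] at hM
  have hdg : ∀ (d : ℕ → K) (k : K), (∀ j, 1 ≤ j → j ≤ 2 * n → d j * d (bar n j) = k) →
      ∃ Y, M * (dg K n d ⊗ₖ (dg K n d ⊗ₖ dg K n d)) = Y * M := fun d k hd => by
    have := hM _ _ (braidDefect_dg hp hq (C x * X : K[X]) (C y * X) hd)
    rw [kronecker_map, kronecker_map, hdiag] at this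
    exact ⟨_, this⟩
  refine eq_zero_of_degenerate_relations P hn M (fun i hi => ?_) (fun i hi => ?_)
    (fun i hi => ?_) (fun i hi => ?_) fun j => hv _ ⟨j, rfl⟩
  -- With γ = 1 the parameters of e_0 are (xyt², yt, 1), which become (0, 0, 1).
  · have := hM _ _ (braidDefect_tripleE hp hq hn (C x * X : K[X]) (C y * X) 1 hi)
    refine ⟨_, Eq.trans ?_ this⟩
    congr 1
    rw [tripleE]
    refine Eq.trans ?_ (triE_map (aeval (0 : K) : K[X] →ₐ[K] K).toRingHom _ _ _ _ _).symm
    change _ = triE ((matE P n (1 : K[X]) i).map (aeval (0 : K) : K[X] →ₐ[K] K))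
      ((dg K[X] n _).map (aeval (0 : K) : K[X] →ₐ[K] K)) (aeval (0 : K) _) (aeval (0 : K) _)
      (aeval (0 : K) _)
    rw [matE_map, hdiag, kz_map, kz_map, kz_map]
    simp [kz, dg]
    rfl
  -- Those of f_0 are (1, xt, xyt²), which become (1, 0, 0).
  · have := hM _ _ (braidDefect_tripleF hp hq hn (C x * X : K[X]) (C y * X) 1 hi)
    refine ⟨_, Eq.trans ?_ this⟩
    congr 1
    rw [tripleF]
    refine Eq.trans ?_ (triF_map (aeval (0 : K) : K[X] →ₐ[K] K).toRingHom _ _ _ _ _).symm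
    change _ = triF ((matF P n (1 : K[X]) i).map (aeval (0 : K) : K[X] →ₐ[K] K))
      ((dg K[X] n _).map (aeval (0 : K) : K[X] →ₐ[K] K)) (aeval (0 : K) _) (aeval (0 : K) _)
      (aeval (0 : K) _)
    rw [matF_map, hdiag, kz_map, kz_map, kz_map]
    simp [kz, dg]
    rfl
  · refine hdg (fun j => (wVal P n 1 i j)⁻¹) 1 fun j h1 h2 => ?_
    rw [← mul_inv, wVal_mul_bar P hn hi 1 h1 h2]
    simp
  · refine hdg (fun j => (wVal' P n 1 i j)⁻¹) 1 fun j h1 h2 => ?_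
    rw [← mul_inv, wVal'_mul_bar P hn hi 1 h1 h2]
    simp

/-- The braid relation. -/
theorem Rhat_braid (hn : 3 ≤ n) (x y : K) :
    leg12 (Rhat P p q n y) * leg23 (Rhat P p q n (x * y)) * leg12 (Rhat P p q n x) =
      leg23 (Rhat P p q n x) * leg12 (Rhat P p q n (x * y)) * leg23 (Rhat P p q n y) := by
  -- The value t = 1 restores the given x and y.
  have h := congrArg (fun M => M.map (Polynomial.aeval (1 : K) : Polynomial K →ₐ[K] K))
    (braidDefect_polynomial hp hq hn x y)
  simp only [braidDefect_map, map_mul, Polynomial.aeval_C, Polynomial.aeval_X, mul_one,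
    Algebra.algebraMap_self, RingHom.id_apply] at h
  rw [Matrix.map_zero _ (map_zero _)] at h
  exact sub_eq_zero.1 h

end Braid

/-! ### From the braid relation to the Yang–Baxter equation. -/

section Flip

open Matrix

set_option linter.unusedSectionVars false

variable {K N : Type*} [Field K] [Fintype N] [DecidableEq N]

/-- The exchange of the first two indices. -/
def swap12 (x : N × N × N) : N × N × N := (x.2.1, x.1, x.2.2)

/-- The exchange of the last two indices. -/
def swap23 (x : N × N × N) : N × N × N := (x.1, x.2.2, x.2.1)

theorem leg12_mul (M M' : Matrix (N × N) (N × N) K) : leg12 (M * M') = leg12 M * leg12 M' := by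
  have := assoc12_mul M M' (1 : Matrix N N K) 1
  rw [one_mul] at this
  exact this.symm

theorem leg23_mul (M M' : Matrix (N × N) (N × N) K) : leg23 (M * M') = leg23 M * leg23 M' := by
  rw [leg23, leg23, leg23, ← mul_kronecker_mul, one_mul]

theorem leg12_flip_apply (x y : N × N × N) :
    leg12 (flipMat K N) x y = if swap12 x = y then 1 else 0 := by
  obtain ⟨a, b, c⟩ := x
  obtain ⟨a', b', c'⟩ := y
  change flipMat K N (a, b) (a', b') * (1 : Matrix N N K) c c' = _
  by_cases h1 : a = b' <;> by_cases h2 : b = a' <;> by_cases h3 : c = c' <;>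
    simp [flipMat, swap12, Matrix.one_apply, h1, h2, h3]

theorem leg23_flip_apply (x y : N × N × N) :
    leg23 (flipMat K N) x y = if swap23 x = y then 1 else 0 := by
  obtain ⟨a, b, c⟩ := x
  obtain ⟨a', b', c'⟩ := y
  change (1 : Matrix N N K) a a' * flipMat K N (b, c) (b', c') = _
  by_cases h1 : a = a' <;> by_cases h2 : b = c' <;> by_cases h3 : c = b' <;>
    simp [flipMat, swap23, Matrix.one_apply, h1, h2, h3]

theorem leg12_flip_mul (M : Matrix (N × N × N) (N × N × N) K) (x y : N × N × N) :
    (leg12 (flipMat K N) * M) x y = M (swap12 x) y := by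
  simp [Matrix.mul_apply, leg12_flip_apply]

theorem leg23_flip_mul (M : Matrix (N × N × N) (N × N × N) K) (x y : N × N × N) :
    (leg23 (flipMat K N) * M) x y = M (swap23 x) y := by
  simp [Matrix.mul_apply, leg23_flip_apply]

theorem mul_leg12_flip (M : Matrix (N × N × N) (N × N × N) K) (x y : N × N × N) :
    (M * leg12 (flipMat K N)) x y = M x (swap12 y) := by
  have h : ∀ z : N × N × N, swap12 z = y ↔ z = swap12 y := fun z =>
    ⟨fun h => by rw [← h]; rfl, fun h => by rw [h]; rfl⟩
  simp [Matrix.mul_apply, leg12_flip_apply, h]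

theorem mul_leg23_flip (M : Matrix (N × N × N) (N × N × N) K) (x y : N × N × N) :
    (M * leg23 (flipMat K N)) x y = M x (swap23 y) := by
  have h : ∀ z : N × N × N, swap23 z = y ↔ z = swap23 y := fun z =>
    ⟨fun h => by rw [← h]; rfl, fun h => by rw [h]; rfl⟩
  simp [Matrix.mul_apply, leg23_flip_apply, h]

theorem leg23_flip_sq : leg23 (flipMat K N) * leg23 (flipMat K N) = 1 := by
  ext x y
  rw [leg23_flip_mul, leg23_flip_apply, Matrix.one_apply]
  rfl

theorem leg_flip_braid : leg12 (flipMat K N) * leg23 (flipMat K N) * leg12 (flipMat K N) =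
    leg23 (flipMat K N) * leg12 (flipMat K N) * leg23 (flipMat K N) := by
  ext x y
  rw [mul_assoc, mul_assoc, leg12_flip_mul, leg23_flip_mul, leg12_flip_apply, leg23_flip_mul,
    leg12_flip_mul, leg23_flip_apply]
  rfl

/-- The product of the two flips is a cyclic permutation of the factors, which carries the first
pair to the last pair. -/
theorem flip_leg12 (M : Matrix (N × N) (N × N) K) :
    leg12 (flipMat K N) * leg23 (flipMat K N) * leg12 M =
      leg23 M * leg12 (flipMat K N) * leg23 (flipMat K N) := by
  ext x y
  rw [mul_assoc, leg12_flip_mul, leg23_flip_mul, mul_leg23_flip, mul_leg12_flip]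
  exact mul_comm _ _

theorem flip_leg23 (M : Matrix (N × N) (N × N) K) :
    leg23 (flipMat K N) * leg12 (flipMat K N) * leg23 M =
      leg12 M * leg23 (flipMat K N) * leg12 (flipMat K N) := by
  ext x y
  rw [mul_assoc, leg23_flip_mul, leg12_flip_mul, mul_leg12_flip, mul_leg23_flip]
  exact mul_comm _ _

/-- The braid relation for `M τ` in the form of the Yang–Baxter equation. -/
theorem yangBaxter_of_braid {L M S : Matrix (N × N) (N × N) K}
    (h : leg12 L * leg23 M * leg12 S = leg23 S * leg12 M * leg23 L) :
    leg12 (L * flipMat K N) * leg13 (M * flipMat K N) * leg23 (S * flipMat K N) =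
      leg23 (S * flipMat K N) * leg13 (M * flipMat K N) * leg12 (L * flipMat K N) := by
  rw [leg13, leg12_mul, leg12_mul, leg23_mul]
  set f := leg12 (flipMat K N)
  set g := leg23 (flipMat K N)
  have hg : g * g = 1 := leg23_flip_sq
  have hb : f * g * f = g * f * g := leg_flip_braid
  have h1 : ∀ M : Matrix (N × N) (N × N) K, f * g * leg12 M = leg23 M * f * g := flip_leg12
  have h2 : ∀ M : Matrix (N × N) (N × N) K, g * f * leg23 M = leg12 M * g * f := flip_leg23
  -- All flips are moved to the right, where they form f g f = g f g. What stands to their left is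
  -- then one side of the braid relation, and the flips are distributed again after it has been
  -- applied.
  calc leg12 L * f * (g * (leg12 M * f) * g) * (leg23 S * g)
      = leg12 L * (f * g * leg12 M) * f * g * leg23 S * g := by noncomm_ring
    _ = leg12 L * leg23 M * (f * g * f) * g * leg23 S * g := by rw [h1]; noncomm_ring
    _ = leg12 L * leg23 M * (g * f) * (g * g) * leg23 S * g := by rw [hb]; noncomm_ring
    _ = leg12 L * leg23 M * (g * f * leg23 S) * g := by rw [hg]; noncomm_ring
    _ = leg12 L * leg23 M * leg12 S * (g * f * g) := by rw [h2]; noncomm_ring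
    _ = leg23 S * leg12 M * leg23 L * (f * g * f) := by rw [h, hb]
    _ = leg23 S * leg12 M * (leg23 L * f * g) * f := by noncomm_ring
    _ = leg23 S * leg12 M * (f * g * leg12 L) * f := by rw [h1]
    -- The inserted 1 is rewritten as g g, one copy for the factor of `S` and one for the
    -- conjugation in `leg13`.
    _ = leg23 S * 1 * leg12 M * f * g * leg12 L * f := by noncomm_ring
    _ = leg23 S * g * (g * (leg12 M * f) * g) * (leg12 L * f) := by rw [← hg]; noncomm_ring

end Flip

end TwoParam
end

theorem theorem6p10 {K : Type*} [Field K] [Algebra ℂ K] (P : TwoParam.Params K)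
    (p q : K) (hp : p ^ 2 = P.r) (hq : q ^ 2 = P.s) (n : ℕ) (hn : 3 ≤ n) :
    (∀ a b : Kˣ, (a : K) * b = (P.r * P.s)⁻¹ →
      (∀ x : TwoParam.UAff P n,
        TwoParam.RhatLoop P p q n ∘ₗ TwoParam.tensorRep P hn a b x =
          TwoParam.tensorRep P hn a b x ∘ₗ TwoParam.RhatLoop P p q n) ∧
      (∀ (u v : Kˣ) (x : TwoParam.UAff' P n),
        TwoParam.Rhat P p q n ((u : K) / v) * TwoParam.tensorRep' P hn a b u v x =
          TwoParam.tensorRep' P hn a b v u x * TwoParam.Rhat P p q n ((u : K) / v))) ∧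
    (∀ u v w : Kˣ,
      let Rc : K → Matrix (Fin (2 * n) × Fin (2 * n)) (Fin (2 * n) × Fin (2 * n)) K :=
        fun z => TwoParam.Rhat P p q n z
      let R : K → Matrix (Fin (2 * n) × Fin (2 * n)) (Fin (2 * n) × Fin (2 * n)) K :=
        fun z => TwoParam.Rhat P p q n z * TwoParam.flipMat K (Fin (2 * n))
      TwoParam.leg12 (R (v / w)) * TwoParam.leg13 (R (u / w)) * TwoParam.leg23 (R (u / v)) =
        TwoParam.leg23 (R (u / v)) * TwoParam.leg13 (R (u / w)) * TwoParam.leg12 (R (v / w)) ∧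
      TwoParam.leg12 (Rc (v / w)) * TwoParam.leg23 (Rc (u / w)) * TwoParam.leg12 (Rc (u / v)) =
        TwoParam.leg23 (Rc (u / v)) * TwoParam.leg12 (Rc (u / w)) *
          TwoParam.leg23 (Rc (v / w))) := by
  refine ⟨fun a b hab => ⟨fun x => TwoParam.RhatLoop_tensorRep P hp hq hn hab x,
    fun u v x => TwoParam.Rhat_tensorRep' P hp hq hn hab u v x⟩, fun u v w => ?_⟩
  -- The choice x = u/v, y = v/w makes the middle argument xy = u/w.
  have h := TwoParam.Rhat_braid hp hq hn ((u : K) / v) ((v : K) / w)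
  rw [div_mul_div_cancel₀ v.ne_zero] at h
  exact ⟨TwoParam.yangBaxter_of_braid h, h⟩
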